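/- **Setting.** A school choice problem $P$ consists of finite sets $I$ (students) and $S$ (schools), a strict preference $\succ_i$ of each student over $S\cup\{s_\emptyset\}$ ($s_\emptyset$ = being unassigned), a quota $q_s\in\mathbb N$ and a strict priority order over $I$ for each school $s$. A matching is a map $\mu:I\to S\cup\{s_\emptyset\}$ with $|\mu^{-1}(s)|\le q_s$ for all $s\in S$ that is non-wasteful: if $|\mu^{-1}(s)|<q_s$, then every student weakly prefers $\mu_i$ to $s$. $\mu$ Pareto-dominates $\nu$ if every student weakly and some student strictly prefers $\mu$ to $\nu$; a matching is inefficient if some matching Pareto-dominates it. Let $DA$ be the outcome of student-proposing deferred acceptance. A student is unimprovable if $\mu_i=DA_i$ for every matching $\mu$ that Pareto-dominates $DA$, and improvable otherwise; $\mathcal I$ is the set of improvable students. Let $\mathcal B(\mu)=\{i:\mu_i\succ_i DA_i\}$ be the set of beneficiaries of $\mu$. A matching $\mu$ that Pareto-dominates $DA$ is justifiable if, whenever $i$ prefers a school $s$ to $\mu_i$ and some $j$ with $\mu_j=s$ has lower priority than $i$ at $s$, student $i$ is unimprovable or $i\in\mathcal B(\mu)$. Write $i\to j$ if $DA_j\succ_i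 DA_i$, and let the label $l(i\to j)$ be the set of $h\in\mathcal I$ with $h\to j$ who have higher priority than $i$ at $DA_j$. **JBC.** Let $S^*$ be the set of schools that reject an improvable student during deferred acceptance. For $s\in S^*$ let $i^*_s$ be the highest-priority student at $s$ among the improvable students who prefer $s$ to their $DA$ assignment and have lower priority at $s$ than the lowest-priority student assigned to $s$ under $DA$. Draw the edges $s\to DA_{i^*_s}$ on $S^*$; JBC moves $i^*_s$ to $s$ for every $s$ on a cycle of this digraph, and leaves all other students at their $DA$ assignment. **SJBC+.** For $B\subseteq I$ let $H(B)$ be the bipartite graph on two copies of $\mathcal I$ with the non-loop edges $i\to j$ such that $l(i\to j)\subseteq B$, and with all self-loops $i\to i$. A perfect matching $M$ of $H(B)$ induces the matching that gives each improvable student the $DA$ school of the student she is matched to in $M$, and every other student her $DA$ assignment. *Expansion.* Start with the perfect matching $M^0$ of $H(\emptyset)$ that induces $\mu^0=JBC$. At step $t=1,2,\dots$ put $B^t=\mathcal B(\mu^{t-1})$ and let $M^t$ be a perfect matching of $H(B^t)$ with the largest possible number of non-loop edges among those obtained from $M^{t-1}$ by flipping along disjoint closed alternating paths in $H(B^t)$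 all of whose new edges are non-loop edges; let $\mu^t$ be the matching induced by $M^t$. Stop with $\mu^*=\mu^t$ when $\mathcal B(\mu^t)=B^t$, and put $B^*=\mathcal B(\mu^*)$. *Refinement.* At the current matching $\mu$ (initially $\mu^*$), call a pair $(i,j)$ with $\mu_j\succ_i\mu_i$ admissible if every improvable $h\ne j$ with $\mu_j\succ_h DA_h$ and with higher priority than $i$ at $\mu_j$ belongs to $B^*$. Repeatedly execute a directed cycle of admissible pairs (every student on it receives the school currently assigned to her successor) until no such cycle exists. A matching $\mu^+$ obtained in this way is called an SJBC+ outcome. **Theorem.** If $DA$ is inefficient, then every SJBC+ outcome $\mu^+$ 1. is a matching that Pareto-dominates $DA$; 2. is justifiable; 3. is not Pareto-dominated by any justifiable matching $\mu'$ unless $\mathcal B(\mu^+)\subsetneq\mathcal B(\mu')$; 4. satisfies $\mathcal B(JBC)\subseteq\mathcal B(\mu^+)$. Furthermore, any SJBC+ outcome can be computed in time polynomial in $|I|$ and $|S|$: there is one program of a unit-cost random access machine (with addition, subtraction and tests, without multiplication) which, given $P$ and an auxiliary sequence of numbers that resolves the free selections, always halts within $C(|I|+|S|+1)^k$ steps ($C,k$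 absolute constants) and outputs an SJBC+ outcome, and which outputs every SJBC+ outcome for a suitable auxiliary sequence. -/

import Mathlib

/-! ## School choice problems, matchings, Pareto dominance -/

/-- A many-to-one school choice problem with students `I` and schools `S`. Assignments are elements of
`Option S`, where `none` is the outside option (being unassigned). Strict preferences and strict
priorities are given by (zero-based) rank bijections: a lower rank is better. -/
structure Problem (I S : Type*) [Fintype I] [Fintype S] where
  /-- `pref i x` is the rank of the assignment `x` in the strict preference of student `i`. -/
  pref : I → Option S ≃ Fin (Fintype.card S + 1)
  /-- `prio s i` is the rank of student `i` in the strict priority order of school `s`. -/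
  prio : S → I ≃ Fin (Fintype.card I)
  /-- The quota of each school; the outside option has no quota. -/
  quota : S → ℕ

namespace Problem

variable {I S : Type*} [Fintype I] [Fintype S] (P : Problem I S)

/-- Student `i` strictly prefers `x` to `y`. -/
def Prefers (i : I) (x y : Option S) : Prop := P.pref i x < P.pref i y

/-- Student `i` has strictly higher priority than student `j` at school `s`. -/
def Higher (s : S) (i j : I) : Prop := P.prio s i < P.prio s j

/-- A matching: quotas are respected, and it is non-wasteful, i.e. whenever a school has an empty
seat, every student weakly prefers her assignment to that school. -/
def IsMatching (μ : I → Option S) : Prop :=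
  (∀ s, {i | μ i = some s}.ncard ≤ P.quota s) ∧
  (∀ s, {i | μ i = some s}.ncard < P.quota s → ∀ i, ¬ P.Prefers i (some s) (μ i))

/-- `μ` Pareto-dominates `ν`. -/
def ParetoDominates (μ ν : I → Option S) : Prop :=
  (∀ i, P.pref i (μ i) ≤ P.pref i (ν i)) ∧ ∃ i, P.Prefers i (μ i) (ν i)

/-- `μ` is not Pareto-dominated by any matching. -/
def ParetoEfficient (μ : I → Option S) : Prop :=
  ¬ ∃ ν, P.IsMatching ν ∧ P.ParetoDominates ν μ

/-- Under `μ`, student `j` violates the priority of student `i` at the school `s`. -/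
def Violates (μ : I → Option S) (j i : I) (s : S) : Prop :=
  P.Prefers i (some s) (μ i) ∧ μ j = some s ∧ P.Higher s i j

/-! ## Student-proposing deferred acceptance

The state of the algorithm is the set `R` of pairs `(i, s)` such that `s` has already rejected `i`. -/

/-- `x` has not rejected `i` (the outside option never rejects). -/
def Available (R : Set (I × S)) (i : I) (x : Option S) : Prop := ∀ s, x = some s → (i, s) ∉ R

/-- `x` is the best assignment that has not rejected `i`: she applies to `x`, or is held there. -/
def Applies (R : Set (I × S)) (i : I) (x : Option S) : Prop :=
  Available R i x ∧ ∀ y, Available R i y → P.pref i x ≤ P.pref i y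

/-- One round: every school keeps its highest-priority applicants (those held from the previous round
included) up to its quota, and rejects the others. -/
def daRound (R : Set (I × S)) : Set (I × S) :=
  R ∪ {p | P.Applies R p.1 (some p.2) ∧
    P.quota p.2 ≤ {j | P.Applies R j (some p.2) ∧ P.Higher p.2 j p.1}.ncard}

/-- All rejections that occur during the execution of deferred acceptance. -/
def daRejected : Set (I × S) := ⋃ k : ℕ, P.daRound^[k] ∅

theorem exists_applies (R : Set (I × S)) (i : I) : ∃ x, P.Applies R i x := by
  classical
  obtain ⟨x, hx, hmin⟩ := Finset.exists_min_image
    (Finset.univ.filter fun x : Option S => Available R i x) (P.pref i)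
    ⟨none, Finset.mem_filter.2 ⟨Finset.mem_univ _, fun s h => by simp at h⟩⟩
  exact ⟨x, by simpa using hx, fun y hy => hmin y (by simpa using hy)⟩

/-- The deferred acceptance matching: everybody gets the best assignment that has not rejected her. -/
noncomputable def da (i : I) : Option S := (P.exists_applies P.daRejected i).choose

/-! ## Improvability, beneficiaries, justifiability -/

/-- The matchings that Pareto-dominate the deferred acceptance matching. -/
def Improvements : Set (I → Option S) := {μ | P.IsMatching μ ∧ P.ParetoDominates μ P.da}

/-- Students who keep their assignment in every improvement. -/
def unimprovable : Set I := {i | ∀ μ ∈ P.Improvements, μ i = P.da i}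

/-- All other students. -/
def improvable : Set I := P.unimprovableᶜ

/-- Students who strictly gain relative to deferred acceptance. -/
def beneficiaries (μ : I → Option S) : Set I := {i | P.Prefers i (μ i) (P.da i)}

/-- `μ` is an improvement, and every priority violation under `μ` is against an unimprovable student
or a beneficiary of `μ`. -/
def Justifiable (μ : I → Option S) : Prop :=
  μ ∈ P.Improvements ∧
  ∀ i j s, P.Violates μ j i s → i ∈ P.unimprovable ∪ P.beneficiaries μ

/-! ## Envy digraph and labels -/

/-- Edge `i → j` of the envy digraph of `μ`. -/
def Envies (μ : I → Option S) (i j : I) : Prop := P.Prefers i (μ j) (μ i)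

/-- The label of the edge `i → j` of the envy digraph of deferred acceptance: the improvable students
who envy `j` and have higher priority than `i` at the school of `j`. -/
def label (i j : I) : Set I :=
  {h | h ∈ P.improvable ∧ P.Envies P.da h j ∧ ∃ s, P.da j = some s ∧ P.Higher s h i}

/-! ## The Just-Below-Cutoffs mechanism -/

/-- Schools that reject an improvable student during the execution of deferred acceptance. -/
def rejectingSchools : Set S := {s | ∃ i ∈ P.improvable, (i, s) ∈ P.daRejected}

/-- `c` is the lowest-priority student assigned to `s` under deferred acceptance. -/
def IsCutoff (s : S) (c : I) : Prop :=
  P.da c = some s ∧ ∀ j, P.da j = some s → P.prio s j ≤ P.prio s c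

/-- The below-cutoff set of `s`. -/
def belowCutoff (s : S) : Set I :=
  {i | i ∈ P.improvable ∧ P.Prefers i (some s) (P.da i) ∧ ∃ c, P.IsCutoff s c ∧ P.Higher s c i}

/-- `i` is the just-below-cutoff student at `s`. -/
def IsJustBelow (s : S) (i : I) : Prop :=
  i ∈ P.belowCutoff s ∧ ∀ j ∈ P.belowCutoff s, P.prio s i ≤ P.prio s j

/-- The school digraph: `s` points to the school held by its just-below-cutoff student. -/
def SchoolEdge (s s' : S) : Prop :=
  s ∈ P.rejectingSchools ∧ s' ∈ P.rejectingSchools ∧ ∃ i, P.IsJustBelow s i ∧ P.da i = some s'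

/-- `s` lies on a cycle of the school digraph (all out-degrees are at most one). -/
def OnSchoolCycle (s : S) : Prop := Relation.TransGen P.SchoolEdge s s

open Classical in
/-- All cycles are executed: the just-below-cutoff student of every school `s` on a cycle moves to
`s`. As the school digraph is functional, a student is just below cutoff for at most one school lying
on a cycle. -/
noncomputable def jbc (i : I) : Option S :=
  if h : ∃ s, P.OnSchoolCycle s ∧ P.IsJustBelow s i then some h.choose else P.da i

/-! ## The sequential mechanism: expansion phase

A perfect matching of the bipartite graph with self-loops is a permutation `σ` of the students (the
left copy of `i` is matched to the right copy of `σ i`); it fixes every student that is not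
improvable. -/

/-- The non-loop edges of the bipartite graph for the set `B`: edges `i → j` of the envy digraph of
deferred acceptance between improvable students, with label contained in `B`. -/
def ExpEdge (B : Set I) (i j : I) : Prop :=
  i ∈ P.improvable ∧ j ∈ P.improvable ∧ P.Envies P.da i j ∧ P.label i j ⊆ B

/-- `σ` is a perfect matching of the bipartite graph for `B` augmented with all self-loops. -/
def IsPerfect (B : Set I) (σ : Equiv.Perm I) : Prop := ∀ i, σ i = i ∨ P.ExpEdge B i (σ i)

/-- The matching induced by `σ`: `i` receives the deferred acceptance school of `σ i`. -/
noncomputable def induced (σ : Equiv.Perm I) (i : I) : Option S := P.da (σ i)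

/-- The perfect matching `σ'` is obtained from `σ` by flipping along disjoint closed paths that
alternate between new non-loop edges of the bipartite graph for `B` and edges of `σ` (self-loops
included). These closed paths are the cycles of the permutation `σ⁻¹ * σ'`. -/
def IsRerouting (B : Set I) (σ σ' : Equiv.Perm I) : Prop :=
  P.IsPerfect B σ' ∧ ∀ i, σ' i ≠ σ i → P.ExpEdge B i (σ' i)

/-- One expansion iteration from `σ`: a rerouting of `σ`, in the bipartite graph for the current
beneficiaries, with the maximum number of non-loop edges. -/
def ExpansionStep (σ σ' : Equiv.Perm I) : Prop :=
  P.IsRerouting (P.beneficiaries (P.induced σ)) σ σ' ∧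
  ∀ τ, P.IsRerouting (P.beneficiaries (P.induced σ)) σ τ →
    {i | τ i ≠ i}.ncard ≤ {i | σ' i ≠ i}.ncard

/-- The perfect matchings from which a further expansion iteration is run. -/
inductive ExpansionReached : Equiv.Perm I → Prop
  /-- The initial perfect matching uses empty-labelled edges and induces the JBC matching. -/
  | init (σ : Equiv.Perm I) (hσ : P.IsPerfect ∅ σ) (hjbc : P.induced σ = P.jbc) :
      ExpansionReached σ
  /-- The phase continues as long as the set of beneficiaries changes. -/
  | step (σ σ' : Equiv.Perm I) (h : ExpansionReached σ) (hs : P.ExpansionStep σ σ')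
      (hne : P.beneficiaries (P.induced σ') ≠ P.beneficiaries (P.induced σ)) :
      ExpansionReached σ'

/-- `μ` is the matching at which an expansion phase stops. -/
def IsExpansionOutcome (μ : I → Option S) : Prop :=
  ∃ σ σ', P.ExpansionReached σ ∧ P.ExpansionStep σ σ' ∧
    P.beneficiaries (P.induced σ') = P.beneficiaries (P.induced σ) ∧ μ = P.induced σ'

/-! ## The sequential mechanism: refinement phase -/

/-- The edge `i → j` of the envy digraph of the current matching `μ` is admissible. -/
def Admissible (B : Set I) (μ : I → Option S) (i j : I) : Prop :=
  P.Envies μ i j ∧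
  ∀ h ∈ P.improvable, h ≠ j → P.Prefers h (μ j) (P.da h) →
    (∃ s, μ j = some s ∧ P.Higher s h i) → h ∈ B

/-- `μ'` results from `μ` by executing one directed cycle `c` of admissible edges: every student on
the cycle receives the school currently assigned to her successor. -/
def RefineStep (B : Set I) (μ μ' : I → Option S) : Prop :=
  ∃ c : Equiv.Perm I, c.IsCycle ∧ (∀ i, c i ≠ i → P.Admissible B μ i (c i)) ∧ μ' = μ ∘ c

/-- `μ` can be produced by the SJBC+ procedure. -/
def IsSJBCPlusOutcome (μ : I → Option S) : Prop :=
  ∃ μs, P.IsExpansionOutcome μs ∧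
    Relation.ReflTransGen (P.RefineStep (P.beneficiaries μs)) μs μ ∧
    ∀ μ', ¬ P.RefineStep (P.beneficiaries μs) μ μ'

end Problem

/-! ## A random access machine with unit-cost instructions

A structured language over natural numbers: finitely many instructions, indirect addressing into
two-dimensional arrays, addition, truncated subtraction, tests and loops; no multiplication. -/

namespace Ram

/-- The memory: registers `reg x`, and cells `arr a i j` of arrays `a`. -/
structure Memory where
  reg : ℕ → ℕ
  arr : ℕ → ℕ → ℕ → ℕ

/-- Expressions. -/
inductive Expr where
  | lit (c : ℕ)
  | reg (x : ℕ)
  | read (a : ℕ) (e₁ e₂ : Expr)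
  | add (e₁ e₂ : Expr)
  | sub (e₁ e₂ : Expr)

/-- Value of an expression. -/
def Expr.eval (m : Memory) : Expr → ℕ
  | .lit c => c
  | .reg x => m.reg x
  | .read a e₁ e₂ => m.arr a (e₁.eval m) (e₂.eval m)
  | .add e₁ e₂ => e₁.eval m + e₂.eval m
  | .sub e₁ e₂ => e₁.eval m - e₂.eval m

/-- Number of elementary operations needed to evaluate an expression. -/
def Expr.cost : Expr → ℕ
  | .lit _ => 1
  | .reg _ => 1
  | .read _ e₁ e₂ => e₁.cost + e₂.cost + 1
  | .add e₁ e₂ => e₁.cost + e₂.cost + 1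
  | .sub e₁ e₂ => e₁.cost + e₂.cost + 1

/-- Programs. A test succeeds if its expression is nonzero. -/
inductive Program where
  | skip
  | assign (x : ℕ) (e : Expr)
  | store (a : ℕ) (e₁ e₂ e : Expr)
  | seq (p q : Program)
  | cond (e : Expr) (p q : Program)
  | loop (e : Expr) (p : Program)

/-- `reg x := v`. -/
def Memory.setReg (m : Memory) (x v : ℕ) : Memory :=
  ⟨fun x' => if x' = x then v else m.reg x', m.arr⟩

/-- `arr a i j := v`. -/
def Memory.setArr (m : Memory) (a i j v : ℕ) : Memory :=
  ⟨m.reg, fun a' i' j' => if a' = a ∧ i' = i ∧ j' = j then v else m.arr a' i' j'⟩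

/-- `Exec p m t m'`: started in memory `m`, the program `p` halts after `t` steps in memory `m'`. -/
inductive Exec : Program → Memory → ℕ → Memory → Prop
  | skip (m : Memory) : Exec .skip m 1 m
  | assign (x : ℕ) (e : Expr) (m : Memory) :
      Exec (.assign x e) m (e.cost + 1) (m.setReg x (e.eval m))
  | store (a : ℕ) (e₁ e₂ e : Expr) (m : Memory) :
      Exec (.store a e₁ e₂ e) m (e₁.cost + e₂.cost + e.cost + 1)
        (m.setArr a (e₁.eval m) (e₂.eval m) (e.eval m))
  | seq (p q : Program) (m m₁ m₂ : Memory) (t₁ t₂ : ℕ)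
      (h₁ : Exec p m t₁ m₁) (h₂ : Exec q m₁ t₂ m₂) : Exec (.seq p q) m (t₁ + t₂) m₂
  | condTrue (e : Expr) (p q : Program) (m m' : Memory) (t : ℕ) (he : e.eval m ≠ 0)
      (h : Exec p m t m') : Exec (.cond e p q) m (e.cost + 1 + t) m'
  | condFalse (e : Expr) (p q : Program) (m m' : Memory) (t : ℕ) (he : e.eval m = 0)
      (h : Exec q m t m') : Exec (.cond e p q) m (e.cost + 1 + t) m'
  | loopDone (e : Expr) (p : Program) (m : Memory) (he : e.eval m = 0) :
      Exec (.loop e p) m (e.cost + 1) m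
  | loopStep (e : Expr) (p : Program) (m m₁ m₂ : Memory) (t₁ t₂ : ℕ) (he : e.eval m ≠ 0)
      (h₁ : Exec p m t₁ m₁) (h₂ : Exec (.loop e p) m₁ t₂ m₂) :
      Exec (.loop e p) m (e.cost + 1 + t₁ + t₂) m₂

/-- Code of an assignment: schools are numbered `0, …, m - 1`, the outside option is `m`. -/
def code {m : ℕ} : Option (Fin m) → ℕ
  | none => m
  | some s => s

/-- Initial memory for a problem with `n` students and `m` schools. Register `0` holds `n`, register
`1` holds `m`; array `0` holds the preference ranks, array `1` the priority ranks, array `2` (column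
`0`) the quotas, and array `3` the numbers `w` that resolve the free selections of the procedure.
Everything else is `0`. -/
def input {n m : ℕ} (P : Problem (Fin n) (Fin m)) (w : ℕ → ℕ → ℕ) : Memory where
  reg x := if x = 0 then n else if x = 1 then m else 0
  arr a i j :=
    if a = 0 then
      if h : i < n then
        if hj : j < m then P.pref ⟨i, h⟩ (some ⟨j, hj⟩)
        else if j = m then P.pref ⟨i, h⟩ none else 0
      else 0
    else if a = 1 then
      if h : i < m ∧ j < n then P.prio ⟨i, h.1⟩ ⟨j, h.2⟩ else 0
    else if a = 2 then
      if h : i < m ∧ j = 0 then P.quota ⟨i, h.1⟩ else 0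
    else if a = 3 then w i j
    else 0

/-- The final memory holds the matching `μ` in column `0` of array `4`. -/
def Outputs {n m : ℕ} (M : Memory) (μ : Fin n → Option (Fin m)) : Prop :=
  ∀ i : Fin n, M.arr 4 i 0 = code (μ i)

end Ram

/-!
Two things have to be shown: the outcomes of the procedure have the four properties, and the
procedure, with all its free selections, runs in polynomial time.

*Properties.* A matching that weakly improves on deferred acceptance permutes its seats: since
deferred acceptance is non-wasteful, no school gains students (`ncard_eq_of_weak_improvement`). Hence
improvements are permutations that move students along envy edges, and the improvable students are
those on cycles of the envy digraph (`mem_improvable_iff`). A perfect matching `σ` all of whose edges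
have labels consisting of its own beneficiaries (`SelfPerfect`) is justifiable: whoever takes a seat
in violation of the priority of an improvable student has used an edge whose label contains that
student (`IsRerouting.mem_of_violates`). The Just-Below-Cutoffs matching is of this kind, as its edges
have empty labels (`isPerfect_jbcPerm`), and it moves somebody if deferred acceptance is inefficient.
In an expansion step nobody who has moved returns to her own seat, so beneficiaries only increase.
The refinement phase keeps the set `B` of beneficiaries at the end of the expansion phase, because
each of its steps is a rerouting in the last bipartite graph, where the number of non-loop edges is
maximal (`RefineInvariant.refineStep`). If a justifiable `μ'` Pareto-dominated the outcome without
new beneficiaries, the permutation leading from the outcome to `μ'` would consist of admissible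
edges, so that the refinement phase could not have stopped
(`Problem.IsSJBCPlusOutcome.properties`).

*Algorithm.* An expansion step asks for a permutation of maximal weight, where the weights are `0` and
`1`. It is found by augmentation. Whether an improving permutation exists is decided by a
Bellman–Ford-like computation of levels (`reachesTop_iff`): if there is none, levels are bounded by
the gains of simple paths and thus remain below the number of students; if there is one, bounded
levels would be a potential that excludes it. An improving permutation is then obtained by deleting
pairs one by one as long as one exists: what remains is its graph (`exists_perm_of_thin`). In the
refinement phase, cycles of admissible edges are found from reachability, and the sum of the ranks
decreases with each trade. In each step the numbers `w` propose a result, which is adopted if it is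
eligible and is replaced by a computed one otherwise. So every `w` leads to an outcome
(`isSJBCPlusOutcome_sjbcPlus`), and every outcome is reached for some `w` (`exists_sjbcPlus_eq`).

*Machine.* Programs are not written down explicitly. Functions of the input that a program computes
in polynomial time, with further arguments in registers and arrays (`Ram.Feasible`), are closed under
case distinctions, sums and quantifiers over students and schools, and polynomially many updates of
an array (`Ram.Feasible.fold`). Each notion that enters the algorithm is obtained from the
input by these operations, and so is the outcome (`Ram.Feasible.sjbcPlus`).
-/

/-! ### Inflationary iterations on finite types -/

/-- A chain produced by an inflationary operator on the subsets of a finite type is stationary after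
as many steps as the type has elements. -/
theorem Set.iterate_inflationary_fixed {α : Type*} [Finite α] (F : Set α → Set α)
    (hF : ∀ X, X ⊆ F X) {K : ℕ} (hK : Nat.card α ≤ K) : F (F^[K] ∅) = F^[K] ∅ := by
  by_contra hne
  have hstep : ∀ k ≤ K, F (F^[k] ∅) ≠ F^[k] ∅ := by
    intro k hk h
    apply hne
    obtain ⟨d, rfl⟩ := Nat.exists_eq_add_of_le' hk
    have : F^[d] (F^[k] ∅) = F^[k] ∅ := Function.iterate_fixed h d
    rw [Function.iterate_add_apply, this, h]
  have hcard : ∀ k ≤ K + 1, k ≤ (F^[k] ∅).ncard := by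
    intro k
    induction k with
    | zero => simp
    | succ k ih =>
      intro hk
      have hlt : (F^[k] ∅).ncard < (F^[k + 1] ∅).ncard := by
        rw [Function.iterate_succ_apply']
        exact Set.ncard_lt_ncard ((hF _).ssubset_of_ne (hstep k (by omega)).symm) (Set.toFinite _)
      have := ih (by omega)
      omega
  have h1 := hcard (K + 1) le_rfl
  have h2 := Set.ncard_le_card (F^[K + 1] ∅)
  omega

/-- The same for operators on relations. -/
theorem iterate_inflationary_rel_fixed {α β : Type*} [Fintype α] [Fintype β]
    (F : (α → β → Prop) → α → β → Prop) (hF : ∀ X a b, X a b → F X a b) {K : ℕ}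
    (hK : Fintype.card α * Fintype.card β ≤ K) :
    F (F^[K] fun _ _ => False) = F^[K] fun _ _ => False := by
  let G : Set (α × β) → Set (α × β) := fun X => {p | F (fun a b => (a, b) ∈ X) p.1 p.2}
  have hG : ∀ k, ∀ a b, (a, b) ∈ G^[k] ∅ ↔ (F^[k] fun _ _ => False) a b := by
    intro k
    induction k with
    | zero => simp
    | succ k ih =>
      intro a b
      have : (fun a b => (a, b) ∈ G^[k] ∅) = F^[k] fun _ _ => False := by
        funext a b; exact propext (ih a b)
      rw [Function.iterate_succ_apply', Function.iterate_succ_apply', ← this]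
      rfl
  have hfix := Set.iterate_inflationary_fixed G (fun X p hp => hF _ _ _ hp) (K := K)
    (by rwa [Nat.card_eq_fintype_card, Fintype.card_prod])
  funext a b
  rw [← Function.iterate_succ_apply' F, ← propext (hG (K + 1) a b), ← propext (hG K a b),
    Function.iterate_succ_apply', hfix]

/-! ### Permutations along a relation -/

theorem Equiv.Perm.transGen_of_ne {α : Type*} [Finite α] {r : α → α → Prop} (c : Equiv.Perm α)
    (hc : ∀ x, c x ≠ x → r x (c x)) {x : α} (hx : c x ≠ x) : Relation.TransGen r x x := by
  have hmove : ∀ k : ℕ, c ((c ^ k) x) ≠ (c ^ k) x := by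
    intro k h
    rw [← Equiv.Perm.mul_apply, ← pow_succ', pow_succ, Equiv.Perm.mul_apply] at h
    exact hx ((c ^ k).injective h)
  have hpath : ∀ k : ℕ, Relation.TransGen r x ((c ^ (k + 1)) x) := by
    intro k
    induction k with
    | zero => simpa using Relation.TransGen.single (hc x hx)
    | succ k ih =>
      rw [pow_succ', Equiv.Perm.mul_apply]
      exact ih.tail (hc _ (hmove _))
  have hpos : 0 < orderOf c := orderOf_pos c
  have := hpath (orderOf c - 1)
  rwa [Nat.sub_add_cancel hpos, pow_orderOf_eq_one] at this

theorem Function.exists_iterate_mem_periodicPts {α : Type*} [Finite α] (f : α → α) (x : α) :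
    ∃ k, f^[k] x ∈ Function.periodicPts f := by
  obtain ⟨a, b, hne, h⟩ := Finite.exists_ne_map_eq_of_infinite (fun k : ℕ => f^[k] x)
  wlog hlt : a < b generalizing a b
  · exact this b a hne.symm h.symm (by omega)
  refine ⟨a, Function.mk_mem_periodicPts (n := b - a) (by omega) ?_⟩
  change f^[b - a] (f^[a] x) = f^[a] x
  rw [← Function.iterate_add_apply, Nat.sub_add_cancel hlt.le]
  exact h.symm

open Classical in
/-- The permutation of a finite type that executes all cycles of the functional digraph of `f`: it
is `f` on the periodic points of `f` and the identity elsewhere. -/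
noncomputable def periodicPerm {α : Type*} [Finite α] (f : α → α) : Equiv.Perm α :=
  Equiv.ofBijective (fun x => if x ∈ Function.periodicPts f then f x else x) <| by
    refine Finite.injective_iff_bijective.1 fun x y hxy => ?_
    have hb := Function.bijOn_periodicPts f
    split_ifs at hxy with hx hy hy
    · exact hb.injOn hx hy hxy
    · exact absurd (hxy ▸ hb.mapsTo hx) hy
    · exact absurd (hxy ▸ hb.mapsTo hy) hx
    · exact hxy

open Classical in
theorem periodicPerm_apply {α : Type*} [Finite α] (f : α → α) (x : α) :
    periodicPerm f x = if x ∈ Function.periodicPts f then f x else x := rfl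

theorem periodicPerm_ne {α : Type*} [Finite α] {f : α → α} {x : α} (h : periodicPerm f x ≠ x) :
    x ∈ Function.periodicPts f ∧ periodicPerm f x = f x := by
  rw [periodicPerm_apply] at h ⊢
  split_ifs at h ⊢ with hx
  exacts [⟨hx, rfl⟩, absurd rfl h]

theorem exists_periodicPerm_ne {α : Type*} [Finite α] {f : α → α} {Q : Set α} (hQ : Q.Nonempty)
    (hmaps : Set.MapsTo f Q Q) (hne : ∀ x ∈ Q, f x ≠ x) : ∃ x, periodicPerm f x ≠ x := by
  obtain ⟨x, hx⟩ := hQ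
  obtain ⟨k, hk⟩ := Function.exists_iterate_mem_periodicPts f x
  refine ⟨f^[k] x, ?_⟩
  rw [periodicPerm_apply, if_pos hk]
  exact hne _ (hmaps.iterate k hx)

theorem transGen_apply_iff {α : Type*} (f : α → α) (x y : α) :
    Relation.TransGen (fun a b => f a = b) x y ↔ ∃ k, f^[k + 1] x = y := by
  constructor
  · intro h
    induction h with
    | single h => exact ⟨0, h⟩
    | tail _ h ih =>
      obtain ⟨k, hk⟩ := ih
      exact ⟨k + 1, by rw [Function.iterate_succ_apply', hk, h]⟩
  · rintro ⟨k, rfl⟩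
    induction k with
    | zero => exact .single rfl
    | succ k ih =>
      rw [Function.iterate_succ_apply']
      exact ih.tail rfl

theorem mem_periodicPts_iff_transGen {α : Type*} (f : α → α) (x : α) :
    x ∈ Function.periodicPts f ↔ Relation.TransGen (fun a b => f a = b) x x := by
  rw [transGen_apply_iff]
  constructor
  · rintro ⟨n, hn, h⟩
    exact ⟨n - 1, by rw [Nat.sub_add_cancel hn]; exact h⟩
  · rintro ⟨k, h⟩
    exact Function.mk_mem_periodicPts (Nat.succ_pos k) h

/-- In a finite digraph every vertex on a closed walk is moved by a permutation that moves vertices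
along edges only. The permutation executes a cycle of a map that brings every vertex closer to the
given one. -/
theorem exists_perm_of_transGen {α : Type*} [Finite α] {r : α → α → Prop} (hr : ∀ x, ¬ r x x) {x : α}
    (hx : Relation.TransGen r x x) :
    ∃ c : Equiv.Perm α, (∀ y, c y ≠ y → r y (c y)) ∧ c x ≠ x := by
  classical
  obtain ⟨D, hD0, hDs⟩ : ∃ D : ℕ → α → Prop, (∀ y, D 0 y ↔ y = x) ∧
      ∀ k y, D (k + 1) y ↔ ∃ z, r y z ∧ D k z :=
    ⟨fun k => Nat.rec (fun y => y = x) (fun _ p y => ∃ z, r y z ∧ p z) k,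
      fun _ => Iff.rfl, fun _ _ => Iff.rfl⟩
  have hD : ∀ y, Relation.ReflTransGen r y x ↔ ∃ k, D k y := by
    intro y
    constructor
    · intro h
      induction h using Relation.ReflTransGen.head_induction_on with
      | refl => exact ⟨0, (hD0 _).2 rfl⟩
      | head h _ ih =>
        obtain ⟨k, hk⟩ := ih
        exact ⟨k + 1, (hDs _ _).2 ⟨_, h, hk⟩⟩
    · rintro ⟨k, hk⟩
      induction k generalizing y with
      | zero => obtain rfl := (hD0 _).1 hk; exact .refl
      | succ k ih =>
        obtain ⟨z, hz, h⟩ := (hDs _ _).1 hk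
        exact .head hz (ih z h)
  obtain ⟨y₀, hy₀, hy₀x⟩ := Relation.TransGen.head'_iff.1 hx
  have hnext : ∀ y, ∃ z, (y = x → z = y₀) ∧ (y ≠ x → (∃ k, D k y) → r y z ∧
      ∃ k < sInf {k | D k y}, D k z) ∧ ((¬ ∃ k, D k y) → z = y) := by
    intro y
    by_cases hyx : y = x
    · exact ⟨y₀, fun _ => rfl, fun h => absurd hyx h, fun h => absurd ⟨0, (hD0 _).2 hyx⟩ h⟩
    · by_cases h : ∃ k, D k y
      · have hs : D (sInf {k | D k y}) y := Nat.sInf_mem h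
        obtain ⟨k, hk⟩ : ∃ k, sInf {k | D k y} = k + 1 := by
          refine Nat.exists_eq_succ_of_ne_zero fun h0 => hyx ?_
          rw [h0] at hs
          exact (hD0 _).1 hs
        rw [hk, hDs] at hs
        obtain ⟨z, hz, hzk⟩ := hs
        exact ⟨z, fun h => absurd h hyx, fun _ _ => ⟨hz, k, by omega, hzk⟩, fun h' => absurd h h'⟩
      · exact ⟨y, fun h => absurd h hyx, fun _ h' => absurd h' h, fun _ => rfl⟩
  choose f hf0 hf1 hf2 using hnext
  have hreach : ∀ k y, D k y → ∃ l, f^[l] y = x := by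
    intro k
    induction k using Nat.strong_induction_on with
    | _ k ih =>
      intro y hy
      by_cases hyx : y = x
      · exact ⟨0, hyx⟩
      · obtain ⟨_, k', hk', hz⟩ := hf1 y hyx ⟨k, hy⟩
        obtain ⟨l, hl⟩ := ih k' (hk'.trans_le (Nat.sInf_le hy)) _ hz
        exact ⟨l + 1, hl⟩
  have hper : x ∈ Function.periodicPts f := by
    obtain ⟨k, hk⟩ := (hD y₀).1 hy₀x
    obtain ⟨l, hl⟩ := hreach k y₀ hk
    refine Function.mk_mem_periodicPts (Nat.succ_pos l) ?_
    change f^[l] (f x) = x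
    rw [hf0 x rfl, hl]
  refine ⟨periodicPerm f, fun y hy => ?_, ?_⟩
  · obtain ⟨_, h⟩ := periodicPerm_ne hy
    rw [h] at hy ⊢
    by_cases hyx : y = x
    · rw [hf0 y hyx, hyx]; exact hy₀
    · by_cases hyD : ∃ k, D k y
      · exact (hf1 y hyx hyD).1
      · exact absurd (hf2 y hyD) hy
  · rw [periodicPerm_apply, if_pos hper, hf0 x rfl]
    rintro rfl
    exact hr _ hy₀

/-- Two maps with fibres of equal sizes differ by a permutation, which can be taken to fix the points
where they agree. -/
theorem exists_perm_comp_eq {α β : Type*} [Finite α] {f g : α → β}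
    (h : ∀ b, {a | f a = b}.ncard = {a | g a = b}.ncard) :
    ∃ c : Equiv.Perm α, f = g ∘ c ∧ ∀ a, f a = g a → c a = a := by
  classical
  have := Fintype.ofFinite α
  let p : α → Prop := fun a => f a ≠ g a
  have hfib : ∀ (F : α → β) b, {a | F a = b}.ncard =
      {a | F a = b ∧ p a}.ncard + {a | F a = b ∧ ¬ p a}.ncard := by
    intro F b
    rw [← Set.ncard_union_eq]
    · congr 1; ext a; simp only [Set.mem_ofPred_eq, Set.mem_union]; tauto
    · rw [Set.disjoint_left]; rintro a ⟨_, h1⟩ ⟨_, h2⟩; exact h2 h1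
  have hsub : ∀ (F : α → β) b, Nat.card {a : {a // p a} // F a = b} = {a | F a = b ∧ p a}.ncard := by
    intro F b
    rw [← Nat.card_coe_set_eq]
    refine Nat.card_congr ?_
    exact { toFun := fun a => ⟨a.1.1, a.2, a.1.2⟩, invFun := fun a => ⟨⟨a.1, a.2.2⟩, a.2.1⟩,
            left_inv := fun _ => rfl, right_inv := fun _ => rfl }
  have hcard : ∀ b, Nat.card {a : {a // p a} // f a = b} = Nat.card {a : {a // p a} // g a = b} := by
    intro b
    rw [hsub, hsub]
    have h1 := hfib f b
    have h2 := hfib g b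
    have h3 : {a | f a = b ∧ ¬ p a} = {a | g a = b ∧ ¬ p a} := by
      ext a
      simp only [Set.mem_ofPred_eq, p, not_not]
      constructor
      · rintro ⟨h, h'⟩; exact ⟨h' ▸ h, h'⟩
      · rintro ⟨h, h'⟩; exact ⟨h' ▸ h, h'⟩
    have h4 := h b
    rw [h3] at h1
    omega
  have e : ∀ b, {a : {a // p a} // f a = b} ≃ {a : {a // p a} // g a = b} := fun b =>
    (Finite.card_eq.1 (hcard b)).some
  let E : Equiv.Perm {a // p a} :=
    (Equiv.sigmaFiberEquiv fun a : {a // p a} => f a).symm.trans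
      ((Equiv.sigmaCongrRight e).trans (Equiv.sigmaFiberEquiv fun a : {a // p a} => g a))
  have hE : ∀ a, g (E a) = f a := fun a => (e (f a) ⟨a, rfl⟩).2
  refine ⟨Equiv.Perm.ofSubtype E, ?_, fun a ha => ?_⟩
  · funext a
    by_cases ha : p a
    · simp [Equiv.Perm.ofSubtype_apply_of_mem E ha, hE]
    · simp only [Function.comp, Equiv.Perm.ofSubtype_apply_of_not_mem E ha]
      exact not_not.1 ha
  · exact Equiv.Perm.ofSubtype_apply_of_not_mem E (not_not.2 ha)

/-! ### Deferred acceptance -/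

namespace Problem

variable {I S : Type*} [Fintype I] [Fintype S] (P : Problem I S)

theorem higher_trans {s : S} {i j k : I} (h₁ : P.Higher s i j) (h₂ : P.Higher s j k) :
    P.Higher s i k := lt_trans (α := Fin _) h₁ h₂

theorem prefers_of_ne {i : I} {x y : Option S} (h : P.pref i x ≤ P.pref i y) (hne : x ≠ y) :
    P.Prefers i x y := lt_of_le_of_ne h fun h' => hne ((P.pref i).injective h')

omit [Fintype I] [Fintype S] in
theorem available_mono {R R' : Set (I × S)} (h : R ⊆ R') {i : I} {x : Option S}
    (hx : Available R' i x) : Available R i x := fun s hs hR => hx s hs (h hR)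

theorem applies_unique {R : Set (I × S)} {i : I} {x y : Option S} (hx : P.Applies R i x)
    (hy : P.Applies R i y) : x = y :=
  (P.pref i).injective (le_antisymm (hx.2 y hy.1) (hy.2 x hx.1))

theorem applies_of_subset {R R' : Set (I × S)} (h : R ⊆ R') {i : I} {x : Option S}
    (hx : P.Applies R i x) (hav : Available R' i x) : P.Applies R' i x :=
  ⟨hav, fun y hy => hx.2 y (available_mono h hy)⟩

theorem subset_daRound (R : Set (I × S)) : R ⊆ P.daRound R := Set.subset_union_left

theorem daRejected_eq_iterate {K : ℕ} (hK : Fintype.card I * Fintype.card S ≤ K) :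
    P.daRejected = P.daRound^[K] ∅ := by
  have hfix := Set.iterate_inflationary_fixed P.daRound P.subset_daRound (K := K)
    (by rwa [Nat.card_eq_fintype_card, Fintype.card_prod])
  refine Set.Subset.antisymm (Set.iUnion_subset fun k => ?_) (Set.subset_iUnion (fun k => P.daRound^[k] ∅) K)
  have hmono : Monotone fun k => P.daRound^[k] ∅ := monotone_nat_of_le_succ fun k => by
    rw [Function.iterate_succ_apply']; exact P.subset_daRound _
  refine (hmono (le_max_left k K)).trans ?_
  obtain ⟨d, hd⟩ := Nat.exists_eq_add_of_le' (le_max_right k K)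
  rw [hd]
  simp only [Function.iterate_add_apply, Function.iterate_fixed hfix d]
  exact le_rfl

theorem daRound_daRejected : P.daRound P.daRejected = P.daRejected := by
  rw [P.daRejected_eq_iterate le_rfl]
  exact Set.iterate_inflationary_fixed P.daRound P.subset_daRound
    (by rw [Nat.card_eq_fintype_card, Fintype.card_prod])

/-- A property of sets of rejections that holds initially and survives a round holds for the set of
all rejections. -/
theorem daRejected_induction {p : Set (I × S) → Prop} (h0 : p ∅) (hs : ∀ R, p R → p (P.daRound R)) :
    p P.daRejected := by
  rw [P.daRejected_eq_iterate le_rfl]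
  generalize Fintype.card I * Fintype.card S = K
  induction K with
  | zero => exact h0
  | succ k ih => rw [Function.iterate_succ_apply']; exact hs _ ih

theorem applies_da (i : I) : P.Applies P.daRejected i (P.da i) :=
  (P.exists_applies P.daRejected i).choose_spec

theorem applies_daRejected_iff {i : I} {x : Option S} : P.Applies P.daRejected i x ↔ x = P.da i :=
  ⟨fun h => P.applies_unique h (P.applies_da i), fun h => h ▸ P.applies_da i⟩

theorem mem_daRejected_iff {i : I} {s : S} :
    (i, s) ∈ P.daRejected ↔ P.Prefers i (some s) (P.da i) := by
  constructor
  · intro h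
    have hinv : ∀ i s, (i, s) ∈ P.daRejected → ∀ x, Available P.daRejected i x →
        P.pref i (some s) ≤ P.pref i x := by
      refine P.daRejected_induction (p := fun R => ∀ i s, (i, s) ∈ R → ∀ x, Available R i x →
        P.pref i (some s) ≤ P.pref i x) (by simp) ?_
      intro R ih i s his x hx
      have hx' := available_mono (P.subset_daRound R) hx
      rcases his with his | ⟨his, _⟩
      · exact ih i s his x hx'
      · exact his.2 x hx'
    refine P.prefers_of_ne (hinv i s h _ (P.applies_da i).1) fun heq => ?_
    exact (P.applies_da i).1 s heq.symm h
  · intro h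
    by_contra hR
    refine absurd ((P.applies_da i).2 (some s) ?_) (not_le.2 h)
    intro s' hs'
    obtain rfl := Option.some.inj hs'
    exact hR

theorem not_prefers_none_da (i : I) : ¬ P.Prefers i none (P.da i) :=
  not_lt.2 ((P.applies_da i).2 none fun s h => by simp at h)

theorem quota_le_ncard_of_mem_daRejected {i : I} {s : S} (h : (i, s) ∈ P.daRejected) :
    P.quota s ≤ {j | P.da j = some s ∧ P.Higher s j i}.ncard := by
  have hinv : ∀ i s, (i, s) ∈ P.daRejected →
      P.quota s ≤ {j | P.Applies P.daRejected j (some s) ∧ P.Higher s j i}.ncard := by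
    refine P.daRejected_induction (p := fun R => ∀ i s, (i, s) ∈ R →
      P.quota s ≤ {j | P.Applies R j (some s) ∧ P.Higher s j i}.ncard) (by simp) ?_
    intro R ih i s his
    have hold : P.quota s ≤ {j | P.Applies R j (some s) ∧ P.Higher s j i}.ncard := by
      rcases his with his | ⟨_, his⟩
      exacts [ih i s his, his]
    -- applicants that survive the round still apply
    have hkeep : ∀ j, P.Applies R j (some s) → (j, s) ∉ P.daRound R →
        P.Applies (P.daRound R) j (some s) := fun j hj hn =>
      P.applies_of_subset (P.subset_daRound R) hj fun s' hs' => by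
        obtain rfl := Option.some.inj hs'; exact hn
    by_cases hex : ∃ j, P.Applies R j (some s) ∧ P.Higher s j i ∧ (j, s) ∈ P.daRound R
    · -- the best student rejected in this round has enough better applicants, none of them rejected
      classical
      obtain ⟨j, hj, hmin⟩ := Finset.exists_min_image
        (Finset.univ.filter fun j => P.Applies R j (some s) ∧ P.Higher s j i ∧
          (j, s) ∈ P.daRound R) (P.prio s) (by obtain ⟨j, hj⟩ := hex; exact ⟨j, by simpa using hj⟩)
      simp only [Finset.mem_filter, Finset.mem_univ, true_and] at hj hmin
      have hq : P.quota s ≤ {k | P.Applies R k (some s) ∧ P.Higher s k j}.ncard := by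
        rcases hj.2.2 with h | ⟨_, h⟩
        exacts [ih j s h, h]
      refine hq.trans (Set.ncard_le_ncard ?_ (Set.toFinite _))
      rintro k ⟨hk, hkj⟩
      have hki := P.higher_trans hkj hj.2.1
      exact ⟨hkeep k hk fun hrej => absurd (hmin k ⟨hk, hki, hrej⟩) (not_le.2 hkj), hki⟩
    · refine hold.trans (Set.ncard_le_ncard ?_ (Set.toFinite _))
      rintro j ⟨hj, hji⟩
      exact ⟨hkeep j hj fun hrej => hex ⟨j, hj, hji, hrej⟩, hji⟩
  refine (hinv i s h).trans (Set.ncard_le_ncard ?_ (Set.toFinite _))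
  rintro j ⟨hj, hji⟩
  exact ⟨(P.applies_daRejected_iff.1 hj).symm, hji⟩

theorem ncard_da_le_quota (s : S) : {i | P.da i = some s}.ncard ≤ P.quota s := by
  classical
  by_contra! hlt
  have hne : {i | P.da i = some s}.Nonempty := by
    rw [← Set.ncard_pos]; omega
  -- the lowest-priority holder would be rejected in a further round
  obtain ⟨j, hj, hmax⟩ := Set.exists_max_image {i | P.da i = some s} (P.prio s) (Set.toFinite _) hne
  have hj' : P.da j = some s := hj
  have hmem : (j, s) ∈ P.daRound P.daRejected := by
    refine Or.inr ⟨P.applies_daRejected_iff.2 hj'.symm, ?_⟩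
    change P.quota s ≤ {i | P.Applies P.daRejected i (some s) ∧ P.Higher s i j}.ncard
    have hsub : {i | P.da i = some s} ⊆
        insert j {i | P.Applies P.daRejected i (some s) ∧ P.Higher s i j} := by
      intro i hi
      by_cases hij : i = j
      · exact Or.inl hij
      · exact Or.inr ⟨P.applies_daRejected_iff.2 (Eq.symm hi),
          lt_of_le_of_ne (hmax i hi) fun h => hij ((P.prio s).injective h)⟩
    have := (Set.ncard_le_ncard hsub (Set.toFinite _)).trans (Set.ncard_insert_le _ _)
    omega
  rw [P.daRound_daRejected] at hmem
  exact (P.applies_da j).1 s hj' hmem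

/-- Deferred acceptance is stable. -/
theorem higher_of_prefers_da {i j : I} {s : S} (h : P.Prefers i (some s) (P.da i))
    (hj : P.da j = some s) : P.Higher s j i := by
  have h1 := P.quota_le_ncard_of_mem_daRejected (P.mem_daRejected_iff.2 h)
  have h2 := P.ncard_da_le_quota s
  have hsub : {j | P.da j = some s ∧ P.Higher s j i} ⊆ {j | P.da j = some s} := fun j hj => hj.1
  have heq := Set.eq_of_subset_of_ncard_le hsub (h2.trans h1) (Set.toFinite _)
  have : j ∈ {j | P.da j = some s} := hj
  rw [← heq] at this
  exact this.2

theorem isMatching_da : P.IsMatching P.da := by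
  refine ⟨P.ncard_da_le_quota, fun s hs i hi => ?_⟩
  have h1 := P.quota_le_ncard_of_mem_daRejected (P.mem_daRejected_iff.2 hi)
  have h2 : {j | P.da j = some s ∧ P.Higher s j i}.ncard ≤ {j | P.da j = some s}.ncard :=
    Set.ncard_le_ncard (fun j hj => hj.1) (Set.toFinite _)
  omega

/-! ### Improvements permute the seats of deferred acceptance -/

theorem prefers_trans_le {i : I} {x y z : Option S} (h₁ : P.Prefers i x y)
    (h₂ : P.pref i y ≤ P.pref i z) : P.Prefers i x z := lt_of_lt_of_le h₁ h₂

theorem prefers_of_le_of_prefers {i : I} {x y z : Option S} (h₁ : P.pref i x ≤ P.pref i y)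
    (h₂ : P.Prefers i y z) : P.Prefers i x z := lt_of_le_of_lt h₁ h₂

/-- Weak improvements on deferred acceptance do not change the number of students at a school or at
the outside option: by non-wastefulness no school gains students, and nobody becomes unassigned. -/
theorem ncard_eq_of_weak_improvement {μ : I → Option S} (hμ : P.IsMatching μ)
    (h : ∀ i, P.pref i (μ i) ≤ P.pref i (P.da i)) (x : Option S) :
    {i | μ i = x}.ncard = {i | P.da i = x}.ncard := by
  classical
  have hle : ∀ s, {i | μ i = some s}.ncard ≤ {i | P.da i = some s}.ncard := by
    intro s
    by_contra! hlt
    have hfull : {i | P.da i = some s}.ncard < P.quota s := hlt.trans_le (hμ.1 s)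
    obtain ⟨i, hi, hi'⟩ := Set.exists_mem_notMem_of_ncard_lt_ncard hlt
    exact P.isMatching_da.2 s hfull i (hi ▸ P.prefers_of_ne (h i) fun h => hi' (h.symm.trans hi))
  have hnone : {i | μ i = none}.ncard ≤ {i | P.da i = none}.ncard := by
    refine Set.ncard_le_ncard (fun i hi => ?_) (Set.toFinite _)
    by_contra hne
    refine P.not_prefers_none_da i ?_
    have hi' : μ i = none := hi
    exact hi' ▸ P.prefers_of_ne (h i) fun h' => hne (h'.symm.trans hi)
  have hall : ∀ x, {i | μ i = x}.ncard ≤ {i | P.da i = x}.ncard := fun x =>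
    match x with | none => hnone | some s => hle s
  have hsum : ∀ f : I → Option S, ∑ x, {i | f i = x}.ncard = Fintype.card I := by
    intro f
    rw [← Finset.card_univ, Finset.card_eq_sum_card_fiberwise (f := f) (t := Finset.univ) (by simp)]
    refine Finset.sum_congr rfl fun x _ => ?_
    rw [← Set.ncard_coe_finset]
    congr 1; ext i; simp
  exact (Finset.sum_eq_sum_iff_of_le fun x _ => hall x).1 ((hsum μ).trans (hsum P.da).symm) x
    (Finset.mem_univ x)

theorem isMatching_da_comp {c : Equiv.Perm I}
    (h : ∀ i, P.pref i (P.da (c i)) ≤ P.pref i (P.da i)) : P.IsMatching (P.da ∘ c) := by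
  have hcard : ∀ s, {i | (P.da ∘ c) i = some s}.ncard = {i | P.da i = some s}.ncard := by
    intro s
    have : {i | (P.da ∘ c) i = some s} = c.symm '' {i | P.da i = some s} := by
      ext i
      rw [Equiv.image_eq_preimage_symm]; rfl
    rw [this, Set.ncard_image_of_injective _ c.symm.injective]
  refine ⟨fun s => (hcard s).trans_le (P.ncard_da_le_quota s), fun s hs i hi => ?_⟩
  exact P.isMatching_da.2 s ((hcard s).symm.trans_lt hs) i (P.prefers_trans_le hi (h i))

theorem exists_perm_of_weak_improvements {μ ν : I → Option S} (hμ : P.IsMatching μ)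
    (hν : P.IsMatching ν) (h : ∀ i, P.pref i (μ i) ≤ P.pref i (P.da i))
    (h' : ∀ i, P.pref i (ν i) ≤ P.pref i (P.da i)) :
    ∃ c : Equiv.Perm I, μ = ν ∘ c ∧ ∀ i, μ i = ν i → c i = i :=
  exists_perm_comp_eq fun x => (P.ncard_eq_of_weak_improvement hμ h x).trans
    (P.ncard_eq_of_weak_improvement hν h' x).symm

theorem not_envies_self (μ : I → Option S) (i : I) : ¬ P.Envies μ i i := lt_irrefl (α := Fin _) _

/-- A permutation that moves students along envy edges of deferred acceptance only. -/
theorem perm_mem_improvements {c : Equiv.Perm I} (hc : ∀ i, c i ≠ i → P.Envies P.da i (c i))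
    (hne : ∃ i, c i ≠ i) : P.da ∘ c ∈ P.Improvements := by
  have hle : ∀ i, P.pref i (P.da (c i)) ≤ P.pref i (P.da i) := by
    intro i
    by_cases h : c i = i
    · rw [h]
    · exact le_of_lt (α := Fin _) (hc i h)
  exact ⟨P.isMatching_da_comp hle, hle, hne.imp fun i hi => hc i hi⟩

theorem mem_improvable_of_perm {c : Equiv.Perm I} (hc : ∀ i, c i ≠ i → P.Envies P.da i (c i))
    {i : I} (hi : c i ≠ i) : i ∈ P.improvable := by
  intro h
  have := h _ (P.perm_mem_improvements hc ⟨i, hi⟩)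
  have he : P.Prefers i (P.da (c i)) (P.da i) := hc i hi
  rw [Function.comp_apply] at this
  rw [this] at he
  exact lt_irrefl (α := Fin _) _ he

/-- The improvable students are those on a cycle of the envy digraph of deferred acceptance. -/
theorem mem_improvable_iff {i : I} :
    i ∈ P.improvable ↔ Relation.TransGen (P.Envies P.da) i i := by
  constructor
  · intro h
    simp only [improvable, unimprovable, Set.mem_compl_iff, Set.mem_ofPred_eq, not_forall] at h
    obtain ⟨μ, ⟨hm, hd, _⟩, hne⟩ := h
    obtain ⟨c, hc, hfix⟩ := P.exists_perm_of_weak_improvements hm P.isMatching_da hd fun _ => le_rfl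
    have hci : ∀ x, μ x = P.da (c x) := fun x => congrFun hc x
    have hmove : ∀ x, c x ≠ x → μ x ≠ P.da x := fun x hx h => hx (hfix x h)
    refine c.transGen_of_ne (fun x hx => ?_) (x := i) fun h => hne (by rw [hci, h])
    change P.Prefers x (P.da (c x)) (P.da x)
    rw [← hci]
    exact P.prefers_of_ne (hd x) (hmove x hx)
  · intro h
    obtain ⟨c, hc, hci⟩ := exists_perm_of_transGen (P.not_envies_self _) h
    exact P.mem_improvable_of_perm hc hci

theorem exists_improvable_envier {j : I} (hj : j ∈ P.improvable) :
    ∃ i ∈ P.improvable, P.Envies P.da i j := by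
  obtain ⟨i, hji, hij⟩ := Relation.TransGen.tail'_iff.1 (P.mem_improvable_iff.1 hj)
  exact ⟨i, P.mem_improvable_iff.2 (Relation.TransGen.head' hij hji), hij⟩

theorem exists_improvable_of_not_efficient (h : ¬ P.ParetoEfficient P.da) :
    P.improvable.Nonempty := by
  simp only [ParetoEfficient, not_not] at h
  obtain ⟨μ, hm, hd⟩ := h
  obtain ⟨i, hi⟩ := hd.2
  refine ⟨i, fun hu => ?_⟩
  rw [hu μ ⟨hm, hd⟩] at hi
  exact lt_irrefl (α := Fin _) _ hi

theorem exists_da_eq_some {i j : I} (h : P.Envies P.da i j) : ∃ s, P.da j = some s := by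
  rcases hs : P.da j with _ | s
  · refine absurd ?_ (P.not_prefers_none_da i)
    rw [← hs]; exact h
  · exact ⟨s, rfl⟩

end Problem

/-! ### The Just-Below-Cutoffs matching as a permutation of seats -/

namespace Problem

variable {I S : Type*} [Fintype I] [Fintype S] (P : Problem I S)

theorem mem_belowCutoff_iff {s : S} {i : I} :
    i ∈ P.belowCutoff s ↔
      i ∈ P.improvable ∧ P.Prefers i (some s) (P.da i) ∧ ∃ j, P.da j = some s := by
  constructor
  · rintro ⟨h1, h2, c, hc, _⟩
    exact ⟨h1, h2, c, hc.1⟩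
  · rintro ⟨h1, h2, j, hj⟩
    obtain ⟨c, hc, hmax⟩ := Set.exists_max_image {i | P.da i = some s} (P.prio s) (Set.toFinite _)
      ⟨j, hj⟩
    exact ⟨h1, h2, c, ⟨hc, hmax⟩, P.higher_of_prefers_da h2 hc⟩

theorem isJustBelow_unique {s : S} {i j : I} (hi : P.IsJustBelow s i) (hj : P.IsJustBelow s j) :
    i = j :=
  (P.prio s).injective (le_antisymm (hi.2 j hj.1) (hj.2 i hi.1))

theorem exists_isJustBelow {s : S} (h : (P.belowCutoff s).Nonempty) : ∃ i, P.IsJustBelow s i := by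
  obtain ⟨i, hi, hmin⟩ := Set.exists_min_image (P.belowCutoff s) (P.prio s) (Set.toFinite _) h
  exact ⟨i, hi, hmin⟩

open Classical in
/-- The just-below-cutoff student of the school that `j` holds under deferred acceptance, and `j`
herself if there is none. -/
noncomputable def nextBelow (j : I) : I :=
  if h : ∃ i s, P.da j = some s ∧ P.IsJustBelow s i then h.choose else j

theorem nextBelow_eq {i j : I} {s : S} (hj : P.da j = some s) (hi : P.IsJustBelow s i) :
    P.nextBelow j = i := by
  have h : ∃ i s, P.da j = some s ∧ P.IsJustBelow s i := ⟨i, s, hj, hi⟩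
  obtain ⟨t, ht, hb⟩ := h.choose_spec
  rw [nextBelow, dif_pos h]
  obtain rfl : t = s := Option.some.inj (ht.symm.trans hj)
  exact P.isJustBelow_unique hb hi

theorem nextBelow_ne {j : I} (h : P.nextBelow j ≠ j) :
    ∃ s, P.da j = some s ∧ P.IsJustBelow s (P.nextBelow j) := by
  by_cases hex : ∃ i s, P.da j = some s ∧ P.IsJustBelow s i
  · obtain ⟨i, s, hs, hb⟩ := hex
    exact ⟨s, hs, (P.nextBelow_eq hs hb).symm ▸ hb⟩
  · exact absurd (by rw [nextBelow, dif_neg hex]) h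

theorem isJustBelow_envies {s : S} {i j : I} (hi : P.IsJustBelow s i) (hj : P.da j = some s) :
    P.Envies P.da i j := by
  have := (P.mem_belowCutoff_iff.1 hi.1).2.1
  rwa [← hj] at this

theorem isJustBelow_ne {s : S} {i j : I} (hi : P.IsJustBelow s i) (hj : P.da j = some s) : i ≠ j := by
  rintro rfl
  exact P.not_envies_self _ _ (P.isJustBelow_envies hi hj)

/-- The permutation of seats behind the Just-Below-Cutoffs matching: the student just below the
cutoff of a school on a cycle takes the seat of the student who leaves this school, that is, the
functional digraph of `nextBelow` is executed backwards on its cycles. -/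
noncomputable def jbcPerm : Equiv.Perm I := (periodicPerm P.nextBelow)⁻¹

theorem jbcPerm_eq_iff {i j : I} : P.jbcPerm i = j ↔ periodicPerm P.nextBelow j = i := by
  rw [jbcPerm, Equiv.Perm.inv_eq_iff_eq, eq_comm]

theorem jbcPerm_ne {i : I} (h : P.jbcPerm i ≠ i) :
    P.jbcPerm i ∈ Function.periodicPts P.nextBelow ∧
      ∃ s, P.da (P.jbcPerm i) = some s ∧ P.IsJustBelow s i := by
  have hi := P.jbcPerm_eq_iff.1 (rfl : P.jbcPerm i = P.jbcPerm i)
  have hne : periodicPerm P.nextBelow (P.jbcPerm i) ≠ P.jbcPerm i := by rw [hi]; exact h.symm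
  obtain ⟨hper, heq⟩ := periodicPerm_ne hne
  rw [hi] at heq
  obtain ⟨s, hs, hb⟩ := P.nextBelow_ne (j := P.jbcPerm i) (by rw [← heq]; exact h.symm)
  exact ⟨hper, s, hs, heq ▸ hb⟩

theorem improvable_of_isJustBelow {s : S} {i : I} (h : P.IsJustBelow s i) : i ∈ P.improvable :=
  h.1.1

theorem mem_rejectingSchools_of_isJustBelow {s : S} {i : I} (h : P.IsJustBelow s i) :
    s ∈ P.rejectingSchools :=
  ⟨i, h.1.1, P.mem_daRejected_iff.2 h.1.2.1⟩

theorem transGen_nextBelow {s t : S} (h : Relation.TransGen P.SchoolEdge s t) {i j : I}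
    (hi : P.IsJustBelow s i) (hj : P.IsJustBelow t j) :
    Relation.TransGen (fun a b => P.nextBelow a = b) i j := by
  induction h generalizing j with
  | single h =>
    obtain ⟨_, _, i', hi', hd⟩ := h
    obtain rfl := P.isJustBelow_unique hi hi'
    exact .single (P.nextBelow_eq hd hj)
  | tail _ h ih =>
    obtain ⟨_, _, i', hi', hd⟩ := h
    exact (ih hi').tail (P.nextBelow_eq hd hj)

theorem transGen_schoolEdge {i j : I} (h : Relation.TransGen (fun a b => P.nextBelow a = b) i j)
    (hmove : ∀ k, Relation.ReflTransGen (fun a b => P.nextBelow a = b) i k → P.nextBelow k ≠ k)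
    {s : S} (hs : P.IsJustBelow s i) :
    ∃ t, P.IsJustBelow t j ∧ Relation.TransGen P.SchoolEdge s t := by
  have hstep : ∀ {a : I} {s : S}, P.IsJustBelow s a → P.nextBelow a ≠ a →
      ∃ t, P.IsJustBelow t (P.nextBelow a) ∧ P.SchoolEdge s t := by
    intro a s hs ha
    obtain ⟨t, ht, hb⟩ := P.nextBelow_ne ha
    exact ⟨t, hb, P.mem_rejectingSchools_of_isJustBelow hs,
      P.mem_rejectingSchools_of_isJustBelow hb, a, hs, ht⟩
  induction h with
  | single h =>
    obtain ⟨t, ht, he⟩ := hstep hs (hmove i .refl)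
    exact ⟨t, h ▸ ht, .single he⟩
  | tail hab h ih =>
    obtain ⟨t, ht, he⟩ := ih
    obtain ⟨u, hu, he'⟩ := hstep ht (hmove _ hab.to_reflTransGen)
    exact ⟨u, h ▸ hu, he.tail he'⟩

/-- The just-below-cutoff student of a school on a cycle replaces a student who leaves this school
along the cycle. -/
theorem exists_of_onSchoolCycle {s : S} {i : I} (hs : P.OnSchoolCycle s) (hi : P.IsJustBelow s i) :
    ∃ j ∈ Function.periodicPts P.nextBelow, P.da j = some s ∧ P.nextBelow j = i := by
  obtain ⟨t, hst, hts⟩ := Relation.TransGen.tail'_iff.1 hs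
  obtain ⟨_, _, j, hj, hd⟩ := id hts
  refine ⟨j, ?_, hd, P.nextBelow_eq hd hi⟩
  rw [mem_periodicPts_iff_transGen]
  exact P.transGen_nextBelow (Relation.TransGen.head' hts hst) hj hj

theorem induced_jbcPerm : P.induced P.jbcPerm = P.jbc := by
  funext i
  by_cases h : P.jbcPerm i = i
  · rw [induced, h, jbc, dif_neg]
    rintro ⟨s, hs, hi⟩
    obtain ⟨j, hj, hd, hn⟩ := P.exists_of_onSchoolCycle hs hi
    have : P.jbcPerm i = j := by
      rw [jbcPerm_eq_iff, periodicPerm_apply, if_pos hj, hn]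
    exact P.isJustBelow_ne hi hd (h.symm.trans this)
  · obtain ⟨hper, s, hd, hb⟩ := P.jbcPerm_ne h
    have hi := P.jbcPerm_eq_iff.1 (rfl : P.jbcPerm i = P.jbcPerm i)
    rw [periodicPerm_apply, if_pos hper] at hi
    have hiper : i ∈ Function.periodicPts P.nextBelow := by
      rw [← hi]
      exact (Function.bijOn_periodicPts P.nextBelow).mapsTo hper
    have hcyc : Relation.TransGen (fun a b => P.nextBelow a = b) i i :=
      (mem_periodicPts_iff_transGen _ _).1 hiper
    have hmove : ∀ k, Relation.ReflTransGen (fun a b => P.nextBelow a = b) i k →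
        P.nextBelow k ≠ k := by
      intro k hk hfix
      -- a walk that reaches a fixed point stays there, so it cannot return to `i`
      have hstay : ∀ l, Relation.ReflTransGen (fun a b => P.nextBelow a = b) k l → l = k := by
        intro l hl
        induction hl with
        | refl => rfl
        | tail _ h ih => rw [← h, ih, hfix]
      have hkper : k ∈ Function.periodicPts P.nextBelow :=
        Function.mk_mem_periodicPts one_pos (by exact hfix)
      have hki : i = k := by
        obtain rfl | hk' := Relation.reflTransGen_iff_eq_or_transGen.1 hk
        · rfl
        · obtain ⟨m, hm⟩ := (transGen_apply_iff _ _ _).1 hk'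
          obtain ⟨l, hl, hil⟩ := hiper
          have : P.nextBelow^[l * (m + 1)] i = i := (hil.const_mul (m + 1) |> fun h => by
            rw [mul_comm]; exact h)
          rw [← this]
          obtain ⟨d, hd⟩ := Nat.exists_eq_add_of_le' (Nat.le_mul_of_pos_left (m + 1) hl)
          rw [hd, Function.iterate_add_apply, hm]
          exact Function.iterate_fixed hfix d
      rw [← hki] at hfix
      have := (Function.bijOn_periodicPts P.nextBelow).injOn hper hiper (hi.trans hfix.symm)
      exact h this
    obtain ⟨t, ht, hst⟩ := P.transGen_schoolEdge hcyc hmove hb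
    have huniq : ∀ u, P.OnSchoolCycle u → P.IsJustBelow u i → u = s := by
      intro u hu hui
      obtain ⟨j, hj, hd', hn⟩ := P.exists_of_onSchoolCycle hu hui
      have hj' := (Function.bijOn_periodicPts P.nextBelow).injOn hj hper (hn.trans hi.symm)
      rw [hj', hd] at hd'
      exact (Option.some.inj hd').symm
    have hts : t = s := by
      -- `t` is on a cycle, since its just-below-cutoff student is the one of `s`
      have hsucc : ∀ {a b v}, P.IsJustBelow a i → P.IsJustBelow b i → P.SchoolEdge a v →
          P.SchoolEdge b v := by
        rintro a b v ha hb ⟨_, h2, k, hk, hkd⟩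
        obtain rfl := P.isJustBelow_unique ha hk
        exact ⟨P.mem_rejectingSchools_of_isJustBelow hb, h2, i, hb, hkd⟩
      have htt : P.OnSchoolCycle t := by
        obtain ⟨v, hv, hvt⟩ := Relation.TransGen.head'_iff.1 hst
        exact Relation.TransGen.head' (hsucc hb ht hv) hvt
      exact huniq t htt ht
    have hcs : P.OnSchoolCycle s := by rw [hts] at hst; exact hst
    have hex : ∃ s, P.OnSchoolCycle s ∧ P.IsJustBelow s i := ⟨s, hcs, hb⟩
    rw [induced, hd, jbc, dif_pos hex, huniq _ hex.choose_spec.1 hex.choose_spec.2]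

theorem label_eq_empty_of_isJustBelow {s : S} {i j : I} (hi : P.IsJustBelow s i)
    (hj : P.da j = some s) : P.label i j = ∅ := by
  rw [Set.eq_empty_iff_forall_notMem]
  rintro h ⟨himp, henv, t, ht, hhi⟩
  obtain rfl := Option.some.inj (ht.symm.trans hj)
  refine absurd (hi.2 h (P.mem_belowCutoff_iff.2 ⟨himp, ?_, j, hj⟩)) (not_le.2 hhi)
  rw [← hj]; exact henv

theorem jbcPerm_envies {i : I} (h : P.jbcPerm i ≠ i) : P.Envies P.da i (P.jbcPerm i) := by
  obtain ⟨_, s, hd, hb⟩ := P.jbcPerm_ne h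
  exact P.isJustBelow_envies hb hd

theorem isPerfect_jbcPerm : P.IsPerfect ∅ P.jbcPerm := by
  intro i
  by_cases h : P.jbcPerm i = i
  · exact Or.inl h
  · obtain ⟨_, s, hd, hb⟩ := P.jbcPerm_ne h
    refine Or.inr ⟨P.improvable_of_isJustBelow hb, ?_, P.isJustBelow_envies hb hd, ?_⟩
    · exact P.mem_improvable_of_perm (fun i => P.jbcPerm_envies) fun h' => h (P.jbcPerm.injective h')
    · rw [P.label_eq_empty_of_isJustBelow hb hd]

/-- Some cycle is executed if some student is improvable: `nextBelow` moves every improvable student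
to another improvable student. -/
theorem exists_jbcPerm_ne (h : P.improvable.Nonempty) : ∃ i, P.jbcPerm i ≠ i := by
  have hnext : ∀ j ∈ P.improvable, ∃ s, P.da j = some s ∧ P.IsJustBelow s (P.nextBelow j) := by
    intro j hj
    obtain ⟨i, hi, hij⟩ := P.exists_improvable_envier hj
    obtain ⟨s, hs⟩ := P.exists_da_eq_some hij
    obtain ⟨k, hk⟩ := P.exists_isJustBelow (s := s)
      ⟨i, P.mem_belowCutoff_iff.2 ⟨hi, by rw [← hs]; exact hij, j, hs⟩⟩
    exact ⟨s, hs, by rwa [P.nextBelow_eq hs hk]⟩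
  obtain ⟨j, hj⟩ := exists_periodicPerm_ne h
    (fun j hj => by obtain ⟨s, _, hb⟩ := hnext j hj; exact P.improvable_of_isJustBelow hb)
    (fun j hj => by obtain ⟨s, hs, hb⟩ := hnext j hj; exact P.isJustBelow_ne hb hs)
  refine ⟨j, fun h => hj ?_⟩
  rwa [jbcPerm_eq_iff] at h

/-! ### The expansion phase -/

theorem beneficiaries_induced {B : Set I} {σ : Equiv.Perm I} (hσ : P.IsPerfect B σ) :
    P.beneficiaries (P.induced σ) = {i | σ i ≠ i} := by
  ext i
  constructor
  · intro h hi
    have h' : P.Prefers i (P.da (σ i)) (P.da i) := h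
    rw [hi] at h'
    exact lt_irrefl (α := Fin _) _ h'
  · intro h
    exact ((hσ i).resolve_left h).2.2.1

theorem IsPerfect.mono {B B' : Set I} (h : B ⊆ B') {σ : Equiv.Perm I} (hσ : P.IsPerfect B σ) :
    P.IsPerfect B' σ := fun i => (hσ i).imp_right fun ⟨h1, h2, h3, h4⟩ => ⟨h1, h2, h3, h4.trans h⟩

theorem IsPerfect.envies {B : Set I} {σ : Equiv.Perm I} (hσ : P.IsPerfect B σ) {i : I}
    (hi : σ i ≠ i) : P.Envies P.da i (σ i) := ((hσ i).resolve_left hi).2.2.1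

theorem IsRerouting.subset {B : Set I} {σ τ : Equiv.Perm I} (h : P.IsRerouting B σ τ) :
    {i | σ i ≠ i} ⊆ {i | τ i ≠ i} := by
  intro i hi hτ
  by_cases hne : τ i = σ i
  · exact hi (hne.symm.trans hτ)
  · have := (h.2 i hne).2.2.1
    rw [hτ] at this
    exact P.not_envies_self _ _ this

/-- The current perfect matching is perfect for the set of its own beneficiaries. -/
def SelfPerfect (σ : Equiv.Perm I) : Prop := P.IsPerfect (P.beneficiaries (P.induced σ)) σ

theorem SelfPerfect.of_isPerfect {B : Set I} {σ : Equiv.Perm I} (h : P.IsPerfect B σ)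
    (hB : B ⊆ P.beneficiaries (P.induced σ)) : P.SelfPerfect σ := IsPerfect.mono P hB h

theorem ExpansionStep.beneficiaries_subset {σ σ' : Equiv.Perm I} (hσ : P.SelfPerfect σ)
    (h : P.ExpansionStep σ σ') :
    P.beneficiaries (P.induced σ) ⊆ P.beneficiaries (P.induced σ') := by
  rw [P.beneficiaries_induced hσ, P.beneficiaries_induced h.1.1]
  exact IsRerouting.subset P h.1

theorem ExpansionStep.selfPerfect {σ σ' : Equiv.Perm I} (hσ : P.SelfPerfect σ)
    (h : P.ExpansionStep σ σ') : P.SelfPerfect σ' :=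
  SelfPerfect.of_isPerfect P h.1.1 (ExpansionStep.beneficiaries_subset P hσ h)

theorem ExpansionReached.selfPerfect {σ : Equiv.Perm I} (h : P.ExpansionReached σ) :
    P.SelfPerfect σ := by
  induction h with
  | init σ hσ _ => exact IsPerfect.mono P (Set.empty_subset _) hσ
  | step σ σ' _ hs _ ih => exact ExpansionStep.selfPerfect P ih hs

theorem ExpansionReached.jbc_subset {σ : Equiv.Perm I} (h : P.ExpansionReached σ) :
    P.beneficiaries P.jbc ⊆ P.beneficiaries (P.induced σ) := by
  induction h with
  | init σ hσ h => rw [h]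
  | step σ σ' h hs _ ih =>
    exact ih.trans (ExpansionStep.beneficiaries_subset P (ExpansionReached.selfPerfect P h) hs)

theorem IsPerfect.induced_le {B : Set I} {σ : Equiv.Perm I} (h : P.IsPerfect B σ) (i : I) :
    P.pref i (P.induced σ i) ≤ P.pref i (P.da i) := by
  by_cases hi : σ i = i
  · rw [induced, hi]
  · exact le_of_lt (α := Fin _) (IsPerfect.envies P h hi)

/-! ### The refinement phase -/

/-- The invariant of the refinement phase, where `B` is the set of beneficiaries at the end of the
expansion phase and `σ` the perfect matching before the last expansion step: the current matching is
induced by a rerouting of `σ` in the bipartite graph for `B`, and has the beneficiaries `B`. -/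
structure RefineInvariant (B : Set I) (σ : Equiv.Perm I) (μ : I → Option S) : Prop where
  exists_rerouting : ∃ τ, P.IsRerouting B σ τ ∧ P.induced τ = μ
  beneficiaries_eq : P.beneficiaries μ = B

theorem refineInvariant_of_step {σ σ' : Equiv.Perm I} (hs : P.ExpansionStep σ σ')
    (heq : P.beneficiaries (P.induced σ') = P.beneficiaries (P.induced σ)) :
    P.RefineInvariant (P.beneficiaries (P.induced σ')) σ (P.induced σ') :=
  ⟨⟨σ', heq ▸ hs.1, rfl⟩, rfl⟩

/-- Refinement steps are reroutings within the last bipartite graph of the expansion phase: the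
current holder of the seat, whom admissibility exempts, is a beneficiary. By maximality of the last
expansion step, there are no new beneficiaries. -/
theorem RefineInvariant.refineStep {B : Set I} {σ σ' : Equiv.Perm I} (hs : P.ExpansionStep σ σ')
    (hB : B = P.beneficiaries (P.induced σ))
    (heq : P.beneficiaries (P.induced σ') = P.beneficiaries (P.induced σ))
    {μ μ' : I → Option S} (hμ : P.RefineInvariant B σ μ) (h : P.RefineStep B μ μ') :
    P.RefineInvariant B σ μ' := by
  subst hB
  obtain ⟨c, _, hadm, rfl⟩ := h
  obtain ⟨τ, hτ, rfl⟩ := hμ.exists_rerouting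
  have henv : ∀ i, c i ≠ i → P.Envies P.da i ((τ * c) i) := fun i hi =>
    P.prefers_trans_le (hadm i hi).1 (IsPerfect.induced_le P hτ.1 i)
  have henv' : ∀ i, (τ * c) i ≠ i → P.Envies P.da i ((τ * c) i) := by
    intro i hi
    by_cases hc : c i = i
    · rw [Equiv.Perm.mul_apply, hc] at hi ⊢
      exact IsPerfect.envies P hτ.1 hi
    · exact henv i hc
  have himp : ∀ i, (τ * c) i ≠ i → i ∈ P.improvable ∧ (τ * c) i ∈ P.improvable := fun i hi =>
    ⟨P.mem_improvable_of_perm henv' hi,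
      P.mem_improvable_of_perm henv' fun h => hi ((τ * c).injective h)⟩
  have hedge : ∀ i, c i ≠ i → P.ExpEdge (P.beneficiaries (P.induced σ)) i ((τ * c) i) := by
    intro i hi
    have hne : (τ * c) i ≠ i := fun h => P.not_envies_self P.da i (by
      have := henv i hi; rwa [h] at this)
    refine ⟨(himp i hne).1, (himp i hne).2, henv i hi, ?_⟩
    rintro h ⟨h1, h2, h3⟩
    by_cases hci : h = c i
    · have hmem : h ∈ P.beneficiaries (P.induced τ) := by
        change P.Prefers h (P.da (τ h)) (P.da h)
        rw [hci] at h2 ⊢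
        exact h2
      rw [hμ.beneficiaries_eq] at hmem
      exact hmem
    · exact (hadm i hi).2 h h1 hci h2 h3
  have hrer : P.IsRerouting (P.beneficiaries (P.induced σ)) σ (τ * c) := by
    constructor
    · intro i
      by_cases hc : c i = i
      · rw [Equiv.Perm.mul_apply, hc]; exact hτ.1 i
      · exact Or.inr (hedge i hc)
    · intro i hi
      by_cases hc : c i = i
      · rw [Equiv.Perm.mul_apply, hc] at hi ⊢; exact hτ.2 i hi
      · exact hedge i hc
  refine ⟨⟨τ * c, hrer, rfl⟩, ?_⟩
  have hmax := hs.2 _ hrer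
  have hsub : P.beneficiaries (P.induced τ) ⊆ P.beneficiaries (P.induced (τ * c)) := by
    intro i hi
    by_cases hc : c i = i
    · have : P.induced (τ * c) i = P.induced τ i := by
        rw [induced, Equiv.Perm.mul_apply, hc]; rfl
      change P.Prefers _ _ _
      rw [this]; exact hi
    · exact henv i hc
  have hcomp : P.induced τ ∘ c = P.induced (τ * c) := rfl
  rw [hcomp]
  rw [← hμ.beneficiaries_eq]
  refine (Set.eq_of_subset_of_ncard_le hsub ?_ (Set.toFinite _)).symm
  rw [hμ.beneficiaries_eq, ← heq, P.beneficiaries_induced hrer.1, P.beneficiaries_induced hs.1.1]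
  exact hmax

theorem RefineInvariant.reflTransGen {B : Set I} {σ σ' : Equiv.Perm I} (hs : P.ExpansionStep σ σ')
    (hB : B = P.beneficiaries (P.induced σ))
    (heq : P.beneficiaries (P.induced σ') = P.beneficiaries (P.induced σ))
    {μ μ' : I → Option S} (hμ : P.RefineInvariant B σ μ)
    (h : Relation.ReflTransGen (P.RefineStep B) μ μ') : P.RefineInvariant B σ μ' := by
  induction h with
  | refl => exact hμ
  | tail _ h ih => exact RefineInvariant.refineStep P hs hB heq ih h

/-! ### Properties of the outcomes -/

theorem IsRerouting.mem_improvements {B : Set I} {σ τ : Equiv.Perm I} (h : P.IsRerouting B σ τ)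
    (hne : (P.beneficiaries (P.induced τ)).Nonempty) : P.induced τ ∈ P.Improvements := by
  obtain ⟨i, hi⟩ := hne
  rw [P.beneficiaries_induced h.1] at hi
  exact P.perm_mem_improvements (fun i hi => IsPerfect.envies P h.1 hi) ⟨i, hi⟩

/-- Violations are justified because labels are: a student who violates the priority of an improvable
student has left her own seat along an edge whose label contains that student. -/
theorem IsRerouting.mem_of_violates {σ τ : Equiv.Perm I} {B : Set I} (h : P.IsRerouting B σ τ)
    {i j : I} {s : S} (hv : P.Violates (P.induced τ) j i s)
    (hi : i ∈ P.improvable) : i ∈ B := by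
  have hpref : P.Prefers i (some s) (P.da i) :=
    P.prefers_trans_le hv.1 (IsPerfect.induced_le P h.1 i)
  have hj : P.da (τ j) = some s := hv.2.1
  have hne : τ j ≠ j := by
    intro hfix
    rw [hfix] at hj
    exact lt_asymm (α := Fin _) (P.higher_of_prefers_da hpref hj) hv.2.2
  refine ((h.1 j).resolve_left hne).2.2.2 ⟨hi, ?_, s, hj, hv.2.2⟩
  rw [Envies, hj]
  exact hpref

/-- The first part of the theorem, for a single problem. -/
theorem IsSJBCPlusOutcome.properties (h : ¬ P.ParetoEfficient P.da) {μ : I → Option S}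
    (hμ : P.IsSJBCPlusOutcome μ) :
    (P.IsMatching μ ∧ P.ParetoDominates μ P.da) ∧ P.Justifiable μ ∧
      (∀ μ', P.Justifiable μ' → P.ParetoDominates μ' μ →
        P.beneficiaries μ ⊂ P.beneficiaries μ') ∧
      P.beneficiaries P.jbc ⊆ P.beneficiaries μ := by
  obtain ⟨_, ⟨σ, σ', hr, hs, heq, rfl⟩, hpath, hterm⟩ := hμ
  obtain ⟨⟨τ, hτ, rfl⟩, hben⟩ := RefineInvariant.reflTransGen P hs heq heq
    (P.refineInvariant_of_step hs heq) hpath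
  rw [heq] at hτ hben hterm
  have hjbc : P.beneficiaries P.jbc ⊆ P.beneficiaries (P.induced τ) := by
    rw [hben]; exact ExpansionReached.jbc_subset P hr
  have hne : (P.beneficiaries (P.induced τ)).Nonempty := by
    obtain ⟨i, hi⟩ := P.exists_jbcPerm_ne (P.exists_improvable_of_not_efficient h)
    refine ⟨i, hjbc ?_⟩
    rw [← P.induced_jbcPerm]
    exact P.jbcPerm_envies hi
  have himp := IsRerouting.mem_improvements P hτ hne
  refine ⟨himp, ⟨himp, fun i j s hv => ?_⟩, fun μ' hμ' hdom => ?_, hjbc⟩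
  · by_cases hi : i ∈ P.improvable
    · refine Or.inr ?_
      rw [hben]
      exact IsRerouting.mem_of_violates P hτ hv hi
    · exact Or.inl (not_not.1 hi)
  · have hsub : P.beneficiaries (P.induced τ) ⊆ P.beneficiaries μ' := fun i hi =>
      P.prefers_of_le_of_prefers (hdom.1 i) hi
    refine hsub.ssubset_of_ne fun hcontra => ?_
    -- with equal beneficiaries, the trades that lead to `μ'` are admissible
    obtain ⟨c, hc, hfix⟩ := P.exists_perm_of_weak_improvements hμ'.1.1 himp.1 hμ'.1.2.1 himp.2.1
    have hci : ∀ x, μ' x = P.induced τ (c x) := fun x => congrFun hc x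
    have hadm : ∀ i, c i ≠ i →
        P.Admissible (P.beneficiaries (P.induced σ)) (P.induced τ) i (c i) := by
      intro i hi
      refine ⟨?_, ?_⟩
      · rw [Envies, ← hci]
        exact P.prefers_of_ne (hdom.1 i) fun h => hi (hfix i h)
      · rintro k hk _ hpk ⟨s, hs', hhi⟩
        rw [← hben, hcontra]
        by_contra hkB
        rw [← hci] at hpk hs'
        -- `k` keeps her deferred acceptance seat under `μ'`
        have hle : P.pref k (P.da k) ≤ P.pref k (μ' k) := not_lt.1 hkB
        have hv : P.Violates μ' i k s := ⟨P.prefers_trans_le (hs' ▸ hpk) hle, hs', hhi⟩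
        rcases hμ'.2 k i s hv with h' | h'
        exacts [hk h', hkB h']
    obtain ⟨i, hi⟩ := hdom.2
    have hne' : c i ≠ i := by
      intro h'
      rw [hci, h'] at hi
      exact lt_irrefl (α := Fin _) _ hi
    classical
    refine hterm _ ⟨c.cycleOf i, Equiv.Perm.isCycle_cycleOf c hne', fun x hx => ?_, rfl⟩
    have hsame : c.SameCycle i x := by
      by_contra hn
      exact hx (Equiv.Perm.cycleOf_apply_of_not_sameCycle hn)
    rw [hsame.cycleOf_apply] at hx ⊢
    exact hadm x hx

end Problem

/-! ### Permutations of positive gain -/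

section Gain

variable {X : Type*} [Fintype X]

/-- Some permutation that moves points along `A` has a larger total value than the identity. -/
def HasGain (win : X → X → ℕ) (A : X → X → Prop) : Prop :=
  ∃ c : Equiv.Perm X, (∀ x, c x ≠ x → A x (c x)) ∧ ∑ x, win x x < ∑ x, win x (c x)

theorem HasGain.mono {win : X → X → ℕ} {A A' : X → X → Prop} (h : ∀ x y, A x y → A' x y)
    (hA : HasGain win A) : HasGain win A' := by
  obtain ⟨c, hc, hlt⟩ := hA
  exact ⟨c, fun x hx => h _ _ (hc x hx), hlt⟩

/-- One round of the Bellman-Ford-like computation of levels: level `0` is free everywhere, and a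
step along `x → y` changes the level by `win x y - win x x`. -/
def levelStep (win : X → X → ℕ) (A : X → X → Prop) (L : ℕ) (Z : X → Fin L → Prop) (y : X)
    (c : Fin L) : Prop :=
  Z y c ∨ (c : ℕ) = 0 ∨ ∃ x, ∃ c' : Fin L, A x y ∧ Z x c' ∧ (c : ℕ) + win x x = c' + win x y

/-- A level of at least the number of points is reached. -/
def ReachesTop (win : X → X → ℕ) (A : X → X → Prop) (L : ℕ) : Prop :=
  ∃ y, ∃ c : Fin L, Fintype.card X ≤ c ∧
    ((levelStep win A L)^[L * L] fun _ _ => False) y c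

/-- The gain of the step from `x` to `y`. -/
def gain (win : X → X → ℕ) (x y : X) : ℤ := (win x y : ℤ) - win x x

/-- If the top is not reached, the highest level reached at each point is a potential, so no
permutation has positive gain. -/
theorem reachesTop_of_hasGain {win : X → X → ℕ} {A : X → X → Prop} {L : ℕ}
    (hwin : ∀ x y, win x y ≤ 1) (hL : Fintype.card X < L) (h : HasGain win A) :
    ReachesTop win A L := by
  classical
  by_contra hn
  set Z := (levelStep win A L)^[L * L] fun _ _ => False with hZ
  have hfix : levelStep win A L Z = Z :=
    iterate_inflationary_rel_fixed _ (fun _ _ _ h => Or.inl h)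
      (by rw [Fintype.card_fin]; exact Nat.mul_le_mul_right _ hL.le)
  have hlt : ∀ y c, Z y c → (c : ℕ) < Fintype.card X := fun y c hc => by
    by_contra hle
    exact hn ⟨y, c, not_lt.1 hle, hc⟩
  have hzero : ∀ y, Z y ⟨0, by omega⟩ := fun y => by
    rw [← hfix]; exact Or.inr (Or.inl rfl)
  have hmax : ∀ y, ∃ c, Z y c ∧ ∀ c', Z y c' → c' ≤ c := fun y =>
    Set.exists_max_image {c | Z y c} id (Set.toFinite _) ⟨_, hzero y⟩
  choose M hM hMmax using hmax
  have hpot : ∀ x y, A x y → M x + win x y ≤ M y + win x x := by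
    intro x y hA
    by_contra! hcon
    have h1 := hlt x _ (hM x)
    have h2 := hwin x y
    have hmem : Z y ⟨M x + win x y - win x x, by omega⟩ := by
      rw [← hfix]
      refine Or.inr (Or.inr ⟨x, M x, hA, hM x, ?_⟩)
      change (M x + win x y - win x x) + win x x = _
      omega
    have h3 : M x + win x y - win x x ≤ M y := hMmax y _ hmem
    omega
  obtain ⟨c, hc, hgain⟩ := h
  have hsum : ∑ x, ((M x : ℕ) + win x (c x)) ≤ ∑ x, ((M (c x) : ℕ) + win x x) := by
    refine Finset.sum_le_sum fun x _ => ?_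
    by_cases hx : c x = x
    · rw [hx]
    · exact hpot x _ (hc x hx)
  rw [Finset.sum_add_distrib, Finset.sum_add_distrib, Equiv.sum_comp c fun x => (M x : ℕ)] at hsum
  omega

/-- The total gain along a path, which is listed from its end to its start. -/
def pathGain (win : X → X → ℕ) : List X → ℤ
  | [] => 0
  | [_] => 0
  | y :: x :: p => gain win x y + pathGain win (x :: p)

omit [Fintype X] in
theorem pathGain_append (win : X → X → ℕ) (p : List X) (y : X) (q : List X) :
    pathGain win (p ++ y :: q) = pathGain win (p ++ [y]) + pathGain win (y :: q) := by
  induction p with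
  | nil => simp [pathGain]
  | cons x p ih =>
    cases p with
    | nil => cases q <;> simp [pathGain]
    | cons z p =>
      simp only [List.cons_append, pathGain] at ih ⊢
      rw [ih]; ring

omit [Fintype X] in
theorem pathGain_lt {win : X → X → ℕ} (hwin : ∀ x y, win x y ≤ 1) (y : X) (p : List X) :
    pathGain win (y :: p) < (y :: p).length := by
  induction p generalizing y with
  | nil => simp [pathGain]
  | cons x p ih =>
    have h1 := ih x
    have h2 : gain win x y ≤ 1 := by
      have := hwin x y
      simp only [gain]; omega
    simp only [pathGain, List.length_cons] at h1 ⊢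
    push_cast at h1 ⊢
    linarith

/-- Closing a simple path gives a permutation. -/
theorem exists_perm_of_path (win : X → X → ℕ) (A : X → X → Prop) (y : X) (p : List X)
    (hnd : (y :: p).Nodup) (hch : (y :: p).IsChain fun b a => A a b) :
    ∃ c : Equiv.Perm X, (∀ x, x ∉ y :: p → c x = x) ∧ c y = (y :: p).getLast (by simp) ∧
      (∀ x ∈ y :: p, x ≠ y → A x (c x)) ∧
      ∑ x, gain win x (c x) = pathGain win (y :: p) + gain win y ((y :: p).getLast (by simp)) := by
  classical
  induction p generalizing y with
  | nil => exact ⟨1, by simp, by simp, by simp, by simp [pathGain, gain]⟩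
  | cons z p ih =>
    obtain ⟨c, hc1, hc2, hc3, hc4⟩ := ih z hnd.of_cons hch.tail
    have hy : y ∉ z :: p := (List.nodup_cons.1 hnd).1
    have hyz : y ≠ z := fun h => hy (h ▸ List.mem_cons_self)
    have hcy : c y = y := hc1 y hy
    have happ : ∀ x, x ≠ y → x ≠ z → (c * Equiv.swap y z) x = c x := fun x h1 h2 => by
      rw [Equiv.Perm.mul_apply, Equiv.swap_apply_of_ne_of_ne h1 h2]
    have h1 : (c * Equiv.swap y z) y = (z :: p).getLast (by simp) := by
      rw [Equiv.Perm.mul_apply, Equiv.swap_apply_left, hc2]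
    have h2 : (c * Equiv.swap y z) z = y := by
      rw [Equiv.Perm.mul_apply, Equiv.swap_apply_right, hcy]
    have hA : A z y := by
      cases hch with | cons_cons h _ => exact h
    refine ⟨c * Equiv.swap y z, ?_, ?_, ?_, ?_⟩
    · intro x hx
      rw [List.mem_cons, not_or] at hx
      rw [happ x hx.1 fun h => hx.2 (h ▸ List.mem_cons_self), hc1 x hx.2]
    · rw [h1, List.getLast_cons (List.cons_ne_nil z p)]
    · intro x hx hxy
      by_cases hxz : x = z
      · rw [hxz, h2]; exact hA
      · rw [happ x hxy hxz]
        exact hc3 x ((List.mem_cons.1 hx).resolve_left hxy) hxz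
    · rw [List.getLast_cons (List.cons_ne_nil z p)]
      have hdiff : ∑ x, (gain win x ((c * Equiv.swap y z) x) - gain win x (c x)) =
          (gain win y ((z :: p).getLast (by simp)) - gain win y y) +
            (gain win z y - gain win z ((z :: p).getLast (by simp))) := by
        rw [Fintype.sum_eq_add y z hyz, h1, h2, hcy, hc2]
        rintro x ⟨hxy, hxz⟩
        rw [happ x hxy hxz, sub_self]
      rw [Finset.sum_sub_distrib, hc4] at hdiff
      simp only [pathGain]
      have : gain win y y = 0 := by simp [gain]
      linarith

/-- Without a permutation of positive gain, every level is bounded by the gain of a simple path: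
removing a cycle from a path does not decrease its gain. -/
theorem exists_path_of_level {win : X → X → ℕ} {A : X → X → Prop} {L : ℕ} (h : ¬ HasGain win A)
    (K : ℕ) (y : X) (c : Fin L) (hc : ((levelStep win A L)^[K] fun _ _ => False) y c) :
    ∃ p : List X, (y :: p).Nodup ∧ ((y :: p).IsChain fun b a => A a b) ∧
      (c : ℤ) ≤ pathGain win (y :: p) := by
  classical
  induction K generalizing y c with
  | zero => exact absurd hc id
  | succ K ih =>
    rw [Function.iterate_succ_apply'] at hc
    rcases hc with hc | hc | ⟨x, c', hA, hx, heq⟩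
    · exact ih y c hc
    · exact ⟨[], by simp, by simp, by simp [pathGain, hc]⟩
    · obtain ⟨p, hnd, hch, hle⟩ := ih x c' hx
      have hc' : (c : ℤ) = c' + gain win x y := by simp only [gain]; omega
      by_cases hy : y ∈ x :: p
      · obtain ⟨u, v, huv⟩ := List.append_of_mem hy
        rw [huv] at hnd hch hle
        refine ⟨v, (List.nodup_append.1 hnd).2.1, hch.right_of_append, ?_⟩
        obtain ⟨q, hq⟩ : ∃ q, u ++ [y] = x :: q := by
          cases u with
          | nil => exact ⟨[], by simp at huv; simp [huv.1]⟩
          | cons a u => exact ⟨u ++ [y], by simp at huv; simp [huv.1]⟩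
        have hsplit : u ++ y :: v = (u ++ [y]) ++ v := by simp
        have hlast : (x :: q).getLast (by simp) = y := by
          simp only [← hq, List.getLast_append_singleton]
        have hnd' : (x :: q).Nodup := by
          rw [← hq]; rw [hsplit] at hnd; exact (List.nodup_append.1 hnd).1
        have hch' : (x :: q).IsChain fun b a => A a b := by
          rw [← hq]; rw [hsplit] at hch; exact hch.left_of_append
        obtain ⟨π, h1, h2, h3, h4⟩ := exists_perm_of_path win A x q hnd' hch'
        rw [hlast] at h2 h4
        have hgain : ∑ z, gain win z (π z) ≤ 0 := by
          by_contra! hpos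
          refine h ⟨π, fun z hz => ?_, ?_⟩
          · by_cases hzx : z = x
            · rw [hzx, h2]; exact hA
            · refine h3 z ?_ hzx
              by_contra hmem
              exact hz (h1 z hmem)
          · simp only [gain, Finset.sum_sub_distrib] at hpos
            have : ((∑ x, win x x : ℕ) : ℤ) < (∑ x, win x (π x) : ℕ) := by push_cast; linarith
            exact_mod_cast this
        rw [pathGain_append, hq] at hle
        linarith
      · refine ⟨x :: p, List.nodup_cons.2 ⟨hy, hnd⟩, .cons_cons hA hch, ?_⟩
        simp only [pathGain]
        linarith

theorem reachesTop_iff {win : X → X → ℕ} {A : X → X → Prop} {L : ℕ}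
    (hwin : ∀ x y, win x y ≤ 1) (hL : Fintype.card X < L) :
    ReachesTop win A L ↔ HasGain win A := by
  refine ⟨fun ⟨y, c, hc, hy⟩ => ?_, reachesTop_of_hasGain hwin hL⟩
  by_contra hn
  obtain ⟨p, hnd, _, hle⟩ := exists_path_of_level hn _ y c hy
  have h1 := pathGain_lt hwin y p
  have h2 : (y :: p).length ≤ Fintype.card X := hnd.length_le_card
  omega

end Gain

/-! ### Sequential deletion of superfluous edges -/

/-- The state after `K` steps, where step `t` is `g t`. -/
def stepFold {α : Type*} (g : ℕ → α → α) (K : ℕ) (a : α) : α := Nat.rec a (fun t s => g t s) K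

@[simp]
theorem stepFold_zero {α : Type*} (g : ℕ → α → α) (a : α) : stepFold g 0 a = a := rfl

theorem stepFold_succ {α : Type*} (g : ℕ → α → α) (K : ℕ) (a : α) :
    stepFold g (K + 1) a = g K (stepFold g K a) := rfl

theorem stepFold_const {α : Type*} (g : α → α) (K : ℕ) (a : α) :
    stepFold (fun _ => g) K a = g^[K] a := by
  induction K with
  | zero => rfl
  | succ K ih => rw [stepFold_succ, Function.iterate_succ_apply', ih]

section Thin

variable {X : Type*}

/-- The relation `A` without the pair `(a, b)`. -/
def removePair (A : X → X → Prop) (a b : X) (x y : X) : Prop := A x y ∧ ¬ (x = a ∧ y = b)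

/-- Step `t` deletes the pair numbered `t` if the property `q` survives. -/
def thinStep (q : (X → X → Prop) → Prop) (idx : X → X → ℕ) (t : ℕ) (A : X → X → Prop) (a b : X) :
    Prop := A a b ∧ ¬ (idx a b = t ∧ q (removePair A a b))

/-- All pairs that are not needed for `q` are deleted one after the other. -/
def thin (q : (X → X → Prop) → Prop) (idx : X → X → ℕ) (K : ℕ) (A : X → X → Prop) :
    X → X → Prop := stepFold (thinStep q idx) K A

theorem thin_anti {q : (X → X → Prop) → Prop} {idx : X → X → ℕ} {K K' : ℕ} (h : K ≤ K')
    {A : X → X → Prop} {a b : X} (hab : thin q idx K' A a b) : thin q idx K A a b := by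
  induction h with
  | refl => exact hab
  | step _ ih => exact ih hab.1

theorem thin_holds {q : (X → X → Prop) → Prop} {idx : X → X → ℕ}
    (hidx : ∀ a b a' b', idx a b = idx a' b' → a = a' ∧ b = b') (K : ℕ) {A : X → X → Prop}
    (hA : q A) : q (thin q idx K A) := by
  induction K with
  | zero => exact hA
  | succ K ih =>
    change q (thinStep q idx K (thin q idx K A))
    set A' := thin q idx K A
    by_cases hex : ∃ a b, idx a b = K ∧ q (removePair A' a b)
    · obtain ⟨a, b, hab, hq⟩ := hex
      convert hq using 1
      funext x y
      refine propext (and_congr_right fun _ => not_congr ⟨fun h => hidx _ _ _ _ (h.1.trans hab.symm),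
        ?_⟩)
      rintro ⟨rfl, rfl⟩
      exact ⟨hab, hq⟩
    · convert ih using 1
      funext x y
      exact propext (and_iff_left fun h => hex ⟨x, y, h⟩)

theorem thin_minimal {q : (X → X → Prop) → Prop} {idx : X → X → ℕ} {K : ℕ}
    (hq : ∀ A A' : X → X → Prop, (∀ x y, A x y → A' x y) → q A → q A')
    (hK : ∀ a b, idx a b < K) {A : X → X → Prop} {a b : X} (hab : thin q idx K A a b) :
    ¬ q (removePair (thin q idx K A) a b) := by
  intro h
  have h1 : thin q idx (idx a b + 1) A a b := thin_anti (hK a b) hab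
  exact h1.2 ⟨rfl, hq _ _ (fun x y hxy => ⟨thin_anti (hK a b).le hxy.1, hxy.2⟩) h⟩

/-- A minimal relation with a permutation of positive gain is the graph of this permutation, apart
from fixed points. -/
theorem exists_perm_of_thin [Fintype X] {win : X → X → ℕ} {idx : X → X → ℕ} {K : ℕ}
    (hidx : ∀ a b a' b', idx a b = idx a' b' → a = a' ∧ b = b') (hK : ∀ a b, idx a b < K)
    {A : X → X → Prop} (hA : HasGain win A) (hirr : ∀ x, ¬ A x x) :
    ∃ c : Equiv.Perm X, (∀ x y, thin (HasGain win) idx K A x y ↔ c x = y ∧ x ≠ y) ∧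
      (∀ x, c x ≠ x → A x (c x)) ∧ ∑ x, win x x < ∑ x, win x (c x) := by
  obtain ⟨c, hc, hgain⟩ := thin_holds hidx K hA
  have hsub : ∀ x y, thin (HasGain win) idx K A x y → A x y := fun x y h =>
    thin_anti (Nat.zero_le K) h
  refine ⟨c, fun x y => ⟨fun h => ?_, fun ⟨h, hne⟩ => h ▸ hc x fun h' => hne (h'.symm.trans h)⟩,
    fun x hx => hsub _ _ (hc x hx), hgain⟩
  refine ⟨?_, fun hxy => hirr x (by have := hsub _ _ h; rwa [← hxy] at this)⟩
  by_contra hne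
  refine thin_minimal (fun _ _ => HasGain.mono) hK h ⟨c, fun z hz => ⟨hc z hz, ?_⟩, hgain⟩
  rintro ⟨rfl, h'⟩
  exact hne h'

end Thin

/-! ### The expansion phase as an algorithm -/

section FirstNext

variable {n : ℕ}

theorem exists_firstNext (A : Fin n → Fin n → Prop) (x : Fin n) :
    ∃ y, (A x y ∧ ∀ z, A x z → y ≤ z) ∨ ((∀ z, ¬ A x z) ∧ y = x) := by
  by_cases h : ∃ y, A x y
  · obtain ⟨y, hy, hmin⟩ := Set.exists_min_image {y | A x y} id (Set.toFinite _) h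
    exact ⟨y, Or.inl ⟨hy, hmin⟩⟩
  · exact ⟨x, Or.inr ⟨not_exists.1 h, rfl⟩⟩

/-- The first successor of `x`, and `x` itself if it has no successors. -/
noncomputable def firstNext (A : Fin n → Fin n → Prop) (x : Fin n) : Fin n :=
  (exists_firstNext A x).choose

theorem firstNext_spec (A : Fin n → Fin n → Prop) (x : Fin n) :
    (A x (firstNext A x) ∧ ∀ z, A x z → firstNext A x ≤ z) ∨
      ((∀ z, ¬ A x z) ∧ firstNext A x = x) :=
  (exists_firstNext A x).choose_spec

theorem eq_firstNext_iff (A : Fin n → Fin n → Prop) (x y : Fin n) :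
    y = firstNext A x ↔ (A x y ∧ ∀ z, A x z → y ≤ z) ∨ ((∀ z, ¬ A x z) ∧ y = x) := by
  refine ⟨fun h => h ▸ firstNext_spec A x, fun h => ?_⟩
  rcases h with ⟨h1, h2⟩ | ⟨h1, h2⟩ <;> rcases firstNext_spec A x with ⟨h3, h4⟩ | ⟨h3, h4⟩
  · exact le_antisymm (h2 _ h3) (h4 _ h1)
  · exact absurd h1 (h3 _)
  · exact absurd h3 (h1 _)
  · rw [h2, h4]

/-- Numbers `g` read as a map on students; numbers that are not students are replaced. -/
def guess (g : Fin n → ℕ) (x : Fin n) : Fin n := if h : g x < n then ⟨g x, h⟩ else x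

theorem guess_val (f : Fin n → Fin n) : guess (fun x => (f x : ℕ)) = f := by
  funext x
  simp [guess]

end FirstNext

namespace Problem

variable {n m : ℕ} (P : Problem (Fin n) (Fin m))

/-- The seat of `j` may be given to `i` in a rerouting of the map `s`. -/
def Allowed (s : Fin n → Fin n) (i j : Fin n) : Prop :=
  j = s i ∨ P.ExpEdge (P.beneficiaries fun i => P.da (s i)) i j

/-- `1` if the seat of `τ y` is a gain for `x`, that is, not her own. -/
def win (τ : Fin n → Fin n) (x y : Fin n) : ℕ := if τ y ≠ x then 1 else 0

theorem win_le_one (τ : Fin n → Fin n) (x y : Fin n) : win τ x y ≤ 1 := by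
  unfold win; split_ifs <;> simp

/-- `x` may take over the seat that `y` has in the current rerouting `τ` of `s`. -/
def Exchange (s τ : Fin n → Fin n) (x y : Fin n) : Prop := x ≠ y ∧ P.Allowed s x (τ y)

/-- The number of a pair of students in the order of deletion. -/
def pairNumber (L : ℕ) (a b : Fin n) : ℕ := a * L + b

open Classical in
/-- One augmentation of the rerouting `τ` of `s`, if there is one. -/
noncomputable def augment (L : ℕ) (s τ : Fin n → Fin n) : Fin n → Fin n :=
  if ReachesTop (win τ) (P.Exchange s τ) L then
    fun x => τ (firstNext (thin (fun A => ReachesTop (win τ) A L) (pairNumber L) (L * L)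
      (P.Exchange s τ)) x)
  else τ

open Classical in
/-- The rerouting of `s` from which augmentation starts: the proposal `g` if it is a rerouting. -/
noncomputable def startRerouting (s g : Fin n → Fin n) : Fin n → Fin n :=
  if Function.Injective g ∧ ∀ i, P.Allowed s i (g i) then g else s

/-- One expansion step from `s`, where `g` is proposed as its result. -/
noncomputable def expand (L : ℕ) (s g : Fin n → Fin n) : Fin n → Fin n :=
  (P.augment L s)^[L] (P.startRerouting s g)

theorem isRerouting_iff_allowed {σ τ : Equiv.Perm (Fin n)} (hσ : P.SelfPerfect σ) :
    P.IsRerouting (P.beneficiaries (P.induced σ)) σ τ ↔ ∀ i, P.Allowed σ i (τ i) := by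
  constructor
  · intro h i
    by_cases hi : τ i = σ i
    · exact Or.inl hi
    · exact Or.inr (h.2 i hi)
  · intro h
    refine ⟨fun i => ?_, fun i hi => (h i).resolve_left hi⟩
    rcases h i with hi | hi
    · rw [hi]; exact hσ i
    · exact Or.inr hi

theorem sum_win_comp (τ c : Equiv.Perm (Fin n)) :
    ∑ x, win τ x (c x) = {i | (τ * c) i ≠ i}.ncard := by
  classical
  simp only [win]
  rw [Finset.sum_boole, ← Set.ncard_coe_finset]
  simp

theorem pairNumber_inj {L : ℕ} (hL : n < L) (a b a' b' : Fin n)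
    (h : pairNumber L a b = pairNumber L a' b') : a = a' ∧ b = b' := by
  have hmod : ∀ a b : Fin n, pairNumber L a b % L = b := fun a b => by
    rw [pairNumber, mul_comm, Nat.mul_add_mod, Nat.mod_eq_of_lt (b.2.trans hL)]
  have hdiv : ∀ a b : Fin n, pairNumber L a b / L = a := fun a b => by
    rw [pairNumber, mul_comm, Nat.mul_add_div (by omega), Nat.div_eq_of_lt (b.2.trans hL), add_zero]
  exact ⟨Fin.ext (by rw [← hdiv a b, h, hdiv]), Fin.ext (by rw [← hmod a b, h, hmod])⟩

theorem pairNumber_lt {L : ℕ} (hL : n < L) (a b : Fin n) : pairNumber L a b < L * L := by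
  have h1 : ((a : ℕ) + 1) * L ≤ L * L := Nat.mul_le_mul_right _ (by have := a.2; omega)
  have := b.2
  rw [add_mul] at h1
  unfold pairNumber
  omega

/-- Augmentation succeeds unless the rerouting is optimal. -/
theorem augment_spec {L : ℕ} (hL : n < L) (s : Fin n → Fin n) (τ : Equiv.Perm (Fin n))
    (hτ : ∀ i, P.Allowed s i (τ i)) :
    (P.augment L s τ = τ ∧ ∀ τ' : Equiv.Perm (Fin n), (∀ i, P.Allowed s i (τ' i)) →
        {i | τ' i ≠ i}.ncard ≤ {i | τ i ≠ i}.ncard) ∨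
      ∃ τ' : Equiv.Perm (Fin n), P.augment L s τ = τ' ∧ (∀ i, P.Allowed s i (τ' i)) ∧
        {i | τ i ≠ i}.ncard < {i | τ' i ≠ i}.ncard := by
  have hiff : ∀ A : Fin n → Fin n → Prop, ReachesTop (win τ) A L ↔ HasGain (win τ) A := fun A =>
    reachesTop_iff (win_le_one τ) (by rwa [Fintype.card_fin])
  have hone := sum_win_comp τ 1
  simp only [Equiv.Perm.one_apply, mul_one] at hone
  by_cases hgain : HasGain (win τ) (P.Exchange s τ)
  · right
    obtain ⟨c, hc, hmove, hlt⟩ := exists_perm_of_thin (idx := pairNumber L) (K := L * L)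
      (pairNumber_inj hL) (pairNumber_lt hL) hgain (fun x hx => hx.1 rfl)
    have hnext : ∀ x, firstNext (thin (HasGain (win τ)) (pairNumber L) (L * L) (P.Exchange s τ)) x =
        c x := by
      intro x
      symm
      rw [eq_firstNext_iff]
      by_cases hx : c x = x
      · refine Or.inr ⟨fun z hz => ?_, hx⟩
        obtain ⟨h1, h2⟩ := (hc x z).1 hz
        exact h2 (hx.symm.trans h1)
      · exact Or.inl ⟨(hc _ _).2 ⟨rfl, fun h => hx h.symm⟩, fun z hz => ((hc x z).1 hz).1.le⟩
    refine ⟨τ * c, ?_, fun i => ?_, ?_⟩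
    · rw [augment, if_pos ((hiff _).2 hgain)]
      simp only [hiff]
      funext x
      exact congrArg τ (hnext x)
    · by_cases hi : c i = i
      · rw [Equiv.Perm.mul_apply, hi]; exact hτ i
      · exact (hmove i hi).2
    · rwa [hone, sum_win_comp] at hlt
  · left
    refine ⟨by rw [augment, if_neg (mt (hiff _).1 hgain)], fun τ' hτ' => ?_⟩
    by_contra! hlt
    refine hgain ⟨τ⁻¹ * τ', fun x hx => ⟨fun h => hx h.symm, ?_⟩, ?_⟩
    · rw [← Equiv.Perm.mul_apply, mul_inv_cancel_left]; exact hτ' x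
    · rwa [hone, sum_win_comp, mul_inv_cancel_left]

theorem augment_iterate_spec {L : ℕ} (hL : n < L) (s : Fin n → Fin n) (τ : Equiv.Perm (Fin n))
    (hτ : ∀ i, P.Allowed s i (τ i)) (K : ℕ) :
    ∃ τ' : Equiv.Perm (Fin n), (P.augment L s)^[K] τ = τ' ∧ (∀ i, P.Allowed s i (τ' i)) ∧
      (K ≤ {i | τ' i ≠ i}.ncard ∨ ∀ τ'' : Equiv.Perm (Fin n), (∀ i, P.Allowed s i (τ'' i)) →
        {i | τ'' i ≠ i}.ncard ≤ {i | τ' i ≠ i}.ncard) := by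
  induction K with
  | zero => exact ⟨τ, rfl, hτ, Or.inl (Nat.zero_le _)⟩
  | succ K ih =>
    obtain ⟨τ₁, h1, h2, h3⟩ := ih
    rw [Function.iterate_succ_apply', h1]
    rcases P.augment_spec hL s τ₁ h2 with ⟨h4, h5⟩ | ⟨τ₂, h4, h5, h6⟩
    · exact ⟨τ₁, h4, h2, Or.inr h5⟩
    · refine ⟨τ₂, h4, h5, ?_⟩
      rcases h3 with h3 | h3
      · exact Or.inl (by omega)
      · exact absurd (h3 τ₂ h5) (not_le.2 h6)

/-- An expansion step is performed, whatever is proposed. -/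
theorem expand_spec {L : ℕ} (hL : n < L) {σ : Equiv.Perm (Fin n)} (hσ : P.SelfPerfect σ)
    (g : Fin n → Fin n) :
    ∃ σ' : Equiv.Perm (Fin n), P.expand L σ g = σ' ∧ P.ExpansionStep σ σ' := by
  obtain ⟨τ, h1, h2⟩ : ∃ τ : Equiv.Perm (Fin n), P.startRerouting σ g = τ ∧
      ∀ i, P.Allowed σ i (τ i) := by
    rw [startRerouting]
    split_ifs with h
    · exact ⟨Equiv.ofBijective g (Finite.injective_iff_bijective.1 h.1), rfl, h.2⟩
    · exact ⟨σ, rfl, fun i => Or.inl rfl⟩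
  obtain ⟨σ', h3, h4, h5⟩ := P.augment_iterate_spec hL σ τ h2 L
  refine ⟨σ', by rw [expand, h1, h3], (P.isRerouting_iff_allowed hσ).2 h4, fun τ' hτ' => ?_⟩
  rcases h5 with h5 | h5
  · have := Set.ncard_le_card {i | σ' i ≠ i}
    rw [Nat.card_eq_fintype_card, Fintype.card_fin] at this
    omega
  · exact h5 τ' ((P.isRerouting_iff_allowed hσ).1 hτ')

/-- Every expansion step is performed if it is proposed. -/
theorem expand_eq {L : ℕ} (hL : n < L) {σ σ' : Equiv.Perm (Fin n)} (hσ : P.SelfPerfect σ)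
    (h : P.ExpansionStep σ σ') : P.expand L σ σ' = σ' := by
  have hall := (P.isRerouting_iff_allowed hσ).1 h.1
  have hstart : P.startRerouting σ σ' = σ' := by
    rw [startRerouting, if_pos ⟨σ'.injective, hall⟩]
  have hfix : P.augment L σ σ' = σ' := by
    rcases P.augment_spec hL σ σ' hall with ⟨h4, _⟩ | ⟨τ, _, h5, h6⟩
    · exact h4
    · exact absurd (h.2 τ ((P.isRerouting_iff_allowed hσ).2 h5)) (not_le.2 h6)
  rw [expand, hstart]
  exact Function.iterate_fixed hfix L

open Classical in
/-- The perfect matching that starts the expansion phase: the proposal `g` if it is eligible. -/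
noncomputable def initial (g : Fin n → Fin n) : Fin n → Fin n :=
  if Function.Injective g ∧ (∀ i, g i = i ∨ P.ExpEdge ∅ i (g i)) ∧
    ∀ i, P.da (g i) = P.da (P.jbcPerm i) then g else P.jbcPerm

theorem initial_spec (g : Fin n → Fin n) :
    ∃ σ : Equiv.Perm (Fin n), P.initial g = σ ∧ P.IsPerfect ∅ σ ∧ P.induced σ = P.jbc := by
  rw [initial]
  split_ifs with h
  · refine ⟨Equiv.ofBijective g (Finite.injective_iff_bijective.1 h.1), rfl, h.2.1, ?_⟩
    rw [← P.induced_jbcPerm]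
    exact funext h.2.2
  · exact ⟨P.jbcPerm, rfl, P.isPerfect_jbcPerm, P.induced_jbcPerm⟩

theorem initial_eq {σ : Equiv.Perm (Fin n)} (hσ : P.IsPerfect ∅ σ) (h : P.induced σ = P.jbc) :
    P.initial σ = σ := by
  exact if_pos ⟨σ.injective, hσ, fun i => congrFun (h.trans P.induced_jbcPerm.symm) i⟩

/-- The expansion phase with the proposals `g`. As many steps are run as suffice; further steps after
the phase has stopped do no harm. -/
noncomputable def expansion (L : ℕ) (g : ℕ → Fin n → Fin n) : Fin n → Fin n :=
  stepFold (fun t s => P.expand L s (g (t + 1))) L (P.initial (g 0))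

/-- A step after the last one could have been the last one as well. -/
theorem ExpansionStep.trans {σ σ' τ : Equiv.Perm (Fin n)} (h : P.ExpansionStep σ σ')
    (heq : P.beneficiaries (P.induced σ') = P.beneficiaries (P.induced σ))
    (h' : P.ExpansionStep σ' τ) : P.ExpansionStep σ τ := by
  obtain ⟨⟨h1, h2⟩, h3⟩ := h'
  rw [heq] at h1 h2 h3
  refine ⟨⟨h1, fun i hi => ?_⟩, fun τ' hτ' => (h.2 τ' hτ').trans (h3 σ' ⟨h.1.1, ?_⟩)⟩
  · by_cases hτ : τ i = σ' i
    · rw [hτ] at hi ⊢; exact h.1.2 i hi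
    · exact h2 i hτ
  · exact fun i hi => absurd rfl hi

theorem expansion_isExpansionOutcome {L : ℕ} (hL : n < L) (g : ℕ → Fin n → Fin n) :
    P.IsExpansionOutcome fun i => P.da (P.expansion L g i) := by
  have key : ∀ K, ∃ σ : Equiv.Perm (Fin n),
      stepFold (fun t s => P.expand L s (g (t + 1))) K (P.initial (g 0)) = σ ∧
      ((P.ExpansionReached σ ∧ K ≤ (P.beneficiaries (P.induced σ)).ncard) ∨
        ∃ σ₀, P.ExpansionReached σ₀ ∧ P.ExpansionStep σ₀ σ ∧
          P.beneficiaries (P.induced σ) = P.beneficiaries (P.induced σ₀)) := by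
    intro K
    induction K with
    | zero =>
      obtain ⟨σ, h1, h2, h3⟩ := P.initial_spec (g 0)
      exact ⟨σ, h1, Or.inl ⟨.init σ h2 h3, Nat.zero_le _⟩⟩
    | succ K ih =>
      obtain ⟨σ, h1, h2⟩ := ih
      have hself : P.SelfPerfect σ := by
        rcases h2 with h2 | ⟨σ₀, h2, h3, _⟩
        · exact ExpansionReached.selfPerfect P h2.1
        · exact ExpansionStep.selfPerfect P (ExpansionReached.selfPerfect P h2) h3
      obtain ⟨σ', h3, h4⟩ := P.expand_spec hL hself (g (K + 1))
      refine ⟨σ', by rw [stepFold_succ, h1, h3], ?_⟩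
      have hsub := ExpansionStep.beneficiaries_subset P hself h4
      by_cases heq : P.beneficiaries (P.induced σ') = P.beneficiaries (P.induced σ)
      · rcases h2 with h2 | ⟨σ₀, h2, h5, h6⟩
        · exact Or.inr ⟨σ, h2.1, h4, heq⟩
        · exact Or.inr ⟨σ₀, h2, ExpansionStep.trans P h5 h6 h4, heq.trans h6⟩
      · have hlt := Set.ncard_lt_ncard (hsub.ssubset_of_ne fun h => heq h.symm) (Set.toFinite _)
        rcases h2 with h2 | ⟨σ₀, h2, h5, h6⟩
        · exact Or.inl ⟨.step σ σ' h2.1 h4 heq, by omega⟩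
        · -- after the phase has stopped, maximality excludes new beneficiaries
          exfalso
          have h7 := ExpansionStep.trans P h5 h6 h4
          have h8 := h5.2 σ' h7.1
          rw [← P.beneficiaries_induced h5.1.1, ← P.beneficiaries_induced h4.1.1] at h8
          omega
  obtain ⟨σ, h1, h2⟩ := key L
  have hda : (fun i => P.da (P.expansion L g i)) = P.induced σ := by
    funext i
    rw [expansion, h1]; rfl
  rw [hda]
  rcases h2 with ⟨_, h2⟩ | ⟨σ₀, h2, h3, h4⟩
  · have := Set.ncard_le_card (P.beneficiaries (P.induced σ))
    rw [Nat.card_eq_fintype_card, Fintype.card_fin] at this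
    omega
  · exact ⟨σ₀, σ, h2, h3, h4, rfl⟩

/-- The perfect matchings of an expansion phase as a sequence. -/
theorem ExpansionReached.exists_seq {σ : Equiv.Perm (Fin n)} (h : P.ExpansionReached σ) :
    ∃ K ≤ (P.beneficiaries (P.induced σ)).ncard, ∃ f : ℕ → Equiv.Perm (Fin n),
      P.IsPerfect ∅ (f 0) ∧ P.induced (f 0) = P.jbc ∧ f K = σ ∧
        ∀ t < K, P.SelfPerfect (f t) ∧ P.ExpansionStep (f t) (f (t + 1)) := by
  induction h with
  | init σ hσ h => exact ⟨0, Nat.zero_le _, fun _ => σ, hσ, h, rfl, by simp⟩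
  | step σ σ' h hs hne ih =>
    obtain ⟨K, hK, f, h1, h2, h3, h4⟩ := ih
    have hself := ExpansionReached.selfPerfect P h
    have hlt := Set.ncard_lt_ncard ((ExpansionStep.beneficiaries_subset P hself hs).ssubset_of_ne
      fun h => hne h.symm) (Set.toFinite _)
    refine ⟨K + 1, by omega, fun t => if t ≤ K then f t else σ', ?_, ?_, ?_, fun t ht => ?_⟩
    · simpa using h1
    · simpa using h2
    · simp
    · rcases Nat.lt_succ_iff_lt_or_eq.1 ht with ht' | rfl
      · have h5 : t ≤ K := ht'.le
        have h6 : t + 1 ≤ K := ht'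
        simp only [h5, h6, if_true]
        exact h4 t ht'
      · simp only [le_refl, if_true, h3]
        simpa using ⟨hself, hs⟩

/-- Every outcome of the expansion phase arises from suitable proposals. -/
theorem exists_expansion_eq {L : ℕ} (hL : n < L) {μ : Fin n → Option (Fin m)}
    (h : P.IsExpansionOutcome μ) :
    ∃ g : ℕ → Fin n → Fin n, (fun i => P.da (P.expansion L g i)) = μ := by
  obtain ⟨σ, σ', hr, hs, heq, rfl⟩ := h
  obtain ⟨K, hK, f, h1, h2, h3, h4⟩ := ExpansionReached.exists_seq P hr
  have hself := ExpansionReached.selfPerfect P hr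
  have hKL : K < L := by
    have := Set.ncard_le_card (P.beneficiaries (P.induced σ))
    rw [Nat.card_eq_fintype_card, Fintype.card_fin] at this
    omega
  -- after the last step, its result is proposed again
  refine ⟨fun t => if t ≤ K then f t else σ', ?_⟩
  have key : ∀ t, stepFold (fun t s => P.expand L s
      ((fun t => if t ≤ K then (f t : Fin n → Fin n) else σ') (t + 1))) t
        (P.initial (f 0)) = if t ≤ K then (f t : Fin n → Fin n) else σ' := by
    intro t
    induction t with
    | zero => simp [P.initial_eq h1 h2]
    | succ t ih =>
      rw [stepFold_succ, ih]
      rcases lt_trichotomy t K with ht | rfl | ht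
      · have h5 : t ≤ K := ht.le
        have h6 : t + 1 ≤ K := ht
        simp only [h5, h6, if_true]
        exact P.expand_eq hL (h4 t ht).1 (h4 t ht).2
      · simp only [le_refl, if_true, h3, Nat.not_succ_le_self, if_false]
        exact P.expand_eq hL hself hs
      · have h5 : ¬ t ≤ K := not_le.2 ht
        have h6 : ¬ t + 1 ≤ K := by omega
        simp only [h5, h6, if_false]
        refine P.expand_eq hL (ExpansionStep.selfPerfect P hself hs)
          ⟨⟨ExpansionStep.selfPerfect P hself hs, fun i hi => absurd rfl hi⟩, fun τ hτ => ?_⟩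
        rw [heq] at hτ
        refine hs.2 τ ⟨hτ.1, fun i hi => ?_⟩
        by_cases hτi : τ i = σ' i
        · rw [hτi] at hi ⊢; exact hs.1.2 i hi
        · exact hτ.2 i hτi
  have hKey := key L
  rw [if_neg (not_le.2 hKL)] at hKey
  funext i
  rw [expansion]
  simp only [Nat.zero_le, if_true]
  rw [hKey]; rfl

/-! ### The refinement phase as an algorithm -/

theorem admissible_irrefl (B : Set (Fin n)) (μ : Fin n → Option (Fin m)) (i : Fin n) :
    ¬ P.Admissible B μ i i := fun h => P.not_envies_self _ _ h.1

/-- The first successor along admissible edges that lie on cycles. -/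
noncomputable def cycleNext (B : Set (Fin n)) (μ : Fin n → Option (Fin m)) : Fin n → Fin n :=
  firstNext fun x y => P.Admissible B μ x y ∧ Relation.TransGen (P.Admissible B μ) y x

/-- The trades that are proposed may be executed in the refinement phase. -/
def ValidTrade (B : Set (Fin n)) (μ : Fin n → Option (Fin m)) (g : Fin n → Fin n) : Prop :=
  Function.Injective g ∧ (∃ i, g i ≠ i) ∧ ∀ i, g i ≠ i → P.Admissible B μ i (g i)

open Classical in
/-- The trades to be executed next: the proposal `g` if it consists of admissible cycles, and
otherwise the cycles of `cycleNext`. -/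
noncomputable def trade (B : Set (Fin n)) (μ : Fin n → Option (Fin m)) (g : Fin n → Fin n) :
    Fin n → Fin n :=
  if P.ValidTrade B μ g then g else periodicPerm (P.cycleNext B μ)

/-- The refinement phase with the proposals `g`. -/
noncomputable def refinement (B : Set (Fin n)) (K : ℕ) (g : ℕ → Fin n → Fin n)
    (μ : Fin n → Option (Fin m)) : Fin n → Option (Fin m) :=
  stepFold (fun t μ i => μ (P.trade B μ (g t) i)) K μ

/-- Disjoint admissible cycles can be executed one after the other. -/
theorem reflTransGen_refineStep (B : Set (Fin n)) (c : Equiv.Perm (Fin n))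
    (μ : Fin n → Option (Fin m)) (hc : ∀ i, c i ≠ i → P.Admissible B μ i (c i)) :
    Relation.ReflTransGen (P.RefineStep B) μ (μ ∘ c) := by
  induction c using Equiv.Perm.cycle_induction_on generalizing μ with
  | base_one => exact .refl
  | base_cycles σ hσ => exact .single ⟨σ, hσ, hc, rfl⟩
  | induction_disjoint σ τ hd _ ihσ ihτ =>
    have hfix : ∀ i, τ i ≠ i → σ i = i ∧ σ (τ i) = τ i := fun i hi =>
      ⟨(hd i).resolve_right hi, (hd (τ i)).resolve_right fun h => hi (τ.injective h)⟩
    have hσ : ∀ i, σ i ≠ i → P.Admissible B μ i (σ i) := by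
      intro i hi
      have hτi : τ i = i := (hd i).resolve_left hi
      have : (σ * τ) i = σ i := by rw [Equiv.Perm.mul_apply, hτi]
      rw [← this]
      exact hc i (by rwa [this])
    have hτ : ∀ i, τ i ≠ i → P.Admissible B (μ ∘ σ) i (τ i) := by
      intro i hi
      obtain ⟨h1, h2⟩ := hfix i hi
      have h3 : (σ * τ) i = τ i := by rw [Equiv.Perm.mul_apply, h2]
      have := hc i (by rwa [h3])
      rw [h3] at this
      simpa only [Admissible, Envies, Function.comp_apply, h1, h2] using this
    exact (ihσ μ hσ).trans (ihτ (μ ∘ σ) hτ)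

theorem trade_spec (B : Set (Fin n)) (μ : Fin n → Option (Fin m)) (g : Fin n → Fin n) :
    ∃ c : Equiv.Perm (Fin n), P.trade B μ g = c ∧
      (∀ i, c i ≠ i → P.Admissible B μ i (c i)) ∧
      ((∃ μ', P.RefineStep B μ μ') → ∃ i, c i ≠ i) := by
  rw [trade]
  split_ifs with h
  · exact ⟨Equiv.ofBijective g (Finite.injective_iff_bijective.1 h.1), rfl, h.2.2, fun _ => h.2.1⟩
  · refine ⟨_, rfl, fun i hi => ?_, ?_⟩
    · obtain ⟨_, heq⟩ := periodicPerm_ne hi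
      rw [heq] at hi ⊢
      rcases firstNext_spec (fun x y => P.Admissible B μ x y ∧
        Relation.TransGen (P.Admissible B μ) y x) i with h' | h'
      · exact h'.1.1
      · exact absurd h'.2 hi
    · rintro ⟨_, c, hc, hadm, rfl⟩
      obtain ⟨i, hi, _⟩ := hc
      have hnext : ∀ x, Relation.TransGen (P.Admissible B μ) x x →
          P.Admissible B μ x (P.cycleNext B μ x) ∧
            Relation.TransGen (P.Admissible B μ) (P.cycleNext B μ x) x := by
        intro x hx
        rcases firstNext_spec (fun x y => P.Admissible B μ x y ∧
          Relation.TransGen (P.Admissible B μ) y x) x with h' | h'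
        · exact h'.1
        · exfalso
          obtain ⟨y, hxy, hyx⟩ := Relation.TransGen.head'_iff.1 hx
          rcases Relation.reflTransGen_iff_eq_or_transGen.1 hyx with rfl | hyx
          · exact P.admissible_irrefl B μ _ hxy
          · exact h'.1 y ⟨hxy, hyx⟩
      refine exists_periodicPerm_ne (Q := {x | Relation.TransGen (P.Admissible B μ) x x})
        ⟨i, c.transGen_of_ne hadm hi⟩ (fun x hx => ?_) (fun x hx hfix => ?_)
      · obtain ⟨h1, h2⟩ := hnext x hx
        exact h2.tail h1
      · have := (hnext x hx).1
        rw [hfix] at this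
        exact P.admissible_irrefl B μ x this

/-- The sum of the ranks of all assignments decreases with every trade. -/
def rankSum (μ : Fin n → Option (Fin m)) : ℕ := ∑ i, (P.pref i (μ i) : ℕ)

theorem rankSum_le (μ : Fin n → Option (Fin m)) : P.rankSum μ ≤ n * m := by
  have : ∀ i ∈ Finset.univ, (P.pref i (μ i) : ℕ) ≤ m := fun i _ => by
    have := (P.pref i (μ i)).2
    have := Fintype.card_fin m
    omega
  simpa [rankSum] using Finset.sum_le_card_nsmul _ _ _ this

theorem rankSum_comp_lt {B : Set (Fin n)} {μ : Fin n → Option (Fin m)} {c : Fin n → Fin n}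
    (hc : ∀ i, c i ≠ i → P.Admissible B μ i (c i)) (hne : ∃ i, c i ≠ i) :
    P.rankSum (μ ∘ c) < P.rankSum μ := by
  have hlt : ∀ i, c i ≠ i → (P.pref i (μ (c i)) : ℕ) < P.pref i (μ i) := fun i hi =>
    Fin.lt_def.1 (hc i hi).1
  obtain ⟨i, hi⟩ := hne
  refine Finset.sum_lt_sum (fun j _ => ?_) ⟨i, Finset.mem_univ _, hlt i hi⟩
  by_cases hj : c j = j
  · rw [Function.comp_apply, hj]
  · exact (hlt j hj).le

theorem refinement_spec (B : Set (Fin n)) {K : ℕ} (hK : n * m < K) (g : ℕ → Fin n → Fin n)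
    (μ : Fin n → Option (Fin m)) :
    Relation.ReflTransGen (P.RefineStep B) μ (P.refinement B K g μ) ∧
      ∀ μ', ¬ P.RefineStep B (P.refinement B K g μ) μ' := by
  have key : ∀ t, Relation.ReflTransGen (P.RefineStep B) μ (P.refinement B t g μ) ∧
      ((∀ μ', ¬ P.RefineStep B (P.refinement B t g μ) μ') ∨
        P.rankSum (P.refinement B t g μ) + t ≤ P.rankSum μ) := by
    intro t
    induction t with
    | zero => exact ⟨.refl, Or.inr le_rfl⟩
    | succ t ih =>
      set ν := P.refinement B t g μ with hν
      obtain ⟨c, h1, h2, h3⟩ := P.trade_spec B ν (g t)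
      have hstep : P.refinement B (t + 1) g μ = ν ∘ c := by
        change (fun i => ν (P.trade B ν (g t) i)) = _
        rw [h1]; rfl
      rw [hstep]
      refine ⟨ih.1.trans (P.reflTransGen_refineStep B c ν h2), ?_⟩
      by_cases hmove : ∃ i, c i ≠ i
      · have hlt := P.rankSum_comp_lt h2 hmove
        rcases ih.2 with h4 | h4
        · exfalso
          rcases Relation.ReflTransGen.cases_head (P.reflTransGen_refineStep B c ν h2) with h5 | h5
          · rw [← h5] at hlt; exact lt_irrefl _ hlt
          · obtain ⟨_, h5, _⟩ := h5
            exact h4 _ h5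
        · exact Or.inr (by omega)
      · have hterm : ∀ μ', ¬ P.RefineStep B ν μ' := fun μ' h => hmove (h3 ⟨μ', h⟩)
        have hcν : ν ∘ c = ν := by
          funext i
          rw [Function.comp_apply, not_not.1 (not_exists.1 hmove i)]
        rw [hcν]
        exact Or.inl hterm
  refine ⟨(key K).1, (key K).2.resolve_right fun h => ?_⟩
  have := P.rankSum_le μ
  omega

/-- Every way to perform the refinement phase arises from suitable proposals. -/
theorem exists_refinement_eq {B : Set (Fin n)} {K : ℕ} (hK : n * m < K)
    {μ ν : Fin n → Option (Fin m)} (h : Relation.ReflTransGen (P.RefineStep B) μ ν)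
    (hterm : ∀ ν', ¬ P.RefineStep B ν ν') :
    ∃ g : ℕ → Fin n → Fin n, P.refinement B K g μ = ν := by
  have hpath : ∃ T, T + P.rankSum ν ≤ P.rankSum μ ∧ ∃ g : ℕ → Fin n → Fin n,
      P.refinement B T g μ = ν := by
    clear hterm
    induction h with
    | refl => exact ⟨0, by omega, fun _ => id, rfl⟩
    | @tail ν ν' _ hs ih =>
      obtain ⟨T, hT, g, hg⟩ := ih
      obtain ⟨c, hc, hadm, rfl⟩ := hs
      have hmove : ∃ i, c i ≠ i := by obtain ⟨i, hi, _⟩ := hc; exact ⟨i, hi⟩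
      have hlt := P.rankSum_comp_lt hadm hmove
      refine ⟨T + 1, by omega, fun t => if t < T then g t else c, ?_⟩
      have hpre : ∀ t ≤ T, P.refinement B t (fun t => if t < T then g t else c) μ =
          P.refinement B t g μ := by
        intro t ht
        induction t with
        | zero => rfl
        | succ t ih =>
          simp only [refinement, stepFold_succ] at ih ⊢
          rw [ih (by omega), if_pos (by omega)]
      have hlast := hpre T le_rfl
      simp only [refinement, stepFold_succ] at hlast hg ⊢
      rw [hlast, hg, if_neg (lt_irrefl T), trade, if_pos ⟨c.injective, hmove, hadm⟩]
      rfl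
  obtain ⟨T, hT, g, hg⟩ := hpath
  have hle := P.rankSum_le μ
  refine ⟨g, ?_⟩
  obtain ⟨d, rfl⟩ := Nat.exists_eq_add_of_le (show T ≤ K by omega)
  clear hK
  -- nothing can be traded at `ν` any more
  induction d with
  | zero => exact hg
  | succ d ih =>
    have hstep : P.refinement B (T + (d + 1)) g μ = fun i => ν (P.trade B ν (g (T + d)) i) := by
      rw [← ih]; rfl
    obtain ⟨c, h1, h2, _⟩ := P.trade_spec B ν (g (T + d))
    rw [hstep, h1]
    rcases Relation.ReflTransGen.cases_head (P.reflTransGen_refineStep B c ν h2) with h5 | h5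
    · exact h5.symm
    · obtain ⟨_, h5, _⟩ := h5
      exact absurd h5 (hterm _)

/-! ### The whole procedure as an algorithm -/

/-- The outcome that the proposals in the rows of `w` lead to: the rows up to `L` are used in the
expansion phase, and the following ones in the refinement phase. -/
noncomputable def sjbcPlus (L : ℕ) (w : ℕ → ℕ → ℕ) : Fin n → Option (Fin m) :=
  P.refinement (P.beneficiaries fun i => P.da (P.expansion L (fun t => guess fun j => w t j) i))
    (L * L) (fun t => guess fun j => w (t + (L + 1)) j)
    fun i => P.da (P.expansion L (fun t => guess fun j => w t j) i)

theorem isSJBCPlusOutcome_sjbcPlus {L : ℕ} (hn : n < L) (hm : m < L) (w : ℕ → ℕ → ℕ) :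
    P.IsSJBCPlusOutcome (P.sjbcPlus L w) := by
  have hspec := P.refinement_spec
    (P.beneficiaries fun i => P.da (P.expansion L (fun t => guess fun j => w t j) i))
    (K := L * L) (Nat.mul_lt_mul'' hn hm) (fun t => guess fun j => w (t + (L + 1)) j)
    fun i => P.da (P.expansion L (fun t => guess fun j => w t j) i)
  exact ⟨_, P.expansion_isExpansionOutcome hn _, hspec.1, hspec.2⟩

theorem expansion_congr {L : ℕ} {g g' : ℕ → Fin n → Fin n} (h : ∀ t ≤ L, g t = g' t) :
    P.expansion L g = P.expansion L g' := by
  have key : ∀ t ≤ L, stepFold (fun t s => P.expand L s (g (t + 1))) t (P.initial (g 0)) =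
      stepFold (fun t s => P.expand L s (g' (t + 1))) t (P.initial (g' 0)) := by
    intro t ht
    induction t with
    | zero => rw [stepFold_zero, stepFold_zero, h 0 (Nat.zero_le _)]
    | succ t ih => rw [stepFold_succ, stepFold_succ, ih (by omega), h _ ht]
  exact key L le_rfl

theorem exists_sjbcPlus_eq {L : ℕ} (hn : n < L) (hm : m < L) {μ : Fin n → Option (Fin m)}
    (h : P.IsSJBCPlusOutcome μ) : ∃ w, P.sjbcPlus L w = μ := by
  obtain ⟨μs, hexp, hpath, hterm⟩ := h
  obtain ⟨g, hg⟩ := P.exists_expansion_eq hn hexp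
  obtain ⟨g', hg'⟩ := P.exists_refinement_eq (Nat.mul_lt_mul'' hn hm) hpath hterm
  let row : ℕ → Fin n → Fin n := fun t => if t ≤ L then g t else g' (t - (L + 1))
  let w : ℕ → ℕ → ℕ := fun t j => if h : j < n then (row t ⟨j, h⟩ : ℕ) else 0
  have hw : ∀ t, (guess fun j : Fin n => w t j) = row t := by
    intro t
    rw [← guess_val (row t)]
    congr 1
    funext j
    simp [w]
  refine ⟨w, ?_⟩
  have h1 : P.expansion L (fun t => guess fun j => w t j) = P.expansion L g :=
    P.expansion_congr fun t ht => by rw [hw]; exact if_pos ht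
  have h2 : (fun t => guess fun j : Fin n => w (t + (L + 1)) j) = g' := by
    funext t
    rw [hw]
    simp only [row, if_neg (show ¬ t + (L + 1) ≤ L by omega), Nat.add_sub_cancel]
  rw [sjbcPlus, h1, h2, hg, hg']

end Problem

/-! ### Polynomial bounds and halting triples -/

namespace Ram

/-- The function `b` is bounded by a polynomial. -/
def PolyBound (b : ℕ → ℕ) : Prop := ∃ C k, ∀ x, 1 ≤ x → b x ≤ C * x ^ k

theorem PolyBound.const (c : ℕ) : PolyBound fun _ => c := ⟨c, 0, fun x _ => by simp⟩

theorem PolyBound.id : PolyBound fun x => x := ⟨1, 1, fun x _ => by simp⟩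

theorem PolyBound.add {b b' : ℕ → ℕ} (h : PolyBound b) (h' : PolyBound b') :
    PolyBound fun x => b x + b' x := by
  obtain ⟨C, k, h⟩ := h
  obtain ⟨C', k', h'⟩ := h'
  refine ⟨C + C', k + k', fun x hx => ?_⟩
  calc b x + b' x ≤ C * x ^ k + C' * x ^ k' := add_le_add (h x hx) (h' x hx)
    _ ≤ C * x ^ (k + k') + C' * x ^ (k + k') := by gcongr <;> omega
    _ = (C + C') * x ^ (k + k') := by ring

theorem PolyBound.mul {b b' : ℕ → ℕ} (h : PolyBound b) (h' : PolyBound b') :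
    PolyBound fun x => b x * b' x := by
  obtain ⟨C, k, h⟩ := h
  obtain ⟨C', k', h'⟩ := h'
  refine ⟨C * C', k + k', fun x hx => ?_⟩
  calc b x * b' x ≤ (C * x ^ k) * (C' * x ^ k') := Nat.mul_le_mul (h x hx) (h' x hx)
    _ = C * C' * x ^ (k + k') := by ring

/-- `M'` has the registers below `d` and the arrays below `k` of `M`. -/
structure Agree (d k : ℕ) (M M' : Memory) : Prop where
  reg : ∀ x < d, M'.reg x = M.reg x
  arr : ∀ a < k, M'.arr a = M.arr a

theorem Agree.trans {d k : ℕ} {M M' M'' : Memory} (h : Agree d k M M') (h' : Agree d k M' M'') :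
    Agree d k M M'' :=
  ⟨fun x hx => (h'.reg x hx).trans (h.reg x hx), fun a ha => (h'.arr a ha).trans (h.arr a ha)⟩

theorem Agree.mono {d k d' k' : ℕ} {M M' : Memory} (h : Agree d k M M') (hd : d' ≤ d)
    (hk : k' ≤ k) : Agree d' k' M M' :=
  ⟨fun x hx => h.reg x (hx.trans_le hd), fun a ha => h.arr a (ha.trans_le hk)⟩

@[simp]
theorem Memory.setReg_self (M : Memory) (x v : ℕ) : (M.setReg x v).reg x = v := if_pos rfl

theorem Memory.setReg_of_ne (M : Memory) {x y : ℕ} (v : ℕ) (h : y ≠ x) :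
    (M.setReg x v).reg y = M.reg y := if_neg h

@[simp]
theorem Memory.setReg_arr (M : Memory) (x v : ℕ) : (M.setReg x v).arr = M.arr := rfl

theorem Memory.setArr_of_ne (M : Memory) {a b : ℕ} (x y v : ℕ) (h : b ≠ a) :
    (M.setArr a x y v).arr b = M.arr b := by
  funext x' y'
  exact if_neg fun h' => h h'.1

theorem Memory.setArr_apply (M : Memory) (a x y v x' y' : ℕ) :
    (M.setArr a x y v).arr a x' y' = if x' = x ∧ y' = y then v else M.arr a x' y' := by
  simp [Memory.setArr]

theorem agree_setReg {d k x : ℕ} (M : Memory) (v : ℕ) (h : d ≤ x) : Agree d k M (M.setReg x v) :=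
  ⟨fun y hy => M.setReg_of_ne v (by omega), fun _ _ => rfl⟩

/-- Started in `M`, the program `p` halts within `T` steps in a memory with property `Q`. -/
def Halts (p : Program) (M : Memory) (T : ℕ) (Q : Memory → Prop) : Prop :=
  ∃ t M', Exec p M t M' ∧ t ≤ T ∧ Q M'

theorem Halts.mono {p : Program} {M : Memory} {T T' : ℕ} {Q Q' : Memory → Prop}
    (h : Halts p M T Q) (hT : T ≤ T') (hQ : ∀ M', Q M' → Q' M') : Halts p M T' Q' := by
  obtain ⟨t, M', h1, h2, h3⟩ := h
  exact ⟨t, M', h1, h2.trans hT, hQ _ h3⟩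

theorem Halts.assign {x : ℕ} {e : Expr} {M : Memory} {Q : Memory → Prop}
    (h : Q (M.setReg x (e.eval M))) : Halts (.assign x e) M (e.cost + 1) Q :=
  ⟨_, _, .assign x e M, le_rfl, h⟩

theorem Halts.store {a : ℕ} {e₁ e₂ e : Expr} {M : Memory} {Q : Memory → Prop}
    (h : Q (M.setArr a (e₁.eval M) (e₂.eval M) (e.eval M))) :
    Halts (.store a e₁ e₂ e) M (e₁.cost + e₂.cost + e.cost + 1) Q :=
  ⟨_, _, .store a e₁ e₂ e M, le_rfl, h⟩

theorem Halts.seq {p q : Program} {M : Memory} {T T' : ℕ} {Q Q' : Memory → Prop}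
    (hp : Halts p M T Q) (hq : ∀ M', Q M' → Halts q M' T' Q') :
    Halts (.seq p q) M (T + T') Q' := by
  obtain ⟨t, M₁, h1, h2, h3⟩ := hp
  obtain ⟨t', M₂, h4, h5, h6⟩ := hq M₁ h3
  exact ⟨_, _, .seq p q M M₁ M₂ t t' h1 h4, add_le_add h2 h5, h6⟩

theorem Halts.cond {e : Expr} {p q : Program} {M : Memory} {T : ℕ} {Q : Memory → Prop}
    (hp : e.eval M ≠ 0 → Halts p M T Q) (hq : e.eval M = 0 → Halts q M T Q) :
    Halts (.cond e p q) M (e.cost + 1 + T) Q := by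
  by_cases he : e.eval M = 0
  · obtain ⟨t, M', h1, h2, h3⟩ := hq he
    exact ⟨_, _, .condFalse e p q M M' t he h1, by omega, h3⟩
  · obtain ⟨t, M', h1, h2, h3⟩ := hp he
    exact ⟨_, _, .condTrue e p q M M' t he h1, by omega, h3⟩

/-- The program that runs `p` with the values `0, 1, …` below that of `e` in register `x`. -/
def forLoop (x : ℕ) (e : Expr) (p : Program) : Program :=
  .seq (.assign x (.lit 0))
    (.loop (.sub e (.reg x)) (.seq p (.assign x (.add (.reg x) (.lit 1)))))

/-- A bound for the running time of a loop with at most `B` rounds of at most `T` steps. -/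
def forTime (e : Expr) (B T : ℕ) : ℕ := 2 + (B + 1) * (e.cost + 7 + T)

/-- The rule for loops, with an invariant `I` that depends on the number of rounds. -/
theorem Halts.forLoop {x : ℕ} {e : Expr} {p : Program} {M : Memory} {B T : ℕ}
    (I : ℕ → Memory → Prop) (h0 : I 0 (M.setReg x 0)) (hB : ∀ c M', I c M' → e.eval M' = B)
    (hstep : ∀ c < B, ∀ M', M'.reg x = c → I c M' →
      Halts p M' T fun M'' => M''.reg x = c ∧ I (c + 1) (M''.setReg x (c + 1))) :
    Halts (forLoop x e p) M (forTime e B T) (I B) := by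
  have hloop : ∀ r c M', c + r = B → M'.reg x = c → I c M' →
      Halts (.loop (.sub e (.reg x)) (.seq p (.assign x (.add (.reg x) (.lit 1))))) M'
        ((r + 1) * (e.cost + 7 + T)) (I B) := by
    intro r
    induction r with
    | zero =>
      intro c M' hc hx hI
      obtain rfl : c = B := hc
      exact ⟨_, M', .loopDone _ _ _ (by simp [Expr.eval, hB _ _ hI, hx]),
        by simp only [Expr.cost]; omega, hI⟩
    | succ r ih =>
      intro c M' hc hx hI
      obtain ⟨t, M₁, h1, h2, h3, h4⟩ := hstep c (by omega) M' hx hI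
      have h5 : (Expr.add (.reg x) (.lit 1)).eval M₁ = c + 1 := by simp [Expr.eval, h3]
      obtain ⟨t', M₂, h6, h7, h8⟩ := ih (c + 1) (M₁.setReg x (c + 1)) (by omega) (by simp) h4
      have hexec := Exec.seq _ _ _ _ _ _ _ h1 (.assign x (.add (.reg x) (.lit 1)) M₁)
      rw [h5] at hexec
      refine ⟨_, M₂, .loopStep _ _ _ _ _ _ _ ?_ hexec h6, ?_, h8⟩
      · simp only [Expr.eval, hB _ _ hI, hx]; omega
      · simp only [Expr.cost]
        have : (r + 1 + 1) * (e.cost + 7 + T) = (r + 1) * (e.cost + 7 + T) + (e.cost + 7 + T) := by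
          ring
        omega
  refine (Halts.seq (Q := fun M' => M' = M.setReg x 0) (Halts.assign rfl) ?_).mono
    (le_of_eq rfl) fun _ h => h
  rintro _ rfl
  exact hloop B 0 _ (by omega) (by simp) h0

/-! ### Polynomial-time computable functions of the input

The functions considered take values for every input, with further arguments from a context. A
context is a list of scalars, held in registers, and of two-dimensional arrays. -/

/-- An input of the machine: a problem and the numbers that resolve the free selections. -/
structure Input where
  n : ℕ
  m : ℕ
  P : Problem (Fin n) (Fin m)
  w : ℕ → ℕ → ℕ

/-- The size of an input, by which running times are measured. -/
def Input.size (i : Input) : ℕ := i.n + i.m + 1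

/-- The memory `M` still contains the input. -/
structure Loaded (i : Input) (M : Memory) : Prop where
  reg_zero : M.reg 0 = i.n
  reg_one : M.reg 1 = i.m
  arr : ∀ a < 4, M.arr a = (input i.P i.w).arr a

theorem Loaded.agree {i : Input} {M M' : Memory} {d k : ℕ} (h : Loaded i M) (hd : 2 ≤ d)
    (hk : 5 ≤ k) (hA : Agree d k M M') : Loaded i M' :=
  ⟨(hA.reg 0 (by omega)).trans h.reg_zero, (hA.reg 1 (by omega)).trans h.reg_one,
    fun a ha => (hA.arr a (by omega)).trans (h.arr a ha)⟩

/-- Types, depending on the input, whose elements are represented by numbers. -/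
class Coded (τ : Input → Type) where
  enc : ∀ i, τ i → ℕ
  enc_injective : ∀ i, Function.Injective (enc i)

/-- Types represented by an initial segment of the natural numbers whose length is the value of an
expression, so that loops can run through all elements. -/
class Ranged (τ : Input → Type) extends Coded τ where
  card : Input → ℕ
  equiv : ∀ i, τ i ≃ Fin (card i)
  enc_eq : ∀ i x, enc i x = equiv i x
  card_le : ∀ i, card i ≤ i.size
  bound : Expr
  eval_bound : ∀ i M, Loaded i M → bound.eval M = card i

open Coded Ranged

theorem enc_lt {τ : Input → Type} [Ranged τ] (i : Input) (x : τ i) : enc i x < card τ i := by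
  rw [enc_eq]; exact (equiv i x).2

theorem exists_enc_eq {τ : Input → Type} [Ranged τ] {i : Input} {c : ℕ} (h : c < card τ i) :
    ∃ x : τ i, enc i x = c := ⟨(equiv i).symm ⟨c, h⟩, by rw [enc_eq]; simp⟩

instance : Coded fun _ => ℕ := ⟨fun _ x => x, fun _ _ _ h => h⟩

open Classical in
noncomputable instance : Coded fun _ => Prop where
  enc _ p := if p then 1 else 0
  enc_injective _ p q h := by
    dsimp only at h
    split_ifs at h with h1 h2 h2
    · exact propext ⟨fun _ => h2, fun _ => h1⟩
    · exact propext ⟨fun h => absurd h h1, fun h => absurd h h2⟩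

instance : Ranged fun _ => Unit where
  enc _ _ := 0
  enc_injective _ _ _ _ := rfl
  card _ := 1
  equiv _ := (Equiv.ofUnique Unit (Fin 1))
  enc_eq _ _ := by simp
  card_le i := by simp [Input.size]
  bound := .lit 1
  eval_bound _ _ _ := rfl

instance : Ranged fun i => Fin i.n where
  enc _ x := x
  enc_injective _ := Fin.val_injective
  card i := i.n
  equiv _ := Equiv.refl _
  enc_eq _ _ := rfl
  card_le i := by simp only [Input.size]; omega
  bound := .reg 0
  eval_bound _ _ h := h.reg_zero

instance : Ranged fun i => Fin i.m where
  enc _ x := x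
  enc_injective _ := Fin.val_injective
  card i := i.m
  equiv _ := Equiv.refl _
  enc_eq _ _ := rfl
  card_le i := by simp only [Input.size]; omega
  bound := .reg 1
  eval_bound _ _ h := h.reg_one

instance : Ranged fun i => Fin i.size where
  enc _ x := x
  enc_injective _ := Fin.val_injective
  card i := i.size
  equiv _ := Equiv.refl _
  enc_eq _ _ := rfl
  card_le i := le_rfl
  bound := .add (.add (.reg 0) (.reg 1)) (.lit 1)
  eval_bound _ _ h := by simp [Expr.eval, h.reg_zero, h.reg_one, Input.size]

instance : Ranged fun i => Option (Fin i.m) where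
  enc _ := code
  enc_injective _ x y h := by
    rcases x with _ | x <;> rcases y with _ | y <;> simp only [code] at h
    · rfl
    · have := y.2; omega
    · have := x.2; omega
    · rw [Fin.ext h]
  card i := i.m + 1
  equiv _ := finSuccEquivLast.symm
  enc_eq _ x := by rcases x with _ | x <;> simp [code]
  card_le i := by simp only [Input.size]; omega
  bound := .add (.reg 1) (.lit 1)
  eval_bound _ _ h := by simp [Expr.eval, h.reg_one]

/-- The empty context. -/
structure Nil (i : Input) : Type where

/-- The context `Γ` extended by a scalar. -/
structure Snoc (Γ τ : Input → Type) (i : Input) : Type where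
  rest : Γ i
  top : τ i

/-- The context `Γ` extended by an array. -/
structure SnocArr (Γ α β τ : Input → Type) (i : Input) : Type where
  rest : Γ i
  top : α i → β i → τ i

/-- Contexts. A layout says which registers and arrays hold the components of a context. -/
class Ctx (Γ : Input → Type) where
  Lay : Type
  /-- The memory represents the elements of the context in the given layout. -/
  Rep : Lay → ∀ i, Γ i → Memory → Prop
  /-- The layout uses only registers below `d` and arrays below `k`. -/
  Below : Lay → ℕ → ℕ → Prop
  below_mono : ∀ {ℓ d k d' k'}, Below ℓ d k → d ≤ d' → k ≤ k' → Below ℓ d' k'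
  rep_agree : ∀ {ℓ d k i γ M M'}, Below ℓ d k → Agree d k M M' → Rep ℓ i γ M → Rep ℓ i γ M'

open Ctx

instance : Ctx Nil where
  Lay := Unit
  Rep _ _ _ _ := True
  Below _ _ _ := True
  below_mono _ _ _ := trivial
  rep_agree _ _ _ := trivial

instance {Γ τ : Input → Type} [Ctx Γ] [Coded τ] : Ctx (Snoc Γ τ) where
  Lay := Lay Γ × ℕ
  Rep ℓ i q M := Rep ℓ.1 i q.rest M ∧ M.reg ℓ.2 = enc i q.top
  Below ℓ d k := Below ℓ.1 d k ∧ ℓ.2 < d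
  below_mono h hd hk := ⟨below_mono h.1 hd hk, h.2.trans_le hd⟩
  rep_agree h hA hR := ⟨rep_agree h.1 hA hR.1, (hA.reg _ h.2).trans hR.2⟩

instance {Γ α β τ : Input → Type} [Ctx Γ] [Ranged α] [Ranged β] [Coded τ] :
    Ctx (SnocArr Γ α β τ) where
  Lay := Lay Γ × ℕ
  Rep ℓ i q M := Rep ℓ.1 i q.rest M ∧ ∀ x y, M.arr ℓ.2 (enc i x) (enc i y) = enc i (q.top x y)
  Below ℓ d k := Below ℓ.1 d k ∧ ℓ.2 < k
  below_mono h hd hk := ⟨below_mono h.1 hd hk, h.2.trans_le hk⟩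
  rep_agree h hA hR := ⟨rep_agree h.1 hA hR.1, fun x y => by rw [hA.arr _ h.2]; exact hR.2 x y⟩

/-- The function `f` is computable in polynomial time: for every layout of its context, there is a
program that writes the code of the value into a given register `d` above the layout and leaves
the registers below `d` and the arrays below `k` unchanged. -/
def Feasible {Γ τ : Input → Type} [Ctx Γ] [Coded τ] (f : ∀ i, Γ i → τ i) : Prop :=
  ∀ (ℓ : Lay Γ) (d k : ℕ), 2 ≤ d → 5 ≤ k → Below ℓ d k → ∃ p b, PolyBound b ∧
    ∀ i γ M, Loaded i M → Rep ℓ i γ M →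
      Halts p M (b i.size) fun M' => Agree d k M M' ∧ M'.reg d = enc i (f i γ)

/-- Maps between contexts that forget or rearrange components. -/
class Ren {Δ Γ : Input → Type} [Ctx Δ] [Ctx Γ] (ρ : ∀ i, Δ i → Γ i) : Prop where
  exists_lay : ∀ ℓ : Lay Δ, ∃ ℓ' : Lay Γ, (∀ d k, Below ℓ d k → Below ℓ' d k) ∧
    ∀ i δ M, Rep ℓ i δ M → Rep ℓ' i (ρ i δ) M

section Ren

variable {Δ Γ τ α β : Input → Type} [Ctx Δ] [Ctx Γ] [Coded τ] [Ranged α] [Ranged β]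

instance : Ren fun i (δ : Δ i) => δ := ⟨fun ℓ => ⟨ℓ, fun _ _ h => h, fun _ _ _ h => h⟩⟩

instance {ρ : ∀ i, Δ i → Snoc Γ τ i} [h : Ren ρ] : Ren fun i δ => (ρ i δ).rest :=
  ⟨fun ℓ => by
    obtain ⟨ℓ', h1, h2⟩ := h.exists_lay ℓ
    exact ⟨ℓ'.1, fun d k hb => (h1 d k hb).1, fun i δ M hr => (h2 i δ M hr).1⟩⟩

instance {ρ : ∀ i, Δ i → SnocArr Γ α β τ i} [h : Ren ρ] : Ren fun i δ => (ρ i δ).rest :=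
  ⟨fun ℓ => by
    obtain ⟨ℓ', h1, h2⟩ := h.exists_lay ℓ
    exact ⟨ℓ'.1, fun d k hb => (h1 d k hb).1, fun i δ M hr => (h2 i δ M hr).1⟩⟩

theorem Ren.lift {ρ : ∀ i, Δ i → Γ i} (h : Ren ρ) :
    Ren fun i (q : Snoc Δ τ i) => (⟨ρ i q.rest, q.top⟩ : Snoc Γ τ i) :=
  ⟨fun ℓ => by
    obtain ⟨ℓ', h1, h2⟩ := h.exists_lay ℓ.1
    exact ⟨(ℓ', ℓ.2), fun d k hb => ⟨h1 d k hb.1, hb.2⟩, fun i q M hr => ⟨h2 i _ M hr.1, hr.2⟩⟩⟩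

end Ren

namespace Feasible

variable {Δ Γ τ τ' σ α β : Input → Type} [Ctx Δ] [Ctx Γ] [Coded τ] [Coded τ'] [Coded σ] [Ranged α]
  [Ranged β]

theorem ren {f : ∀ i, Γ i → τ i} (hf : Feasible f) {ρ : ∀ i, Δ i → Γ i} (hρ : Ren ρ) :
    Feasible fun i δ => f i (ρ i δ) := by
  intro ℓ d k hd hk hb
  obtain ⟨ℓ', h1, h2⟩ := hρ.exists_lay ℓ
  obtain ⟨p, b, hpb, hp⟩ := hf ℓ' d k hd hk (h1 d k hb)
  exact ⟨p, b, hpb, fun i δ M hM hR => hp i _ M hM (h2 i δ M hR)⟩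

/-- A scalar of the context. -/
theorem var (ρ : ∀ i, Δ i → Snoc Γ τ i) [hρ : Ren ρ] : Feasible fun i δ => (ρ i δ).top := by
  intro ℓ d k hd hk hb
  obtain ⟨ℓ', h1, h2⟩ := hρ.exists_lay ℓ
  refine ⟨.assign d (.reg ℓ'.2), _, .const 2, fun i δ M hM hR => ?_⟩
  refine (Halts.assign (Q := fun M' => Agree d k M M' ∧ _) ⟨agree_setReg _ _ le_rfl, ?_⟩).mono
    le_rfl fun _ h => h
  rw [Memory.setReg_self]
  exact (h2 i δ M hR).2

/-- Functions given by an expression without variables. -/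
theorem ofExpr {f : ∀ i, τ i} (E : Expr) (hE : ∀ i M, Loaded i M → E.eval M = enc i (f i)) :
    Feasible fun i (_ : Γ i) => f i := by
  intro ℓ d k hd hk hb
  refine ⟨.assign d E, _, .const (E.cost + 1), fun i δ M hM hR => ?_⟩
  refine Halts.assign ⟨agree_setReg _ _ le_rfl, ?_⟩
  rw [Memory.setReg_self, hE i M hM]

/-- The value of `x` is held in a register while `F` is computed. -/
theorem bind {F : ∀ i, Snoc Γ τ i → σ i} (hF : Feasible F) {ρ : ∀ i, Δ i → Γ i} (hρ : Ren ρ)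
    {x : ∀ i, Δ i → τ i} (hx : Feasible x) : Feasible fun i δ => F i ⟨ρ i δ, x i δ⟩ := by
  intro ℓ d k hd hk hb
  obtain ⟨ℓ', h1, h2⟩ := hρ.exists_lay ℓ
  obtain ⟨p, b, hpb, hp⟩ := hx ℓ d k hd hk hb
  obtain ⟨p', b', hpb', hp'⟩ := hF (ℓ', d) (d + 1) k (by omega) hk
    ⟨below_mono (h1 d k hb) (by omega) le_rfl, by omega⟩
  refine ⟨.seq p (.seq p' (.assign d (.reg (d + 1)))), _, hpb.add (hpb'.add (.const 2)),
    fun i δ M hM hR => ?_⟩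
  refine (hp i δ M hM hR).seq fun M₁ h3 => ?_
  refine (hp' i ⟨ρ i δ, x i δ⟩ M₁ (hM.agree hd hk h3.1)
    ⟨rep_agree (h1 d k hb) h3.1 (h2 i δ M hR), h3.2⟩).seq fun M₂ h4 => ?_
  refine Halts.assign ⟨?_, ?_⟩
  · exact (h3.1.trans (h4.1.mono (by omega) le_rfl)).trans (agree_setReg _ _ le_rfl)
  · rw [Memory.setReg_self]; exact h4.2

theorem app {F : ∀ i, Γ i → τ i → σ i} (hF : Feasible fun i (q : Snoc Γ τ i) => F i q.rest q.top)
    {ρ : ∀ i, Δ i → Γ i} [hρ : Ren ρ] {x : ∀ i, Δ i → τ i} (hx : Feasible x) :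
    Feasible fun i δ => F i (ρ i δ) (x i δ) :=
  hF.bind hρ hx

theorem app₂ {F : ∀ i, Γ i → τ i → τ' i → σ i}
    (hF : Feasible fun i (q : Snoc (Snoc Γ τ) τ' i) => F i q.rest.rest q.rest.top q.top)
    {ρ : ∀ i, Δ i → Γ i} [hρ : Ren ρ] {x : ∀ i, Δ i → τ i} (hx : Feasible x)
    {y : ∀ i, Δ i → τ' i} (hy : Feasible y) :
    Feasible fun i δ => F i (ρ i δ) (x i δ) (y i δ) := by
  have h1 : Feasible fun i (q : Snoc Δ τ i) => F i (ρ i q.rest) q.top (y i q.rest) :=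
    hF.bind hρ.lift (hy.ren (inferInstance : Ren fun i (q : Snoc Δ τ i) => q.rest))
  exact h1.bind (inferInstance : Ren fun i (δ : Δ i) => δ) hx

/-- An operation on one number given by an expression. -/
theorem map {f : ∀ i, Γ i → τ i} (hf : Feasible f) (g : ∀ i, τ i → σ i) (E : ℕ → Expr) (c : ℕ)
    (hc : ∀ a, (E a).cost ≤ c)
    (hE : ∀ i M a x, Loaded i M → M.reg a = enc i x → (E a).eval M = enc i (g i x)) :
    Feasible fun i γ => g i (f i γ) := by
  intro ℓ d k hd hk hb
  obtain ⟨p, b, hpb, hp⟩ := hf ℓ d k hd hk hb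
  refine ⟨.seq p (.assign d (E d)), _, hpb.add (.const (c + 1)), fun i γ M hM hR => ?_⟩
  refine ((hp i γ M hM hR).seq fun M₁ h1 => Halts.assign
    (Q := fun M' => Agree d k M M' ∧ M'.reg d = enc i (g i (f i γ))) ⟨?_, ?_⟩).mono
      (by have := hc d; omega) fun _ h => h
  · exact h1.1.trans (agree_setReg _ _ le_rfl)
  · rw [Memory.setReg_self]
    exact hE i M₁ d _ (hM.agree hd hk h1.1) h1.2

/-- An operation on two numbers given by an expression. -/
theorem map₂ {f : ∀ i, Γ i → τ i} (hf : Feasible f) {f' : ∀ i, Γ i → τ' i} (hf' : Feasible f')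
    (g : ∀ i, τ i → τ' i → σ i) (E : ℕ → ℕ → Expr) (c : ℕ) (hc : ∀ a a', (E a a').cost ≤ c)
    (hE : ∀ i M a a' x y, Loaded i M → M.reg a = enc i x → M.reg a' = enc i y →
      (E a a').eval M = enc i (g i x y)) :
    Feasible fun i γ => g i (f i γ) (f' i γ) := by
  intro ℓ d k hd hk hb
  obtain ⟨p, b, hpb, hp⟩ := hf ℓ d k hd hk hb
  obtain ⟨p', b', hpb', hp'⟩ := hf' ℓ (d + 1) k (by omega) hk (below_mono hb (by omega) le_rfl)
  refine ⟨.seq p (.seq p' (.assign d (E d (d + 1)))), _, hpb.add (hpb'.add (.const (c + 1))),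
    fun i γ M hM hR => ?_⟩
  refine ((hp i γ M hM hR).seq fun M₁ h1 => (hp' i γ M₁ (hM.agree hd hk h1.1)
    (rep_agree hb h1.1 hR)).seq fun M₂ h2 => Halts.assign
    (Q := fun M' => Agree d k M M' ∧ M'.reg d = enc i (g i (f i γ) (f' i γ))) ⟨?_, ?_⟩).mono
      (by have := hc d (d + 1); omega) fun _ h => h
  · exact (h1.1.trans (h2.1.mono (by omega) le_rfl)).trans (agree_setReg _ _ le_rfl)
  · rw [Memory.setReg_self]
    refine hE i M₂ d (d + 1) _ _ (hM.agree hd hk (h1.1.trans (h2.1.mono (by omega) le_rfl))) ?_ h2.2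
    rw [h2.1.reg d (by omega), h1.2]

/-- Case distinction. -/
theorem ite {c : ∀ i, Γ i → Prop} [∀ i γ, Decidable (c i γ)] (hc : Feasible c)
    {f g : ∀ i, Γ i → τ i} (hf : Feasible f) (hg : Feasible g) :
    Feasible fun i γ => if c i γ then f i γ else g i γ := by
  intro ℓ d k hd hk hb
  obtain ⟨p, b, hpb, hp⟩ := hc ℓ d k hd hk hb
  obtain ⟨q, b₁, hqb, hq⟩ := hf ℓ d k hd hk hb
  obtain ⟨r, b₂, hrb, hr⟩ := hg ℓ d k hd hk hb
  refine ⟨.seq p (.cond (.reg d) q r), _, hpb.add ((PolyBound.const 2).add (hqb.add hrb)),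
    fun i γ M hM hR => ?_⟩
  refine (hp i γ M hM hR).seq fun M₁ h1 => ?_
  have hM₁ := hM.agree hd hk h1.1
  have hR₁ := rep_agree hb h1.1 hR
  have hreg : (Expr.reg d).eval M₁ = enc (τ := fun _ => Prop) i (c i γ) := h1.2
  refine Halts.cond (fun h => ?_) (fun h => ?_)
  · have hcγ : c i γ := by
      by_contra hn
      exact h (hreg.trans (if_neg hn))
    simp only [if_pos hcγ]
    exact (hq i γ M₁ hM₁ hR₁).mono (by omega) fun M₂ h2 => ⟨h1.1.trans h2.1, h2.2⟩
  · have hcγ : ¬ c i γ := by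
      intro hc
      rw [hreg] at h
      exact one_ne_zero ((if_pos hc).symm.trans h)
    simp only [if_neg hcγ]
    exact (hr i γ M₁ hM₁ hR₁).mono (by omega) fun M₂ h2 => ⟨h1.1.trans h2.1, h2.2⟩

theorem forTime_mono {e : Expr} {B B' T T' : ℕ} (hB : B ≤ B') (hT : T ≤ T') :
    forTime e B T ≤ forTime e B' T' := by
  unfold forTime
  gcongr

theorem forTime_poly (e : Expr) {b b' : ℕ → ℕ} (h : PolyBound b) (h' : PolyBound b') :
    PolyBound fun x => forTime e (b x) (b' x) :=
  (PolyBound.const 2).add ((h.add (.const 1)).mul ((PolyBound.const _).add h'))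

/-- Sums over a type that loops can run through. -/
theorem sum [∀ i, Fintype (α i)] {f : ∀ i, Γ i → α i → ℕ}
    (hf : Feasible fun i (q : Snoc Γ α i) => f i q.rest q.top) :
    Feasible fun i γ => ∑ x, f i γ x := by
  intro ℓ d k hd hk hb
  obtain ⟨p, b, hpb, hp⟩ := hf (ℓ, d + 1) (d + 2) k (by omega) hk
    ⟨below_mono hb (by omega) le_rfl, by omega⟩
  refine ⟨.seq (.assign d (.lit 0)) (forLoop (d + 1) (bound α)
    (.seq p (.assign d (.add (.reg d) (.reg (d + 2)))))), _,
    (PolyBound.const 2).add (forTime_poly (bound α) .id (hpb.add (.const 4))), fun i γ M hM hR => ?_⟩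
  refine Halts.seq (Q := fun M' => M' = M.setReg d 0) (Halts.assign rfl) ?_
  rintro _ rfl
  have hsum : ∑ x, f i γ x = ∑ c : Fin (card α i), f i γ ((equiv i).symm c) :=
    (Equiv.sum_comp (equiv i).symm _).symm
  let v : ℕ → ℕ := fun c => if h : c < card α i then f i γ ((equiv i).symm ⟨c, h⟩) else 0
  have hsum' : ∑ x, f i γ x = ∑ c ∈ Finset.range (card α i), v c := by
    rw [hsum, Finset.sum_range]
    exact Finset.sum_congr rfl fun c _ => by simp [v]
  refine (Halts.forLoop (B := card α i) (T := b i.size + 4)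
    (fun c M' => Agree d k M M' ∧ M'.reg d = ∑ c' ∈ Finset.range c, v c') ⟨?_, ?_⟩ ?_ ?_).mono
      (forTime_mono (card_le i) le_rfl) fun M' h => ⟨h.1, by rw [h.2, ← hsum']; rfl⟩
  · exact (agree_setReg _ _ le_rfl).trans (agree_setReg _ _ (by omega))
  · rw [Memory.setReg_of_ne _ _ (by omega)]; simp
  · intro c M' h
    exact eval_bound i M' (hM.agree hd hk h.1)
  · rintro c hc M' hx ⟨h1, h2⟩
    have hval : enc i ((equiv i).symm ⟨c, hc⟩ : α i) = c := by rw [enc_eq]; simp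
    refine (hp i ⟨γ, (equiv i).symm ⟨c, hc⟩⟩ M' (hM.agree hd hk h1)
      ⟨rep_agree hb h1 hR, hx.trans hval.symm⟩).seq fun M₂ h3 => Halts.assign ⟨?_, ?_, ?_⟩
    · rw [Memory.setReg_of_ne _ _ (by omega), h3.1.reg _ (by omega), hx]
    · exact ((h1.trans (h3.1.mono (by omega) le_rfl)).trans (agree_setReg _ _ le_rfl)).trans
        (agree_setReg _ _ (by omega))
    · rw [Memory.setReg_of_ne _ _ (by omega), Memory.setReg_self, Finset.sum_range_succ]
      simp only [Expr.eval]
      rw [h3.1.reg _ (by omega), h2, h3.2]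
      simp only [v, dif_pos hc]
      rfl

/-- An entry of an array of the context. -/
theorem read (ρ : ∀ i, Δ i → SnocArr Γ α β τ i) [hρ : Ren ρ] {x : ∀ i, Δ i → α i}
    (hx : Feasible x) {y : ∀ i, Δ i → β i} (hy : Feasible y) :
    Feasible fun i δ => (ρ i δ).top (x i δ) (y i δ) := by
  intro ℓ d k hd hk hb
  obtain ⟨ℓ', h1, h2⟩ := hρ.exists_lay ℓ
  obtain ⟨p, b, hpb, hp⟩ := hx ℓ d k hd hk hb
  obtain ⟨p', b', hpb', hp'⟩ := hy ℓ (d + 1) k (by omega) hk (below_mono hb (by omega) le_rfl)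
  refine ⟨.seq p (.seq p' (.assign d (.read ℓ'.2 (.reg d) (.reg (d + 1))))), _,
    hpb.add (hpb'.add (.const 4)), fun i δ M hM hR => ?_⟩
  refine (hp i δ M hM hR).seq fun M₁ h3 => (hp' i δ M₁ (hM.agree hd hk h3.1)
    (rep_agree hb h3.1 hR)).seq fun M₂ h4 => Halts.assign ⟨?_, ?_⟩
  · exact (h3.1.trans (h4.1.mono (by omega) le_rfl)).trans (agree_setReg _ _ le_rfl)
  · rw [Memory.setReg_self]
    have hA : Agree d k M M₂ := h3.1.trans (h4.1.mono (by omega) le_rfl)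
    simp only [Expr.eval]
    rw [h4.2, h4.1.reg d (by omega), h3.2, hA.arr _ (h1 d k hb).2]
    exact (h2 i δ M hR).2 _ _

/-! ### Iterated updates of an array -/

/-- The program that fills the array `a` with the values that `p` computes in register `d + 2` from
the indices in the registers `d` and `d + 1`. -/
def tabulate (α β : Input → Type) [Ranged α] [Ranged β] (d a : ℕ) (p : Program) : Program :=
  forLoop d (bound α) (forLoop (d + 1) (bound β)
    (.seq p (.store a (.reg d) (.reg (d + 1)) (.reg (d + 2)))))

/-- A bound for the running time of `tabulate`. -/
def tabulateTime (α β : Input → Type) [Ranged α] [Ranged β] (B T : ℕ) : ℕ :=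
  forTime (bound α) B (forTime (bound β) B (T + 4))

omit [Ctx Δ] [Ctx Γ] [Coded τ] [Coded τ'] [Coded σ] in
theorem tabulateTime_poly {b b' : ℕ → ℕ} (h : PolyBound b) (h' : PolyBound b') :
    PolyBound fun x => tabulateTime α β (b x) (b' x) :=
  forTime_poly _ h (forTime_poly _ h (h'.add (.const 4)))

/-- `M'` differs from `M` in registers from `d` on, in arrays from `k` on, and in the array `a`. -/
structure AgreeExcept (d k a : ℕ) (M M' : Memory) : Prop where
  reg : ∀ x < d, M'.reg x = M.reg x
  arr : ∀ b < k, b ≠ a → M'.arr b = M.arr b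

theorem AgreeExcept.setReg {d k a x v : ℕ} {M M' : Memory} (h : AgreeExcept d k a M M')
    (hx : d ≤ x) : AgreeExcept d k a M (M'.setReg x v) :=
  ⟨fun y hy => (M'.setReg_of_ne v (by omega)).trans (h.reg y hy), h.arr⟩

theorem AgreeExcept.setArr {d k a x y v : ℕ} {M M' : Memory} (h : AgreeExcept d k a M M') :
    AgreeExcept d k a M (M'.setArr a x y v) :=
  ⟨h.reg, fun b hb hne => (M'.setArr_of_ne x y v hne).trans (h.arr b hb hne)⟩

theorem AgreeExcept.trans_agree {d k a d' : ℕ} {M M' M'' : Memory} (h : AgreeExcept d k a M M')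
    (h' : Agree d' k M' M'') (hd : d ≤ d') : AgreeExcept d k a M M'' :=
  ⟨fun y hy => (h'.reg y (by omega)).trans (h.reg y hy),
    fun b hb hne => (h'.arr b hb).trans (h.arr b hb hne)⟩

theorem AgreeExcept.agree {d k a k' : ℕ} {M M' : Memory} (h : AgreeExcept d k a M M')
    (hk : k' ≤ k) (ha : k' ≤ a) : Agree d k' M M' :=
  ⟨h.reg, fun b hb => h.arr b (by omega) (by omega)⟩

omit [Ctx Δ] [Ctx Γ] [Coded τ] [Coded τ'] [Coded σ] in
theorem halts_tabulate {i : Input} {d k a T : ℕ} {p : Program} {M : Memory} (v : α i → β i → ℕ)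
    (hd : 2 ≤ d) (hk : 5 ≤ k) (ha : 5 ≤ a) (hak : a < k) (hM : Loaded i M)
    (hp : ∀ M' x y, Loaded i M' → AgreeExcept d k a M M' → M'.reg d = enc i x →
      M'.reg (d + 1) = enc i y →
      Halts p M' T fun M'' => Agree (d + 2) k M' M'' ∧ M''.reg (d + 2) = v x y) :
    Halts (tabulate α β d a p) M (tabulateTime α β i.size T) fun M' =>
      AgreeExcept d k a M M' ∧ ∀ x y, M'.arr a (enc i x) (enc i y) = v x y := by
  have hload : ∀ M', AgreeExcept d k a M M' → Loaded i M' := fun M' h =>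
    hM.agree (k := 5) hd le_rfl (h.agree hk ha)
  refine (Halts.forLoop (B := card α i) (T := forTime (bound β) i.size (T + 4))
    (fun c M' => AgreeExcept d k a M M' ∧
      ∀ x y, enc i x < c → M'.arr a (enc i x) (enc i y) = v x y) ⟨?_, ?_⟩ ?_ ?_).mono
      (forTime_mono (card_le i) le_rfl) fun M' h => ⟨h.1, fun x y => h.2 x y (enc_lt i x)⟩
  · exact AgreeExcept.setReg ⟨fun _ _ => rfl, fun _ _ _ => rfl⟩ le_rfl
  · intro x y h; omega
  · exact fun c M' h => eval_bound i M' (hload M' h.1)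
  · rintro c hc M₁ hx ⟨h1, h2⟩
    obtain ⟨x₀, rfl⟩ := exists_enc_eq hc
    refine (Halts.forLoop (B := card β i) (T := T + 4)
      (fun c' M' => AgreeExcept d k a M M' ∧ M'.reg d = enc i x₀ ∧
        (∀ x y, enc i x < enc i x₀ → M'.arr a (enc i x) (enc i y) = v x y) ∧
        ∀ y, enc i y < c' → M'.arr a (enc i x₀) (enc i y) = v x₀ y) ⟨?_, ?_, ?_, ?_⟩ ?_ ?_).mono
        (forTime_mono (card_le i) le_rfl) fun M' h => ⟨h.2.1, h.1.setReg le_rfl, fun x y hxy => ?_⟩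
    · exact h1.setReg (by omega)
    · rw [Memory.setReg_of_ne _ _ (by omega), hx]
    · exact h2
    · intro y h; omega
    · exact fun c M' h => eval_bound i M' (hload M' h.1)
    · rintro c' hc' M₂ hy ⟨h3, h4, h5, h6⟩
      obtain ⟨y₀, rfl⟩ := exists_enc_eq hc'
      refine (hp M₂ x₀ y₀ (hload M₂ h3) h3 h4 hy).seq fun M₃ h7 => Halts.store ?_
      have e1 : (Expr.reg d).eval M₃ = enc i x₀ := (h7.1.reg d (by omega)).trans h4
      have e2 : (Expr.reg (d + 1)).eval M₃ = enc i y₀ := (h7.1.reg (d + 1) (by omega)).trans hy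
      have e3 : (Expr.reg (d + 2)).eval M₃ = v x₀ y₀ := h7.2
      have harr : ∀ x y, (M₃.setArr a (enc i x₀) (enc i y₀) (v x₀ y₀)).arr a x y =
          if x = enc i x₀ ∧ y = enc i y₀ then v x₀ y₀ else M₂.arr a x y := fun x y => by
        rw [Memory.setArr_apply, h7.1.arr a hak]
      rw [e1, e2, e3]
      refine ⟨e2, ?_, ?_, ?_, ?_⟩
      · exact ((h3.trans_agree h7.1 (by omega)).setArr).setReg (by omega)
      · rw [Memory.setReg_of_ne _ _ (by omega)]; exact e1
      · intro x y hlt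
        rw [Memory.setReg_arr, harr, if_neg fun h => (hlt.ne h.1).elim]
        exact h5 x y hlt
      · intro y hlt
        rw [Memory.setReg_arr, harr]
        by_cases hyy : enc i y = enc i y₀
        · rw [if_pos ⟨rfl, hyy⟩, enc_injective i hyy]
        · rw [if_neg fun h => hyy h.2]
          exact h6 y (by omega)
    · rw [Memory.setReg_arr]
      rcases Nat.lt_succ_iff_lt_or_eq.1 hxy with h' | h'
      · exact h.2.2.1 x y h'
      · rw [enc_injective i h']
        exact h.2.2.2 y (enc_lt i y)

/-- Polynomially many updates of an array, where each entry is computed from the whole array of the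
step before. The new entries are collected in a second array first. -/
theorem fold {K : ∀ i, Γ i → ℕ} (hK : Feasible K)
    (hKb : ∃ b, PolyBound b ∧ ∀ i γ, K i γ ≤ b i.size)
    {init : ∀ i, Γ i → α i → β i → τ i}
    (hinit : Feasible fun i (q : Snoc (Snoc Γ α) β i) => init i q.rest.rest q.rest.top q.top)
    {g : ∀ i, Γ i → ℕ → (α i → β i → τ i) → α i → β i → τ i}
    (hg : Feasible fun i (q : Snoc (Snoc (SnocArr (Snoc Γ fun _ => ℕ) α β τ) α) β i) =>
      g i q.rest.rest.rest.rest q.rest.rest.rest.top q.rest.rest.top q.rest.top q.top)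
    {F : ∀ i, SnocArr Γ α β τ i → σ i} (hF : Feasible F) :
    Feasible fun i γ => F i ⟨γ, stepFold (g i γ) (K i γ) (init i γ)⟩ := by
  intro ℓ d k hd hk hb
  obtain ⟨bK, hbK, hKle⟩ := hKb
  obtain ⟨pK, b₁, hb₁, hpK⟩ := hK ℓ d k hd hk hb
  obtain ⟨pI, b₂, hb₂, hpI⟩ := hinit ((ℓ, d + 2), d + 3) (d + 4) (k + 2) (by omega) (by omega)
    ⟨⟨below_mono hb (by omega) (by omega), by dsimp only; omega⟩, by dsimp only; omega⟩
  obtain ⟨pg, b₃, hb₃, hpg⟩ := hg ((((ℓ, d + 1), k), d + 2), d + 3) (d + 4) (k + 2) (by omega)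
    (by omega) ⟨⟨⟨⟨below_mono hb (by omega) (by omega), by dsimp only; omega⟩,
      by dsimp only; omega⟩, by dsimp only; omega⟩, by dsimp only; omega⟩
  obtain ⟨pF, b₄, hb₄, hpF⟩ := hF (ℓ, k) (d + 1) (k + 1) (by omega) (by omega)
    ⟨below_mono hb (by omega) (by omega), by omega⟩
  refine ⟨.seq pK (.seq (tabulate α β (d + 2) k pI) (.seq (forLoop (d + 1) (.reg d)
    (.seq (tabulate α β (d + 2) (k + 1) pg) (tabulate α β (d + 2) k
      (.assign (d + 4) (.read (k + 1) (.reg (d + 2)) (.reg (d + 3)))))))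
    (.seq pF (.assign d (.reg (d + 1)))))), _, hb₁.add ((tabulateTime_poly (α := α) (β := β) .id
      hb₂).add ((forTime_poly (.reg d) hbK ((tabulateTime_poly (α := α) (β := β) .id hb₃).add
      (tabulateTime_poly (α := α) (β := β) .id (.const 4)))).add (hb₄.add (.const 2)))),
    fun i γ M hM hR => ?_⟩
  set S : ℕ → α i → β i → τ i := fun c => stepFold (g i γ) c (init i γ) with hS
  refine (hpK i γ M hM hR).seq fun M₁ h1 => ?_
  have hM₁ := hM.agree hd hk h1.1
  have hR₁ := rep_agree hb h1.1 hR
  refine (halts_tabulate (k := k + 2) (fun x y => enc i (S 0 x y)) (by omega) (by omega) (by omega)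
    (by omega) hM₁ fun M' x y hM' hA hx hy => ?_).seq fun M₂ h2 => ?_
  · refine hpI i ⟨⟨γ, x⟩, y⟩ M' hM' ⟨⟨rep_agree hb ?_ hR₁, hx⟩, hy⟩
    exact (hA.agree (by omega) le_rfl).mono (by omega) le_rfl
  have hA₂ : Agree d k M M₂ :=
    h1.1.trans ((h2.1.agree (by omega) le_rfl).mono (by omega) le_rfl)
  refine Halts.seq ((Halts.forLoop (B := K i γ)
    (T := tabulateTime α β i.size (b₃ i.size) + tabulateTime α β i.size 4)
    (fun c M' => Agree d k M M' ∧ M'.reg d = K i γ ∧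
      ∀ x y, M'.arr k (enc i x) (enc i y) = enc i (S c x y)) ⟨?_, ?_, ?_⟩ ?_ ?_).mono
      (forTime_mono (hKle i γ) le_rfl) fun _ h => h) fun M₃ h3 => ?_
  · exact hA₂.trans (agree_setReg _ _ (by omega))
  · rw [Memory.setReg_of_ne _ _ (by omega), h2.1.reg d (by omega), h1.2]; rfl
  · exact h2.2
  · exact fun c M' h => h.2.1
  · rintro c hc M' hx ⟨h3, h4, h5⟩
    have hM' := hM.agree hd hk h3
    refine (halts_tabulate (k := k + 2) (fun x y => enc i (S (c + 1) x y)) (by omega) (by omega)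
      (by omega) (by omega) hM' fun M'' x y hM'' hA hx' hy => ?_).seq fun M'' h6 => ?_
    · have hA' : Agree (d + 2) (k + 1) M' M'' := hA.agree (by omega) le_rfl
      refine hpg i ⟨⟨⟨⟨γ, c⟩, S c⟩, x⟩, y⟩ M'' hM'' ⟨⟨⟨⟨rep_agree hb (h3.trans
        (hA'.mono (by omega) (by omega))) hR, ?_⟩, ?_⟩, hx'⟩, hy⟩
      · exact (hA'.reg (d + 1) (by omega)).trans hx
      · intro x y
        rw [hA'.arr k (by omega)]
        exact h5 x y
    · have hA₃ : Agree (d + 2) (k + 1) M' M'' := h6.1.agree (by omega) le_rfl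
      have hM'' := hM'.agree (k := k + 1) (d := d + 2) (by omega) (by omega) hA₃
      refine (halts_tabulate (k := k + 2) (fun x y => enc i (S (c + 1) x y)) (by omega) (by omega)
        (by omega) (by omega) hM'' fun N x y _ hA hx' hy => ?_).mono le_rfl fun N h7 =>
          ⟨?_, ?_, ?_, ?_⟩
      · refine Halts.assign ⟨agree_setReg _ _ le_rfl, ?_⟩
        rw [Memory.setReg_self]
        simp only [Expr.eval]
        rw [hx', hy, hA.arr (k + 1) (by omega) (by omega)]
        exact h6.2 x y
      · rw [h7.1.reg _ (by omega), hA₃.reg _ (by omega), hx]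
      · refine (h3.trans ?_).trans (agree_setReg _ _ (by omega))
        exact (hA₃.mono (by omega) (by omega)).trans
          ((h7.1.agree (by omega) le_rfl).mono (by omega) le_rfl)
      · rw [Memory.setReg_of_ne _ _ (by omega), h7.1.reg _ (by omega), hA₃.reg _ (by omega), h4]
      · exact h7.2
  · refine (hpF i ⟨γ, S (K i γ)⟩ M₃ (hM.agree hd hk h3.1)
      ⟨rep_agree hb h3.1 hR, h3.2.2⟩).seq fun M₄ h4 => Halts.assign ⟨?_, ?_⟩
    · exact (h3.1.trans (h4.1.mono (by omega) (by omega))).trans (agree_setReg _ _ le_rfl)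
    · rw [Memory.setReg_self]; exact h4.2

end Feasible

/-- A polynomial-time computable assignment is output by a program with polynomial running time. -/
theorem exists_program {f : ∀ i : Input, Fin i.n → Option (Fin i.m)}
    (hf : Feasible fun i (q : Snoc Nil (fun i => Fin i.n) i) => f i q.top) :
    ∃ (prog : Program) (C k : ℕ), ∀ i : Input, ∃ t M, Exec prog (input i.P i.w) t M ∧
      t ≤ C * i.size ^ k ∧ Outputs M (f i) := by
  obtain ⟨p, b, hpb, hp⟩ := hf ((), 2) 3 5 (by omega) le_rfl ⟨trivial, by omega⟩
  obtain ⟨C, k, hCk⟩ := Feasible.forTime_poly (.reg 0) .id (hpb.add (.const 4))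
  refine ⟨forLoop 2 (.reg 0) (.seq p (.store 4 (.reg 2) (.lit 0) (.reg 3))), C, k, fun i => ?_⟩
  have hload : Loaded i (input i.P i.w) := ⟨rfl, rfl, fun _ _ => rfl⟩
  obtain ⟨t, M, h1, h2, h3⟩ := Halts.forLoop (x := 2) (e := .reg 0) (B := i.n)
    (p := .seq p (.store 4 (.reg 2) (.lit 0) (.reg 3))) (M := input i.P i.w) (T := b i.size + 4)
    (fun c M' => Agree 2 4 (input i.P i.w) M' ∧ ∀ x : Fin i.n, (x : ℕ) < c →
      M'.arr 4 x 0 = code (f i x)) ⟨agree_setReg _ _ le_rfl, fun x hx => by omega⟩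
    (fun c M' h => h.1.reg 0 (by omega)) (by
      rintro c hc M' hx ⟨h1, h2⟩
      have hM' : Loaded i M' := ⟨h1.reg 0 (by omega), h1.reg 1 (by omega), fun a ha => h1.arr a ha⟩
      refine (hp i ⟨⟨⟩, ⟨c, hc⟩⟩ M' hM' ⟨trivial, hx⟩).seq fun M₁ h3 => Halts.store ?_
      have e1 : (Expr.reg 2).eval M₁ = c := (h3.1.reg 2 (by omega)).trans hx
      rw [e1]
      refine ⟨e1, ⟨fun x hx => ?_, fun a ha => ?_⟩, fun x hx => ?_⟩
      · rw [Memory.setReg_of_ne _ _ (by omega)]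
        exact (h3.1.reg x (by omega)).trans (h1.reg x hx)
      · rw [Memory.setReg_arr, Memory.setArr_of_ne _ _ _ _ (by omega)]
        exact (h3.1.arr a (by omega)).trans (h1.arr a ha)
      · rw [Memory.setReg_arr, Memory.setArr_apply]
        by_cases hxc : (x : ℕ) = c
        · rw [if_pos ⟨hxc, rfl⟩]
          obtain rfl : x = ⟨c, hc⟩ := Fin.ext hxc
          exact h3.2
        · rw [if_neg fun h => hxc h.1, h3.1.arr 4 (by omega)]
          exact h2 x (by omega))
  refine ⟨t, M, h1, h2.trans (le_trans ?_ (hCk i.size (by simp [Input.size]))), fun x => h3.2 x x.2⟩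
  exact Feasible.forTime_mono (by simp only [Input.size]; omega) le_rfl

end Ram

/-! ### Closure properties of polynomial-time computability -/

namespace Ram

open Coded Ranged Ctx

namespace Feasible

variable {Γ τ α β : Input → Type} [Ctx Γ] [Coded τ] [Ranged α] [Ranged β]

theorem of_enc {f : ∀ i, Γ i → τ i} (h : Feasible fun i γ => enc i (f i γ)) : Feasible f := h

theorem encode {f : ∀ i, Γ i → τ i} (h : Feasible f) : Feasible fun i γ => enc i (f i γ) := h

theorem val_n {x : ∀ i, Γ i → Fin i.n} (h : Feasible x) : Feasible fun i γ => (x i γ : ℕ) := h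

theorem val_size {x : ∀ i, Γ i → Fin i.size} (h : Feasible x) :
    Feasible fun i γ => (x i γ : ℕ) := h

/-- Further variables may be added to the context. -/
theorem wk {Δ : Input → Type} [Ctx Δ] {f : ∀ i, Γ i → τ i} (hf : Feasible f) {ρ : ∀ i, Δ i → Γ i}
    [hρ : Ren ρ] : Feasible fun i δ => f i (ρ i δ) := hf.ren hρ

theorem lit (c : ℕ) : Feasible fun i (_ : Γ i) => c := ofExpr (.lit c) fun _ _ _ => rfl

theorem n : Feasible fun i (_ : Γ i) => i.n := ofExpr (.reg 0) fun _ _ h => h.reg_zero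

theorem unit : Feasible fun i (_ : Γ i) => () := ofExpr (.lit 0) fun _ _ _ => rfl

theorem size : Feasible fun i (_ : Γ i) => i.size :=
  ofExpr (.add (.add (.reg 0) (.reg 1)) (.lit 1)) fun _ _ h => by
    simp [Expr.eval, h.reg_zero, h.reg_one, Input.size, enc]

theorem false : Feasible fun i (_ : Γ i) => False :=
  ofExpr (.lit 0) fun _ _ _ => (if_neg id).symm

theorem some {x : ∀ i, Γ i → Fin i.m} (hx : Feasible x) : Feasible fun i γ => Option.some (x i γ) :=
  hx

section Numbers

variable {f g : ∀ i, Γ i → ℕ}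

theorem add (hf : Feasible f) (hg : Feasible g) : Feasible fun i γ => f i γ + g i γ :=
  map₂ hf hg (fun _ x y => x + y) (fun a b => .add (.reg a) (.reg b)) 3 (fun _ _ => le_rfl)
    fun _ _ _ _ _ _ _ h h' => congrArg₂ (· + ·) h h'

theorem lt (hf : Feasible f) (hg : Feasible g) : Feasible fun i γ => f i γ < g i γ :=
  map₂ hf hg (fun _ x y => x < y)
    (fun a b => .sub (.lit 1) (.sub (.lit 1) (.sub (.reg b) (.reg a)))) 7 (fun _ _ => le_rfl)
    fun i M a b x y _ h h' => by
      simp only [Expr.eval, h, h', enc]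
      split_ifs <;> omega

theorem le (hf : Feasible f) (hg : Feasible g) : Feasible fun i γ => f i γ ≤ g i γ :=
  map₂ hf hg (fun _ x y => x ≤ y)
    (fun a b => .sub (.lit 1) (.sub (.reg a) (.reg b))) 5 (fun _ _ => le_rfl)
    fun i M a b x y _ h h' => by
      simp only [Expr.eval, h, h', enc]
      split_ifs <;> omega

end Numbers

theorem le_n {x y : ∀ i, Γ i → Fin i.n} (hx : Feasible x) (hy : Feasible y) :
    Feasible fun i γ => x i γ ≤ y i γ := le hx.val_n hy.val_n

theorem eq {f g : ∀ i, Γ i → τ i} (hf : Feasible f) (hg : Feasible g) :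
    Feasible fun i γ => f i γ = g i γ :=
  map₂ hf hg (fun _ x y => x = y)
    (fun a b => .sub (.lit 1) (.add (.sub (.reg a) (.reg b)) (.sub (.reg b) (.reg a)))) 9
    (fun _ _ => le_rfl) fun i M a b x y _ h h' => by
      have h1 : enc (τ := fun _ => Prop) i (x = y) = if enc i x = enc i y then 1 else 0 := by
        by_cases hxy : x = y
        · rw [if_pos (congrArg _ hxy)]; exact if_pos hxy
        · rw [if_neg fun h => hxy (enc_injective i h)]; exact if_neg hxy
      simp only [Expr.eval, h, h', h1]
      split_ifs <;> omega

section Logic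

variable {p q : ∀ i, Γ i → Prop}

theorem not (hp : Feasible p) : Feasible fun i γ => ¬ p i γ :=
  map hp (fun _ x => ¬ x) (fun a => .sub (.lit 1) (.reg a)) 3 (fun _ => le_rfl)
    fun i M a x _ h => by
      by_cases hx : x <;> simp [Expr.eval, h, enc, hx]

theorem and (hp : Feasible p) (hq : Feasible q) : Feasible fun i γ => p i γ ∧ q i γ :=
  map₂ hp hq (fun _ x y => x ∧ y) (fun a b => .sub (.add (.reg a) (.reg b)) (.lit 1)) 5
    (fun _ _ => le_rfl) fun i M a b x y _ h h' => by
      by_cases hx : x <;> by_cases hy : y <;> simp [Expr.eval, h, h', enc, hx, hy]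

theorem or (hp : Feasible p) (hq : Feasible q) : Feasible fun i γ => p i γ ∨ q i γ :=
  map₂ hp hq (fun _ x y => x ∨ y)
    (fun a b => .sub (.lit 1) (.sub (.lit 1) (.add (.reg a) (.reg b)))) 7
    (fun _ _ => le_rfl) fun i M a b x y _ h h' => by
      by_cases hx : x <;> by_cases hy : y <;> simp [Expr.eval, h, h', enc, hx, hy]

theorem imp (hp : Feasible p) (hq : Feasible q) : Feasible fun i γ => p i γ → q i γ :=
  map₂ hp hq (fun _ x y => x → y) (fun a b => .sub (.lit 1) (.sub (.reg a) (.reg b))) 5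
    (fun _ _ => le_rfl) fun i M a b x y _ h h' => by
      by_cases hx : x <;> by_cases hy : y <;> simp [Expr.eval, h, h', enc, hx, hy]

end Logic

theorem congr {f g : ∀ i, Γ i → τ i} (hf : Feasible f) (h : ∀ i γ, f i γ = g i γ) : Feasible g := by
  obtain rfl : f = g := funext fun i => funext fun γ => h i γ
  exact hf

theorem ex {p : ∀ i, Γ i → α i → Prop} (hp : Feasible fun i (q : Snoc Γ α i) => p i q.rest q.top) :
    Feasible fun i γ => ∃ x, p i γ x := by
  classical
  let _ : ∀ i, Fintype (α i) := fun i => Fintype.ofEquiv _ (equiv i).symm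
  have h : Feasible fun i γ => 0 < ∑ x, if p i γ x then 1 else 0 :=
    lt (lit 0) (sum (ite hp (lit 1) (lit 0)))
  refine h.congr fun i γ => propext ?_
  simp [Finset.sum_boole, Finset.card_pos, Finset.filter_nonempty_iff]

theorem all {p : ∀ i, Γ i → α i → Prop}
    (hp : Feasible fun i (q : Snoc Γ α i) => p i q.rest q.top) :
    Feasible fun i γ => ∀ x, p i γ x :=
  (not (ex (p := fun i γ x => ¬ p i γ x) hp.not)).congr fun i γ => propext (by simp)

theorem ncard {p : ∀ i, Γ i → α i → Prop}
    (hp : Feasible fun i (q : Snoc Γ α i) => p i q.rest q.top) :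
    Feasible fun i γ => {x | p i γ x}.ncard := by
  classical
  let _ : ∀ i, Fintype (α i) := fun i => Fintype.ofEquiv _ (equiv i).symm
  have h : Feasible fun i γ => ∑ x, if p i γ x then 1 else 0 := sum (ite hp (lit 1) (lit 0))
  refine h.congr fun i γ => ?_
  rw [Finset.sum_boole, ← Set.ncard_coe_finset]
  simp

/-- A function is computable if its graph is decidable: its value is found by exhaustive search. -/
theorem of_graph {f : ∀ i, Γ i → α i} (p : ∀ i, Γ i → α i → Prop)
    (hp : Feasible fun i (q : Snoc Γ α i) => p i q.rest q.top)
    (h : ∀ i γ x, p i γ x ↔ x = f i γ) : Feasible f := by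
  classical
  let _ : ∀ i, Fintype (α i) := fun i => Fintype.ofEquiv _ (equiv i).symm
  have h' : Feasible fun i γ => ∑ x, if p i γ x then enc i x else 0 :=
    sum (ite hp (encode (var fun i (q : Snoc Γ α i) => q)) (lit 0))
  refine of_enc (h'.congr fun i γ => ?_)
  simp [h]

/-- The iteration of an operator on relations, starting from the empty relation. -/
theorem iterate {K : ∀ i, Γ i → ℕ} (hK : Feasible K)
    (hKb : ∃ b, PolyBound b ∧ ∀ i γ, K i γ ≤ b i.size)
    {g : ∀ i, Γ i → (α i → β i → Prop) → α i → β i → Prop}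
    (hg : Feasible fun i (q : Snoc (Snoc (SnocArr (Snoc Γ fun _ => ℕ) α β fun _ => Prop) α) β i) =>
      g i q.rest.rest.rest.rest q.rest.rest.top q.rest.top q.top)
    {x : ∀ i, Γ i → α i} (hx : Feasible x) {y : ∀ i, Γ i → β i} (hy : Feasible y) :
    Feasible fun i γ => ((g i γ)^[K i γ] fun _ _ => False) (x i γ) (y i γ) := by
  refine (fold hK hKb (init := fun _ _ _ _ => False) false (g := fun i γ _ S => g i γ S) hg
    (read (fun i (q : SnocArr Γ α β (fun _ => Prop) i) => q)
      (hx.ren (inferInstance : Ren fun i (q : SnocArr Γ α β (fun _ => Prop) i) => q.rest))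
      (hy.ren (inferInstance : Ren fun i (q : SnocArr Γ α β (fun _ => Prop) i) => q.rest)))).congr
    fun i γ => ?_
  simp only [stepFold_const]
/-- Polynomially many updates of a function of one variable. -/
theorem fold_fun {K : ∀ i, Γ i → ℕ} (hK : Feasible K)
    (hKb : ∃ b, PolyBound b ∧ ∀ i γ, K i γ ≤ b i.size) {init : ∀ i, Γ i → α i → τ i}
    (hinit : Feasible fun i (q : Snoc Γ α i) => init i q.rest q.top)
    {g : ∀ i, Γ i → ℕ → (α i → τ i) → α i → τ i}
    (hg : Feasible fun i (q : Snoc (SnocArr (Snoc Γ fun _ => ℕ) α (fun _ => Unit) τ) α i) =>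
      g i q.rest.rest.rest q.rest.rest.top (fun a => q.rest.top a ()) q.top)
    {x : ∀ i, Γ i → α i} (hx : Feasible x) :
    Feasible fun i γ => stepFold (g i γ) (K i γ) (init i γ) (x i γ) := by
  refine (fold (α := α) (β := fun _ => Unit) hK hKb (init := fun i γ a _ => init i γ a) hinit.wk
    (g := fun i γ t S a _ => g i γ t (fun a => S a ()) a) hg.wk
    (F := fun i q => q.top (x i q.rest) ()) (read (fun i q => q) hx.wk
      unit)).congr fun i γ => ?_
  generalize K i γ = K
  generalize x i γ = a
  change stepFold (fun t (S : α i → Unit → τ i) a _ => g i γ t (fun a => S a ()) a) K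
    (fun a _ => init i γ a) a () = _
  induction K generalizing a with
  | zero => rfl
  | succ K ih => simp only [stepFold_succ, ih]

theorem size_mul_size : Feasible fun i (_ : Γ i) => i.size * i.size :=
  (sum (α := fun i => Fin i.size) (f := fun i _ _ => i.size) size).congr fun i _ => by simp

omit [Ctx Γ] in
theorem size_poly : ∃ b, PolyBound b ∧ ∀ i (_ : Γ i), i.size ≤ b i.size :=
  ⟨_, .id, fun _ _ => le_rfl⟩

omit [Ctx Γ] in
theorem size_mul_size_poly : ∃ b, PolyBound b ∧ ∀ i (_ : Γ i), i.size * i.size ≤ b i.size :=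
  ⟨_, PolyBound.id.mul .id, fun _ _ => le_rfl⟩

theorem mul_size {x : ∀ i, Γ i → Fin i.n} (hx : Feasible x) :
    Feasible fun i γ => (x i γ : ℕ) * i.size := by
  have h : Feasible fun i γ => ∑ y : Fin i.n, if (y : ℕ) < (x i γ : ℕ) then i.size else 0 :=
    sum (ite (lt (val_n (var fun i (q : Snoc Γ (fun i => Fin i.n) i) => q))
      (val_n (hx.ren (inferInstance : Ren fun i (q : Snoc Γ (fun i => Fin i.n) i) => q.rest))))
      size (lit 0))
  refine h.congr fun i γ => ?_
  rw [← Finset.sum_filter, Finset.sum_const, smul_eq_mul]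
  congr 1
  have : (Finset.univ.filter fun y : Fin i.n => (y : ℕ) < (x i γ : ℕ)) = Finset.Iio (x i γ) := by
    ext y; simp
  rw [this, Fin.card_Iio]

/-- Reachability in a digraph, by iteration. -/
theorem transGen {r : ∀ i, Γ i → α i → α i → Prop}
    (hr : Feasible fun i (q : Snoc (Snoc Γ α) α i) => r i q.rest.rest q.rest.top q.top)
    {x y : ∀ i, Γ i → α i} (hx : Feasible x) (hy : Feasible y) :
    Feasible fun i γ => Relation.TransGen (r i γ) (x i γ) (y i γ) := by
  let _ : ∀ i, Fintype (α i) := fun i => Fintype.ofEquiv _ (equiv i).symm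
  let g : ∀ i, Γ i → (α i → α i → Prop) → α i → α i → Prop := fun i γ S a b =>
    S a b ∨ r i γ a b ∨ ∃ c, r i γ a c ∧ S c b
  have hg : Feasible fun i
      (q : Snoc (Snoc (SnocArr (Snoc Γ fun _ => ℕ) α α fun _ => Prop) α) α i) =>
      g i q.rest.rest.rest.rest q.rest.rest.top q.rest.top q.top :=
    or (read _ (var _) (var _)) (or (hr.app₂ (var _) (var _))
      (ex (and (hr.app₂ (var _) (var _)) (read _ (var _) (var _)))))
  refine (iterate size_mul_size size_mul_size_poly hg hx hy).congr fun i γ => propext ?_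
  have hcard : Fintype.card (α i) ≤ i.size := by
    rw [Fintype.card_congr (equiv i), Fintype.card_fin]; exact card_le i
  have hfix := iterate_inflationary_rel_fixed (g i γ) (fun _ _ _ h => Or.inl h)
    (Nat.mul_le_mul hcard hcard)
  constructor
  · generalize i.size * i.size = K
    generalize x i γ = a
    generalize y i γ = b
    clear hfix
    induction K generalizing a with
    | zero => exact fun h => absurd h id
    | succ K ih =>
      rw [Function.iterate_succ_apply']
      rintro (h | h | ⟨c, hac, hcb⟩)
      · exact ih a h
      · exact .single h
      · exact .head hac (ih c hcb)
  · intro h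
    generalize x i γ = a at h ⊢
    generalize y i γ = b at h ⊢
    generalize hS : ((g i γ)^[i.size * i.size] fun _ _ => False) = S at hfix ⊢
    induction h using Relation.TransGen.head_induction_on with
    | single h => rw [← hfix]; exact Or.inr (Or.inl h)
    | head h _ ih => rw [← hfix]; exact Or.inr (Or.inr ⟨_, h, ih⟩)

end Feasible

end Ram

/-! ### The notions of the model are computable in polynomial time -/

namespace Ram

open Coded Ranged Ctx

namespace Feasible

variable {Γ : Input → Type} [Ctx Γ]

section Basic

variable {x y : ∀ i, Γ i → Fin i.n} {a b : ∀ i, Γ i → Option (Fin i.m)} {s : ∀ i, Γ i → Fin i.m}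

theorem pref (hx : Feasible x) (ha : Feasible a) :
    Feasible fun i γ => (i.P.pref (x i γ) (a i γ) : ℕ) :=
  map₂ hx ha (fun i x a => (i.P.pref x a : ℕ)) (fun c d => .read 0 (.reg c) (.reg d)) 3
    (fun _ _ => le_rfl) fun i M c d x a hM h h' => by
      simp only [Expr.eval, h, h', hM.arr 0 (by omega)]
      rcases a with _ | s <;> simp [input, enc, code]

theorem prio (hs : Feasible s) (hx : Feasible x) :
    Feasible fun i γ => (i.P.prio (s i γ) (x i γ) : ℕ) :=
  map₂ hs hx (fun i s x => (i.P.prio s x : ℕ)) (fun c d => .read 1 (.reg c) (.reg d)) 3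
    (fun _ _ => le_rfl) fun i M c d s x hM h h' => by
      simp only [Expr.eval, h, h', hM.arr 1 (by omega)]
      simp [input, enc]

theorem quota (hs : Feasible s) : Feasible fun i γ => i.P.quota (s i γ) :=
  map hs (fun i s => i.P.quota s) (fun c => .read 2 (.reg c) (.lit 0)) 3
    (fun _ => le_rfl) fun i M c s hM h => by
      simp only [Expr.eval, h, hM.arr 2 (by omega)]
      simp [input, enc]

theorem w {t u : ∀ i, Γ i → ℕ} (ht : Feasible t) (hu : Feasible u) :
    Feasible fun i γ => i.w (t i γ) (u i γ) :=
  map₂ ht hu (fun i t u => i.w t u) (fun c d => .read 3 (.reg c) (.reg d)) 3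
    (fun _ _ => le_rfl) fun i M c d t u hM h h' => by
      simp only [Expr.eval, h, h', hM.arr 3 (by omega)]
      simp [input, enc]

theorem prefers (hx : Feasible x) (ha : Feasible a) (hb : Feasible b) :
    Feasible fun i γ => i.P.Prefers (x i γ) (a i γ) (b i γ) :=
  lt (pref hx ha) (pref hx hb)

theorem higher (hs : Feasible s) (hx : Feasible x) (hy : Feasible y) :
    Feasible fun i γ => i.P.Higher (s i γ) (x i γ) (y i γ) :=
  lt (prio hs hx) (prio hs hy)

/-- Membership in a set that is given by a predicate over a context. -/
theorem mem {α : Input → Type} [Coded α] {B : ∀ i, Γ i → Set (α i)}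
    (hB : Feasible fun i (q : Snoc Γ α i) => q.top ∈ B i q.rest) {Δ : Input → Type} [Ctx Δ]
    {ρ : ∀ i, Δ i → Γ i} [Ren ρ] {x : ∀ i, Δ i → α i} (hx : Feasible x) :
    Feasible fun i δ => x i δ ∈ B i (ρ i δ) :=
  hB.app (F := fun i γ h => h ∈ B i γ) hx

end Basic

/-! ### Deferred acceptance is computable in polynomial time -/

section DeferredAcceptance

variable {x y : ∀ i, Γ i → Fin i.n} {a : ∀ i, Γ i → Option (Fin i.m)} {s : ∀ i, Γ i → Fin i.m}

theorem available {R : ∀ i, Γ i → Fin i.n → Fin i.m → Prop}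
    (hR : Feasible fun i (q : Snoc (Snoc Γ fun i => Fin i.n) (fun i => Fin i.m) i) =>
      R i q.rest.rest q.rest.top q.top) (hx : Feasible x) (ha : Feasible a) :
    Feasible fun i γ => Problem.Available {p | R i γ p.1 p.2} (x i γ) (a i γ) :=
  all (p := fun i γ s => a i γ = Option.some s → ¬ R i γ (x i γ) s)
    (imp (eq ha.wk (some (var _))) (not (hR.app₂ hx.wk (var _))))

theorem applies {R : ∀ i, Γ i → Fin i.n → Fin i.m → Prop}
    (hR : Feasible fun i (q : Snoc (Snoc Γ fun i => Fin i.n) (fun i => Fin i.m) i) =>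
      R i q.rest.rest q.rest.top q.top) (hx : Feasible x) (ha : Feasible a) :
    Feasible fun i γ => i.P.Applies {p | R i γ p.1 p.2} (x i γ) (a i γ) :=
  and (available hR hx ha) (all (p := fun i γ b =>
    Problem.Available {p | R i γ p.1 p.2} (x i γ) b →
      (i.P.pref (x i γ) (a i γ) : ℕ) ≤ i.P.pref (x i γ) b)
    (imp (available (R := fun i (q : Snoc Γ (fun i => Option (Fin i.m)) i) => R i q.rest)
        (hR.app₂ (var _) (var _)) hx.wk (var _))
      (le (pref hx.wk ha.wk) (pref hx.wk (var _)))))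

theorem daRound {R : ∀ i, Γ i → Fin i.n → Fin i.m → Prop}
    (hR : Feasible fun i (q : Snoc (Snoc Γ fun i => Fin i.n) (fun i => Fin i.m) i) =>
      R i q.rest.rest q.rest.top q.top) (hx : Feasible x) (hs : Feasible s) :
    Feasible fun i γ => (x i γ, s i γ) ∈ i.P.daRound {p | R i γ p.1 p.2} :=
  or (hR.app₂ (ρ := fun _ γ => γ) hx hs) (and (applies hR hx (some hs)) (le (quota hs)
    (ncard (p := fun i γ j => i.P.Applies {p | R i γ p.1 p.2} j (Option.some (s i γ)) ∧
      i.P.Higher (s i γ) j (x i γ))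
      (and (applies (R := fun i (q : Snoc Γ (fun i => Fin i.n) i) => R i q.rest)
          (hR.app₂ (var _) (var _)) (var _) (some hs.wk))
        (higher hs.wk (var _) hx.wk)))))

theorem daRejected (hx : Feasible x) (hs : Feasible s) :
    Feasible fun i γ => (x i γ, s i γ) ∈ i.P.daRejected := by
  let g : ∀ i, Γ i → (Fin i.n → Fin i.m → Prop) → Fin i.n → Fin i.m → Prop :=
    fun i _ R x s => (x, s) ∈ i.P.daRound {p | R p.1 p.2}
  refine (iterate (g := g) size_mul_size size_mul_size_poly
    (daRound (R := fun i (q : Snoc (Snoc (SnocArr (Snoc Γ fun _ => ℕ)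
      (fun i => Fin i.n) (fun i => Fin i.m) fun _ => Prop) (fun i => Fin i.n))
      (fun i => Fin i.m) i) x s =>
      q.rest.rest.top x s)
      (read _ (var _) (var _)) (var _) (var _)) hx hs).congr
    fun i γ => propext ?_
  rw [i.P.daRejected_eq_iterate (K := i.size * i.size) (by
    simp only [Fintype.card_fin, Input.size]; exact Nat.mul_le_mul (by omega) (by omega))]
  have h : Function.Semiconj
      (fun R : Fin i.n → Fin i.m → Prop => {p : Fin i.n × Fin i.m | R p.1 p.2}) (g i γ)
      i.P.daRound := fun R => rfl
  have h' := h.iterate_right (i.size * i.size) fun _ _ => False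
  have h0 : {p : Fin i.n × Fin i.m | False} = ∅ := Set.eq_empty_of_forall_notMem fun _ h => h
  dsimp only at h'
  rw [h0] at h'
  rw [← h']
  rfl

theorem da (hx : Feasible x) : Feasible fun i γ => i.P.da (x i γ) :=
  of_graph (fun i γ a => i.P.Applies {p | (p.1, p.2) ∈ i.P.daRejected} (x i γ) a)
    (applies (R := fun i _ x s => (x, s) ∈ i.P.daRejected) (daRejected (var _) (var _)) hx.wk
      (var _))
    fun i _ _ => i.P.applies_daRejected_iff

theorem improvable (hx : Feasible x) : Feasible fun i γ => x i γ ∈ i.P.improvable :=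
  (transGen (r := fun i _ x y => i.P.Envies i.P.da x y)
    (prefers (var _) (da (var _)) (da (var _))) hx hx).congr fun i _ =>
      propext i.P.mem_improvable_iff.symm

theorem label (hx : Feasible x) (hy : Feasible y) {h : ∀ i, Γ i → Fin i.n} (hh : Feasible h) :
    Feasible fun i γ => h i γ ∈ i.P.label (x i γ) (y i γ) :=
  and (improvable hh) (and (prefers hh (da hy) (da hh)) (ex (p := fun i γ s =>
    i.P.da (y i γ) = Option.some s ∧ i.P.Higher s (h i γ) (x i γ))
    (and (eq (da hy.wk) (some (var _))) (higher (var _) hh.wk hx.wk))))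

theorem expEdge {B : ∀ i, Γ i → Set (Fin i.n)}
    (hB : Feasible fun i (q : Snoc Γ (fun i => Fin i.n) i) => q.top ∈ B i q.rest)
    (hx : Feasible x) (hy : Feasible y) :
    Feasible fun i γ => i.P.ExpEdge (B i γ) (x i γ) (y i γ) :=
  and (improvable hx) (and (improvable hy) (and (prefers hx (da hy) (da hx))
    (all (p := fun i γ h => h ∈ i.P.label (x i γ) (y i γ) → h ∈ B i γ)
      (imp (label hx.wk hy.wk (var _)) (mem hB (var _))))))

theorem beneficiaries {μ : ∀ i, Γ i → Fin i.n → Option (Fin i.m)}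
    (hμ : Feasible fun i (q : Snoc Γ (fun i => Fin i.n) i) => μ i q.rest q.top)
    (hx : Feasible x) : Feasible fun i γ => x i γ ∈ i.P.beneficiaries (μ i γ) :=
  prefers hx (hμ.app (ρ := fun _ γ => γ) hx) (da hx)

end DeferredAcceptance

/-! ### The starting point of the expansion phase is computable in polynomial time -/

section Initial

variable {x y : ∀ i, Γ i → Fin i.n} {s : ∀ i, Γ i → Fin i.m}

theorem belowCutoff (hs : Feasible s) (hx : Feasible x) :
    Feasible fun i γ => x i γ ∈ i.P.belowCutoff (s i γ) :=
  (and (improvable hx) (and (prefers hx (some hs) (da hx))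
    (ex (p := fun i γ j => i.P.da j = Option.some (s i γ)) (eq (da (var _)) (some hs.wk))))).congr
      fun i _ => propext i.P.mem_belowCutoff_iff.symm

theorem isJustBelow (hs : Feasible s) (hx : Feasible x) :
    Feasible fun i γ => i.P.IsJustBelow (s i γ) (x i γ) :=
  and (belowCutoff hs hx) (all (p := fun i γ j => j ∈ i.P.belowCutoff (s i γ) →
    (i.P.prio (s i γ) (x i γ) : ℕ) ≤ i.P.prio (s i γ) j)
    (imp (belowCutoff hs.wk (var _)) (le (prio hs.wk hx.wk) (prio hs.wk (var _)))))

theorem firstNext {A : ∀ i, Γ i → Fin i.n → Fin i.n → Prop}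
    (hA : Feasible fun i (q : Snoc (Snoc Γ fun i => Fin i.n) (fun i => Fin i.n) i) =>
      A i q.rest.rest q.rest.top q.top) (hx : Feasible x) :
    Feasible fun i γ => firstNext (A i γ) (x i γ) :=
  of_graph (fun i γ y => (A i γ (x i γ) y ∧ ∀ z, A i γ (x i γ) z → y ≤ z) ∨
      ((∀ z, ¬ A i γ (x i γ) z) ∧ y = x i γ))
    (or (and (hA.app₂ hx.wk (var _)) (all
          (p := fun i (q : Snoc Γ (fun i => Fin i.n) i) z => A i q.rest (x i q.rest) z → q.top ≤ z)
        (imp (hA.app₂ hx.wk (var _)) (le_n (var _) (var _)))))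
      (and (all
          (p := fun i (q : Snoc Γ (fun i => Fin i.n) i) z => ¬ A i q.rest (x i q.rest) z)
          (not (hA.app₂ hx.wk (var _))))
        (eq (var _) hx.wk)))
    fun _ _ _ => (eq_firstNext_iff _ _ _).symm

theorem nextBelow (hx : Feasible x) : Feasible fun i γ => i.P.nextBelow (x i γ) := by
  refine (firstNext (A := fun i _ j k => ∃ s, i.P.da j = Option.some s ∧ i.P.IsJustBelow s k)
    (ex (Γ := Snoc (Snoc Γ fun i => Fin i.n) fun i => Fin i.n)
      (p := fun i q s => i.P.da q.rest.top = Option.some s ∧ i.P.IsJustBelow s q.top)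
      (and (eq (da (var _)) (some (var _))) (isJustBelow (var _) (var _)))) hx).congr fun i γ => ?_
  symm
  rw [eq_firstNext_iff]
  by_cases h : ∃ k s, i.P.da (x i γ) = Option.some s ∧ i.P.IsJustBelow s k
  · obtain ⟨k, s, hs, hk⟩ := h
    rw [i.P.nextBelow_eq hs hk]
    refine Or.inl ⟨⟨s, hs, hk⟩, fun z ⟨s', hs', hz⟩ => ?_⟩
    rw [← i.P.nextBelow_eq hs hk, i.P.nextBelow_eq hs' hz]
  · exact Or.inr ⟨not_exists.1 h, dif_neg h⟩

theorem periodicPerm {f : ∀ i, Γ i → Fin i.n → Fin i.n}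
    (hf : Feasible fun i (q : Snoc Γ (fun i => Fin i.n) i) => f i q.rest q.top) (hx : Feasible x) :
    Feasible fun i γ => periodicPerm (f i γ) (x i γ) := by
  classical
  refine (ite (transGen (r := fun i γ a b => f i γ a = b) (eq (hf.app (var _)) (var _)) hx hx)
    (hf.app (ρ := fun _ γ => γ) hx) hx).congr fun i γ => ?_
  rw [periodicPerm_apply]
  exact if_congr (mem_periodicPts_iff_transGen _ _).symm rfl rfl

theorem jbcPerm (hx : Feasible x) : Feasible fun i γ => i.P.jbcPerm (x i γ) :=
  of_graph (fun i γ y => _root_.periodicPerm i.P.nextBelow y = x i γ)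
    (eq (periodicPerm (f := fun i _ => i.P.nextBelow) (nextBelow (var _)) (var _)) hx.wk)
    fun i _ _ => i.P.jbcPerm_eq_iff.symm.trans eq_comm

theorem injective {g : ∀ i, Γ i → Fin i.n → Fin i.n}
    (hg : Feasible fun i (q : Snoc Γ (fun i => Fin i.n) i) => g i q.rest q.top) :
    Feasible fun i γ => Function.Injective (g i γ) :=
  all (p := fun i γ a => ∀ b, g i γ a = g i γ b → a = b)
    (all (Γ := Snoc Γ fun i => Fin i.n)
      (p := fun i q b => g i q.rest q.top = g i q.rest b → q.top = b)
      (imp (eq (hg.app (var _)) (hg.app (var _))) (eq (var _) (var _))))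

theorem guess {g : ∀ i, Γ i → Fin i.n → ℕ}
    (hg : Feasible fun i (q : Snoc Γ (fun i => Fin i.n) i) => g i q.rest q.top) (hx : Feasible x) :
    Feasible fun i γ => guess (g i γ) (x i γ) :=
  of_graph (fun i γ y => (y : ℕ) = g i γ (x i γ) ∨ ¬ g i γ (x i γ) < i.n ∧ y = x i γ)
    (or (eq (val_n (var _)) (hg.app hx.wk))
      (and (not (lt (hg.app hx.wk) n)) (eq (var _) hx.wk)))
    fun i γ y => by
      unfold _root_.guess
      split_ifs with h
      · simp [h, Fin.ext_iff]
      · have : (y : ℕ) ≠ g i γ (x i γ) := fun h' => h (h' ▸ y.2)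
        simp [h, this]

theorem initial {g : ∀ i, Γ i → Fin i.n → Fin i.n}
    (hg : Feasible fun i (q : Snoc Γ (fun i => Fin i.n) i) => g i q.rest q.top) (hx : Feasible x) :
    Feasible fun i γ => i.P.initial (g i γ) (x i γ) := by
  classical
  have hc : Feasible fun i γ => Function.Injective (g i γ) ∧
      (∀ j, g i γ j = j ∨ i.P.ExpEdge ∅ j (g i γ j)) ∧
        ∀ j, i.P.da (g i γ j) = i.P.da (i.P.jbcPerm j) :=
    and (injective hg) (and
      (all (p := fun i γ j => g i γ j = j ∨ i.P.ExpEdge ∅ j (g i γ j))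
        (or (eq hg (var _)) (expEdge (B := fun _ _ => ∅) false (var _) hg)))
      (all (p := fun i γ j => i.P.da (g i γ j) = i.P.da (i.P.jbcPerm j))
        (eq (da hg) (da (jbcPerm (var _))))))
  refine (ite hc (hg.app (ρ := fun _ γ => γ) hx) (jbcPerm hx)).congr fun i γ => ?_
  unfold Problem.initial
  split_ifs <;> rfl

end Initial

end Feasible

end Ram

/-! ### The expansion phase is computable in polynomial time -/

namespace Ram

open Coded Ranged Ctx

namespace Feasible

variable {Γ : Input → Type} [Ctx Γ]

section Expansion

variable {x y : ∀ i, Γ i → Fin i.n} {s τ g : ∀ i, Γ i → Fin i.n → Fin i.n}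
  {v : ∀ i, Γ i → Fin i.n → Fin i.n → ℕ} {A : ∀ i, Γ i → Fin i.n → Fin i.n → Prop}

theorem allowed (hs : Feasible fun i (q : Snoc Γ (fun i => Fin i.n) i) => s i q.rest q.top)
    (hx : Feasible x) (hy : Feasible y) :
    Feasible fun i γ => i.P.Allowed (s i γ) (x i γ) (y i γ) :=
  or (eq hy (hs.app (ρ := fun _ γ => γ) hx)) (expEdge
    (B := fun i γ => i.P.beneficiaries fun j => i.P.da (s i γ j))
    (beneficiaries (μ := fun i (q : Snoc Γ (fun i => Fin i.n) i) j => i.P.da (s i q.rest j))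
      (da (hs.app (var _))) (var _)) hx hy)

theorem win (hτ : Feasible fun i (q : Snoc Γ (fun i => Fin i.n) i) => τ i q.rest q.top)
    (hx : Feasible x) (hy : Feasible y) :
    Feasible fun i γ => Problem.win (τ i γ) (x i γ) (y i γ) :=
  ite (not (eq (hτ.app (ρ := fun _ γ => γ) hy) hx)) (lit 1) (lit 0)

theorem exchange (hs : Feasible fun i (q : Snoc Γ (fun i => Fin i.n) i) => s i q.rest q.top)
    (hτ : Feasible fun i (q : Snoc Γ (fun i => Fin i.n) i) => τ i q.rest q.top)
    (hx : Feasible x) (hy : Feasible y) :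
    Feasible fun i γ => i.P.Exchange (s i γ) (τ i γ) (x i γ) (y i γ) :=
  and (not (eq hx hy)) (allowed hs hx (hτ.app (ρ := fun _ γ => γ) hy))

theorem reachesTop
    (hv : Feasible fun i (q : Snoc (Snoc Γ fun i => Fin i.n) (fun i => Fin i.n) i) =>
      v i q.rest.rest q.rest.top q.top)
    (hA : Feasible fun i (q : Snoc (Snoc Γ fun i => Fin i.n) (fun i => Fin i.n) i) =>
      A i q.rest.rest q.rest.top q.top) :
    Feasible fun i γ => ReachesTop (v i γ) (A i γ) i.size := by
  have hstep : Feasible fun i (q : Snoc (Snoc (SnocArr (Snoc (Snoc (Snoc Γ fun i => Fin i.n)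
      fun i => Fin i.size) fun _ => ℕ) (fun i => Fin i.n) (fun i => Fin i.size) fun _ => Prop)
      fun i => Fin i.n) (fun i => Fin i.size) i) =>
      levelStep (v i q.rest.rest.rest.rest.rest.rest) (A i q.rest.rest.rest.rest.rest.rest) i.size
        q.rest.rest.top q.rest.top q.top :=
    or (read _ (var _) (var _)) (or (eq (val_size (var _)) (lit 0)) (ex (ex
      (and (hA.app₂ (var _) (var _)) (and (read _ (var _) (var _))
        (eq (add (val_size (var _)) (hv.app₂ (var _) (var _)))
          (add (val_size (var _)) (hv.app₂ (var _) (var _)))))))))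
  have hiter : Feasible fun i (q : Snoc (Snoc Γ fun i => Fin i.n) (fun i => Fin i.size) i) =>
      ((levelStep (v i q.rest.rest) (A i q.rest.rest) i.size)^[i.size * i.size]
        fun _ _ => False) q.rest.top q.top :=
    iterate size_mul_size size_mul_size_poly
      (g := fun i (q : Snoc (Snoc Γ fun i => Fin i.n) (fun i => Fin i.size) i) =>
        levelStep (v i q.rest.rest) (A i q.rest.rest) i.size)
      hstep (var _) (var _)
  have h : Feasible fun i γ => ∃ y, ∃ c : Fin i.size, i.n ≤ (c : ℕ) ∧
      ((levelStep (v i γ) (A i γ) i.size)^[i.size * i.size] fun _ _ => False) y c :=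
    ex (ex (and (le n (val_size (var _))) hiter))
  exact h.congr fun i γ => by simp only [ReachesTop, Fintype.card_fin]

theorem thin
    (hv : Feasible fun i (q : Snoc (Snoc Γ fun i => Fin i.n) (fun i => Fin i.n) i) =>
      v i q.rest.rest q.rest.top q.top)
    (hA : Feasible fun i (q : Snoc (Snoc Γ fun i => Fin i.n) (fun i => Fin i.n) i) =>
      A i q.rest.rest q.rest.top q.top) (hx : Feasible x) (hy : Feasible y) :
    Feasible fun i γ => thin (fun A => ReachesTop (v i γ) A i.size) (Problem.pairNumber i.size)
      (i.size * i.size) (A i γ) (x i γ) (y i γ) := by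
  have hg : Feasible fun i (q : Snoc (Snoc (SnocArr (Snoc Γ fun _ => ℕ) (fun i => Fin i.n)
      (fun i => Fin i.n) fun _ => Prop) fun i => Fin i.n) (fun i => Fin i.n) i) =>
      thinStep (fun A => ReachesTop (v i q.rest.rest.rest.rest) A i.size)
        (Problem.pairNumber i.size) q.rest.rest.rest.top q.rest.rest.top q.rest.top q.top :=
    and (read _ (var _) (var _)) (not (and
      (eq (add (mul_size (var _)) (val_n (var _))) (var _))
      (reachesTop (Γ := Snoc (Snoc (SnocArr (Snoc Γ fun _ => ℕ) (fun i => Fin i.n)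
          (fun i => Fin i.n) fun _ => Prop) fun i => Fin i.n) fun i => Fin i.n)
        (v := fun i q => v i q.rest.rest.rest.rest)
        (A := fun i q => removePair q.rest.rest.top q.rest.top q.top)
        (hv.app₂ (var _) (var _)) (and (read _ (var _) (var _))
          (not (and (eq (var _) (var _)) (eq (var _) (var _))))))))
  exact fold size_mul_size size_mul_size_poly hA
    (g := fun i γ => thinStep (fun A => ReachesTop (v i γ) A i.size) (Problem.pairNumber i.size))
    hg (F := fun i q => q.top (x i q.rest) (y i q.rest)) (read (fun _ q => q) hx.wk hy.wk)

theorem augment (hs : Feasible fun i (q : Snoc Γ (fun i => Fin i.n) i) => s i q.rest q.top)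
    (hτ : Feasible fun i (q : Snoc Γ (fun i => Fin i.n) i) => τ i q.rest q.top)
    (hx : Feasible x) :
    Feasible fun i γ => i.P.augment i.size (s i γ) (τ i γ) (x i γ) := by
  classical
  have hv : Feasible fun i (q : Snoc (Snoc Γ fun i => Fin i.n) (fun i => Fin i.n) i) =>
      Problem.win (τ i q.rest.rest) q.rest.top q.top :=
    win (Γ := Snoc (Snoc Γ fun i => Fin i.n) fun i => Fin i.n)
      (τ := fun i q => τ i q.rest.rest) (hτ.app (var _)) (var _) (var _)
  have hA : Feasible fun i (q : Snoc (Snoc Γ fun i => Fin i.n) (fun i => Fin i.n) i) =>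
      i.P.Exchange (s i q.rest.rest) (τ i q.rest.rest) q.rest.top q.top :=
    exchange (Γ := Snoc (Snoc Γ fun i => Fin i.n) fun i => Fin i.n)
      (s := fun i q => s i q.rest.rest) (τ := fun i q => τ i q.rest.rest)
      (hs.app (var _)) (hτ.app (var _)) (var _) (var _)
  have hnext := firstNext (A := fun i γ => _root_.thin
      (fun A => ReachesTop (Problem.win (τ i γ)) A i.size) (Problem.pairNumber i.size)
      (i.size * i.size) (i.P.Exchange (s i γ) (τ i γ)))
    (thin (Γ := Snoc (Snoc Γ fun i => Fin i.n) fun i => Fin i.n)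
      (v := fun i q => Problem.win (τ i q.rest.rest))
      (A := fun i q => i.P.Exchange (s i q.rest.rest) (τ i q.rest.rest))
      (hv.app₂ (F := fun i γ => Problem.win (τ i γ)) (var _) (var _))
      (hA.app₂ (F := fun i γ => i.P.Exchange (s i γ) (τ i γ)) (var _) (var _)) (var _) (var _)) hx
  refine (ite (reachesTop (v := fun i γ => Problem.win (τ i γ))
    (A := fun i γ => i.P.Exchange (s i γ) (τ i γ)) hv hA)
    (hτ.app (F := τ) (ρ := fun _ γ => γ) hnext)
    (hτ.app (F := τ) (ρ := fun _ γ => γ) hx)).congr fun i γ => ?_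
  unfold Problem.augment
  split_ifs <;> rfl

theorem startRerouting (hs : Feasible fun i (q : Snoc Γ (fun i => Fin i.n) i) => s i q.rest q.top)
    (hg : Feasible fun i (q : Snoc Γ (fun i => Fin i.n) i) => g i q.rest q.top)
    (hx : Feasible x) :
    Feasible fun i γ => i.P.startRerouting (s i γ) (g i γ) (x i γ) := by
  classical
  have hc : Feasible fun i γ => Function.Injective (g i γ) ∧
      ∀ j, i.P.Allowed (s i γ) j (g i γ j) :=
    and (injective hg) (all (p := fun i γ j => i.P.Allowed (s i γ) j (g i γ j))
      (allowed (Γ := Snoc Γ fun i => Fin i.n) (s := fun i q => s i q.rest)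
        (hs.app (var _)) (var _) hg))
  refine (ite hc (hg.app (ρ := fun _ γ => γ) hx) (hs.app (ρ := fun _ γ => γ) hx)).congr
    fun i γ => ?_
  unfold Problem.startRerouting
  split_ifs <;> rfl

theorem expand (hs : Feasible fun i (q : Snoc Γ (fun i => Fin i.n) i) => s i q.rest q.top)
    (hg : Feasible fun i (q : Snoc Γ (fun i => Fin i.n) i) => g i q.rest q.top)
    (hx : Feasible x) :
    Feasible fun i γ => i.P.expand i.size (s i γ) (g i γ) (x i γ) :=
  (fold_fun size size_poly (init := fun i γ => i.P.startRerouting (s i γ) (g i γ))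
    (startRerouting (Γ := Snoc Γ fun i => Fin i.n) (s := fun i q => s i q.rest)
      (g := fun i q => g i q.rest) (hs.app (var _)) (hg.app (var _)) (var _))
    (g := fun i γ _ => i.P.augment i.size (s i γ))
    (augment (Γ := Snoc (SnocArr (Snoc Γ fun _ => ℕ) (fun i => Fin i.n) (fun _ => Unit)
        fun i => Fin i.n) fun i => Fin i.n)
      (s := fun i q => s i q.rest.rest.rest) (τ := fun i q a => q.rest.top a ())
      (hs.app (var _)) (read _ (var _) unit) (var _)) hx).congr fun i γ => by
    rw [stepFold_const, Problem.expand]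

theorem expansion {g : ∀ i, Γ i → ℕ → Fin i.n → Fin i.n}
    (hg : Feasible fun i (q : Snoc (Snoc Γ fun _ => ℕ) (fun i => Fin i.n) i) =>
      g i q.rest.rest q.rest.top q.top) (hx : Feasible x) :
    Feasible fun i γ => i.P.expansion i.size (g i γ) (x i γ) :=
  fold_fun size size_poly (init := fun i γ => i.P.initial (g i γ 0))
    (initial (Γ := Snoc Γ fun i => Fin i.n) (g := fun i q => g i q.rest 0)
      (hg.app₂ (lit 0) (var _)) (var _))
    (g := fun i γ t s => i.P.expand i.size s (g i γ (t + 1)))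
    (expand (Γ := Snoc (SnocArr (Snoc Γ fun _ => ℕ) (fun i => Fin i.n) (fun _ => Unit)
        fun i => Fin i.n) fun i => Fin i.n)
      (s := fun _ q a => q.rest.top a ())
      (g := fun i q => g i q.rest.rest.rest (q.rest.rest.top + 1))
      (read _ (var _) unit) (hg.app₂ (add (var _) (lit 1)) (var _)) (var _)) hx

end Expansion

/-! ### The refinement phase is computable in polynomial time -/

section Refinement

variable {x y : ∀ i, Γ i → Fin i.n} {B : ∀ i, Γ i → Set (Fin i.n)}
  {μ : ∀ i, Γ i → Fin i.n → Option (Fin i.m)}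

theorem admissible
    (hB : Feasible fun i (q : Snoc Γ (fun i => Fin i.n) i) => q.top ∈ B i q.rest)
    (hμ : Feasible fun i (q : Snoc Γ (fun i => Fin i.n) i) => μ i q.rest q.top)
    (hx : Feasible x) (hy : Feasible y) :
    Feasible fun i γ => i.P.Admissible (B i γ) (μ i γ) (x i γ) (y i γ) :=
  and (prefers hx (hμ.app (ρ := fun _ γ => γ) hy) (hμ.app (ρ := fun _ γ => γ) hx))
    (all (p := fun i γ h => h ∈ i.P.improvable → h ≠ y i γ →
        i.P.Prefers h (μ i γ (y i γ)) (i.P.da h) →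
        (∃ s, μ i γ (y i γ) = Option.some s ∧ i.P.Higher s h (x i γ)) → h ∈ B i γ)
      (imp (improvable (var _)) (imp (not (eq (var _) hy.wk))
        (imp (prefers (var _) (hμ.app hy.wk) (da (var _)))
          (imp (ex (p := fun i (q : Snoc Γ (fun i => Fin i.n) i) s =>
              μ i q.rest (y i q.rest) = Option.some s ∧ i.P.Higher s q.top (x i q.rest))
            (and (eq (hμ.app hy.wk) (some (var _))) (higher (var _) (var _) hx.wk)))
            (mem hB (var _)))))))

theorem cycleNext
    (hB : Feasible fun i (q : Snoc Γ (fun i => Fin i.n) i) => q.top ∈ B i q.rest)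
    (hμ : Feasible fun i (q : Snoc Γ (fun i => Fin i.n) i) => μ i q.rest q.top)
    (hx : Feasible x) : Feasible fun i γ => i.P.cycleNext (B i γ) (μ i γ) (x i γ) := by
  have hA : Feasible fun i (q : Snoc (Snoc Γ fun i => Fin i.n) (fun i => Fin i.n) i) =>
      i.P.Admissible (B i q.rest.rest) (μ i q.rest.rest) q.rest.top q.top :=
    admissible (Γ := Snoc (Snoc Γ fun i => Fin i.n) fun i => Fin i.n)
      (B := fun i q => B i q.rest.rest) (μ := fun i q => μ i q.rest.rest)
      (mem hB (var _)) (hμ.app (var _)) (var _) (var _)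
  exact firstNext (A := fun i γ x y => i.P.Admissible (B i γ) (μ i γ) x y ∧
      Relation.TransGen (i.P.Admissible (B i γ) (μ i γ)) y x)
    (and hA (transGen (Γ := Snoc (Snoc Γ fun i => Fin i.n) fun i => Fin i.n)
      (r := fun i q => i.P.Admissible (B i q.rest.rest) (μ i q.rest.rest))
      (hA.app₂ (F := fun i γ x y => i.P.Admissible (B i γ) (μ i γ) x y) (var _) (var _))
      (var _) (var _))) hx

theorem trade
    (hB : Feasible fun i (q : Snoc Γ (fun i => Fin i.n) i) => q.top ∈ B i q.rest)
    (hμ : Feasible fun i (q : Snoc Γ (fun i => Fin i.n) i) => μ i q.rest q.top)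
    {g : ∀ i, Γ i → Fin i.n → Fin i.n}
    (hg : Feasible fun i (q : Snoc Γ (fun i => Fin i.n) i) => g i q.rest q.top)
    (hx : Feasible x) : Feasible fun i γ => i.P.trade (B i γ) (μ i γ) (g i γ) (x i γ) := by
  classical
  have hc : Feasible fun i γ => i.P.ValidTrade (B i γ) (μ i γ) (g i γ) :=
    and (injective hg) (and (ex (p := fun i γ j => g i γ j ≠ j) (not (eq hg (var _))))
      (all (p := fun i γ j => g i γ j ≠ j → i.P.Admissible (B i γ) (μ i γ) j (g i γ j))
        (imp (not (eq hg (var _))) (admissible (Γ := Snoc Γ fun i => Fin i.n)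
          (B := fun i q => B i q.rest) (μ := fun i q => μ i q.rest)
          (mem hB (var _)) (hμ.app (var _)) (var _) hg))))
  refine (ite hc (hg.app (ρ := fun _ γ => γ) hx) (periodicPerm
    (f := fun i γ => i.P.cycleNext (B i γ) (μ i γ))
    (cycleNext (Γ := Snoc Γ fun i => Fin i.n) (B := fun i q => B i q.rest)
      (μ := fun i q => μ i q.rest) (mem hB (var _)) (hμ.app (var _)) (var _)) hx)).congr
      fun i γ => ?_
  unfold Problem.trade
  split_ifs <;> rfl

theorem refinement
    (hB : Feasible fun i (q : Snoc Γ (fun i => Fin i.n) i) => q.top ∈ B i q.rest)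
    (hμ : Feasible fun i (q : Snoc Γ (fun i => Fin i.n) i) => μ i q.rest q.top)
    {g : ∀ i, Γ i → ℕ → Fin i.n → Fin i.n}
    (hg : Feasible fun i (q : Snoc (Snoc Γ fun _ => ℕ) (fun i => Fin i.n) i) =>
      g i q.rest.rest q.rest.top q.top) (hx : Feasible x) :
    Feasible fun i γ => i.P.refinement (B i γ) (i.size * i.size) (g i γ) (μ i γ) (x i γ) :=
  fold_fun size_mul_size size_mul_size_poly (init := μ) hμ
    (g := fun i γ t μ j => μ (i.P.trade (B i γ) μ (g i γ t) j))
    (read _ (trade (Γ := Snoc (SnocArr (Snoc Γ fun _ => ℕ) (fun i => Fin i.n) (fun _ => Unit)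
        fun i => Option (Fin i.m)) fun i => Fin i.n)
      (B := fun i q => B i q.rest.rest.rest) (μ := fun _ q a => q.rest.top a ())
      (g := fun i q => g i q.rest.rest.rest q.rest.rest.top)
      (mem hB (var _)) (read _ (var _) unit) (hg.app₂ (var _) (var _)) (var _)) unit) hx

/-- The procedure is carried out in polynomial time. -/
theorem sjbcPlus (hx : Feasible x) : Feasible fun i γ => i.P.sjbcPlus i.size i.w (x i γ) := by
  have hg : Feasible fun i (q : Snoc (Snoc Γ fun _ => ℕ) (fun i => Fin i.n) i) =>
      _root_.guess (fun j => i.w q.rest.top j) q.top :=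
    guess (Γ := Snoc (Snoc Γ fun _ => ℕ) fun i => Fin i.n) (g := fun i q j => i.w q.rest.top j)
      (w (var _) (val_n (var _))) (var _)
  have hg' : Feasible fun i (q : Snoc (Snoc Γ fun _ => ℕ) (fun i => Fin i.n) i) =>
      _root_.guess (fun j => i.w (q.rest.top + (i.size + 1)) j) q.top :=
    guess (Γ := Snoc (Snoc Γ fun _ => ℕ) fun i => Fin i.n)
      (g := fun i q j => i.w (q.rest.top + (i.size + 1)) j)
      (w (add (var _) (add size (lit 1))) (val_n (var _))) (var _)
  have hμ : Feasible fun i (q : Snoc Γ (fun i => Fin i.n) i) =>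
      i.P.da (i.P.expansion i.size (fun t => _root_.guess fun j => i.w t j) q.top) :=
    da (expansion (Γ := Snoc Γ fun i => Fin i.n) (g := fun i _ t => _root_.guess fun j => i.w t j)
      (hg.app₂ (F := fun i _ t y => _root_.guess (fun j => i.w t j) y)
        (ρ := fun _ q => q.rest.rest.rest)
        (var _) (var _)) (var _))
  exact refinement (B := fun i _ => i.P.beneficiaries fun j =>
      i.P.da (i.P.expansion i.size (fun t => _root_.guess fun j => i.w t j) j))
    (beneficiaries (Γ := Snoc Γ fun i => Fin i.n) (μ := fun i _ j =>
      i.P.da (i.P.expansion i.size (fun t => _root_.guess fun j => i.w t j) j))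
      (hμ.app (F := fun i _ y =>
      i.P.da (i.P.expansion i.size (fun t => _root_.guess fun j => i.w t j) y))
      (ρ := fun _ q => q.rest.rest) (var _)) (var _))
    hμ (g := fun i _ t => _root_.guess fun j => i.w (t + (i.size + 1)) j) hg' hx

end Refinement

end Feasible

end Ram

/-! ### The theorem -/

theorem theorem2 :
    -- properties of every outcome
    (∀ (I S : Type*) [Fintype I] [Fintype S] (P : Problem I S), ¬ P.ParetoEfficient P.da →
      ∀ μ : I → Option S, P.IsSJBCPlusOutcome μ →
        (P.IsMatching μ ∧ P.ParetoDominates μ P.da) ∧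
        P.Justifiable μ ∧
        (∀ μ', P.Justifiable μ' → P.ParetoDominates μ' μ →
          P.beneficiaries μ ⊂ P.beneficiaries μ') ∧
        P.beneficiaries P.jbc ⊆ P.beneficiaries μ) ∧
    -- one program, with polynomially bounded running time, computes an outcome for each way `w` of
    -- resolving the free selections, and every outcome for a suitable `w`
    (∃ (prog : Ram.Program) (C k : ℕ), ∀ (n m : ℕ) (P : Problem (Fin n) (Fin m)),
      (∀ w : ℕ → ℕ → ℕ, ∃ μ t M, P.IsSJBCPlusOutcome μ ∧ Ram.Exec prog (Ram.input P w) t M ∧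
        t ≤ C * (n + m + 1) ^ k ∧ Ram.Outputs M μ) ∧
      (∀ μ, P.IsSJBCPlusOutcome μ → ∃ (w : ℕ → ℕ → ℕ) (t : ℕ) (M : Ram.Memory),
        Ram.Exec prog (Ram.input P w) t M ∧ t ≤ C * (n + m + 1) ^ k ∧ Ram.Outputs M μ)) := by
  refine ⟨fun I S _ _ P h μ hμ => hμ.properties P h, ?_⟩
  obtain ⟨prog, C, k, hprog⟩ := Ram.exists_program (f := fun i => i.P.sjbcPlus i.size i.w)
    (Ram.Feasible.sjbcPlus (Ram.Feasible.var _))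
  refine ⟨prog, C, k, fun n m P => ⟨fun w => ?_, fun μ hμ => ?_⟩⟩
  · obtain ⟨t, M, h1, h2, h3⟩ := hprog ⟨n, m, P, w⟩
    exact ⟨_, t, M, P.isSJBCPlusOutcome_sjbcPlus (L := n + m + 1) (by omega) (by omega) w, h1, h2, h3⟩
  · obtain ⟨w, rfl⟩ := P.exists_sjbcPlus_eq (L := n + m + 1) (by omega) (by omega) hμ
    obtain ⟨t, M, h1, h2, h3⟩ := hprog ⟨n, m, P, w⟩
    exact ⟨w, t, M, h1, h2, h3⟩
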